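/- Let $(M,g)$ be a (non-empty, smooth) oriented Riemannian four-manifold, with Levi-Civita connection $\nabla$. Its twistor space $Z$ is the set of all pairs $(p,J)$ with $p\in M$ and $J$ an endomorphism of $T_pM$ such that $J^2=-\mathrm{Id}$, $g_p(JX,JY)=g_p(X,Y)$ for all $X,Y\in T_pM$, and such that there is a negatively oriented orthonormal basis $(e_1,e_2,e_3,e_4)$ of $T_pM$ with $Je_1=e_2$ and $Je_3=e_4$; it is a six-dimensional submanifold of the total space of $\mathrm{End}(TM)$, with projection $\pi\colon Z\to M$. For a vector $w$ tangent to $\mathrm{End}(TM)$ at $(p,J)$, let $K(w)\in\mathrm{End}(T_pM)$ be its vertical part with respect to the connection induced by $\nabla$ on $\mathrm{End}(TM)$. For $t>0$, let $g_t$ be the Riemannian metric on $Z$ given by $$g_t(v,w)=g(d\pi(v),d\pi(w))+\frac{t^2}{4}\,\mathrm{tr}\big(K(v)^{T}K(w)\big),\qquad v,w\in T_{(p,J)}Z.$$ (Thus $\pi$ is a Riemannian submersion whose fibres are round two-spheres of radius $t$.) A Riemannian $n$-manifold is called locally conformally flat if every point has an open neighbourhood with a smooth chart to an open subset of $\mathbb{R}^n$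 in which the metric is a positive smooth multiple of the Euclidean metric. Theorem. For every non-empty oriented Riemannian four-manifold $(M,g)$ and every $t>0$, the twistor space $(Z,g_t)$ is not locally conformally flat. -/

import Mathlib

open Bundle FiberBundle VectorField Module
open scoped Manifold ContDiff Topology

set_option linter.unusedSectionVars false

noncomputable section

/-! ### The Levi-Civita connection -/

section LeviCivita

variable {E : Type*} [NormedAddCommGroup E] [NormedSpace ℝ E]
  {H : Type*} [TopologicalSpace H] {I : ModelWithCorners ℝ E H}
  {M : Type*} [TopologicalSpace M] [ChartedSpace H M]

instance tangentSpaceFiniteDimensional [FiniteDimensional ℝ E] (x : M) :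
    FiniteDimensional ℝ (TangentSpace I x) :=
  inferInstanceAs (FiniteDimensional ℝ E)

variable [RiemannianBundle (fun x : M => TangentSpace I x)]

/-- The Koszul expression (half the right-hand side of the Koszul formula), whose value is `⟪∇_X Y, Z⟫` for the Levi-Civita connection. -/
def koszul (X Y Z : Π x : M, TangentSpace I x) (x : M) : ℝ :=
  (1 / 2 : ℝ) *
    (d% (fun q => inner ℝ (Y q) (Z q)) x (X x) + d% (fun q => inner ℝ (X q) (Z q)) x (Y x)
      - d% (fun q => inner ℝ (X q) (Y q)) x (Z x)
      + inner ℝ (mlieBracket I X Y x) (Z x) - inner ℝ (mlieBracket I X Z x) (Y x)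
      - inner ℝ (mlieBracket I Y Z x) (X x))

variable [IsManifold I ∞ M]
  [IsContMDiffRiemannianBundle I ∞ E (fun x : M => TangentSpace I x)]

lemma mdifferentiableAt_inner {x : M} {X Y : Π x : M, TangentSpace I x}
    (hX : MDiffAt (T% X) x) (hY : MDiffAt (T% Y) x) :
    MDiffAt (fun q => inner ℝ (X q) (Y q)) x :=
  MDifferentiableAt.inner_bundle hX hY

variable [FiniteDimensional ℝ E]

lemma koszul_tensorial_left {x : M} {Y Z : Π x : M, TangentSpace I x}
    (hY : MDiffAt (T% Y) x) (hZ : MDiffAt (T% Z) x) :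
    TensorialAt I E (koszul · Y Z x) x where
  smul {f X} hf hX := by
    have h1 := mdifferentiableAt_inner hX hY
    have h2 := mdifferentiableAt_inner hX hZ
    simp [koszul, inner_smul_left, inner_smul_right, mvfderiv_fun_mul hf h1,
      mvfderiv_fun_mul hf h2, inner_add_left, mlieBracket_smul_left hf hX]
    ring
  add {X X'} hX hX' := by
    simp [koszul, inner_add_left, inner_add_right,
      mvfderiv_fun_add (mdifferentiableAt_inner hX hY) (mdifferentiableAt_inner hX' hY),
      mvfderiv_fun_add (mdifferentiableAt_inner hX hZ) (mdifferentiableAt_inner hX' hZ),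
      mlieBracket_add_left hX hX']
    ring

lemma koszul_tensorial_right {x : M} {X Y : Π x : M, TangentSpace I x}
    (hX : MDiffAt (T% X) x) (hY : MDiffAt (T% Y) x) :
    TensorialAt I E (koszul X Y · x) x where
  smul {f Z} hf hZ := by
    have h1 := mdifferentiableAt_inner hX hZ
    have h2 := mdifferentiableAt_inner hY hZ
    simp [koszul, inner_smul_left, inner_smul_right, mvfderiv_fun_mul hf h1,
      mvfderiv_fun_mul hf h2, inner_add_left, mlieBracket_smul_right hf hZ]
    rw [real_inner_comm (Z x) (X x), real_inner_comm (Z x) (Y x)]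
    ring
  add {Z Z'} hZ hZ' := by
    simp [koszul, inner_add_left, inner_add_right,
      mvfderiv_fun_add (mdifferentiableAt_inner hY hZ) (mdifferentiableAt_inner hY hZ'),
      mvfderiv_fun_add (mdifferentiableAt_inner hX hZ) (mdifferentiableAt_inner hX hZ'),
      mlieBracket_add_right hZ hZ']
    ring

/-- For a vector field `Y` differentiable at `x`, the form `(X, Z) ↦ ⟪∇_X Y, Z⟫` at `x`. -/
def koszulForm (Y : Π x : M, TangentSpace I x) (x : M) (hY : MDiffAt (T% Y) x) :
    TangentSpace I x →L[ℝ] TangentSpace I x →L[ℝ] ℝ :=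
  TensorialAt.mkHom₂ (koszul · Y · x) x
    (fun _ hZ => koszul_tensorial_left hY hZ) (fun _ hX => koszul_tensorial_right hX hY)

lemma koszulForm_apply {X Y Z : Π x : M, TangentSpace I x} {x : M}
    (hX : MDiffAt (T% X) x) (hY : MDiffAt (T% Y) x) (hZ : MDiffAt (T% Z) x) :
    koszulForm Y x hY (X x) (Z x) = koszul X Y Z x :=
  TensorialAt.mkHom₂_apply _ _ hX hZ

open Classical in
/-- The underlying operator of the Levi-Civita connection: `leviCivitaFun Y x v = (∇_v Y)(x)`. -/
def leviCivitaFun (Y : Π x : M, TangentSpace I x) (x : M) :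
    TangentSpace I x →L[ℝ] TangentSpace I x :=
  if hY : MDiffAt (T% Y) x then
    LinearMap.toContinuousLinearMap
      { toFun := fun v => (InnerProductSpace.toDual ℝ (TangentSpace I x)).symm (koszulForm Y x hY v)
        map_add' := fun v w => by simp
        map_smul' := fun c v => by simp }
  else 0

lemma inner_leviCivitaFun {X Y Z : Π x : M, TangentSpace I x} {x : M}
    (hX : MDiffAt (T% X) x) (hY : MDiffAt (T% Y) x) (hZ : MDiffAt (T% Z) x) :
    inner ℝ (leviCivitaFun Y x (X x)) (Z x) = koszul X Y Z x := by
  rw [leviCivitaFun, dif_pos hY, ← koszulForm_apply hX hY hZ]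
  simp

lemma leviCivitaFun_ext {x : M} {A B : TangentSpace I x →L[ℝ] TangentSpace I x}
    (h : ∀ X Z : Π x : M, TangentSpace I x, MDiffAt (T% X) x → MDiffAt (T% Z) x →
      inner ℝ (A (X x)) (Z x) = inner ℝ (B (X x)) (Z x)) : A = B := by
  ext v
  refine ext_inner_right ℝ fun w => ?_
  simpa using h (extend E v) (extend E w) (mdifferentiableAt_extend ..)
    (mdifferentiableAt_extend ..)

/-- The **Levi-Civita connection** of a Riemannian manifold: `leviCivita Y p v` is `(∇_v Y)(p)`.
It is torsion-free and metric, see `leviCivita_torsion` and `leviCivita_metric`. -/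
def leviCivita : CovariantDerivative I E (TangentSpace I : M → Type _) where
  toFun := leviCivitaFun
  isCovariantDerivativeOnUniv :=
    { add := by
        intro Y Y' x hY hY' _
        refine leviCivitaFun_ext fun X Z hX hZ => ?_
        have hYY := mdifferentiableAt_add_section hY hY'
        rw [add_apply, inner_add_left, inner_leviCivitaFun hX hYY hZ,
          inner_leviCivitaFun hX hY hZ, inner_leviCivitaFun hX hY' hZ]
        simp [koszul, inner_add_left, inner_add_right,
          mvfderiv_fun_add (mdifferentiableAt_inner hY hZ) (mdifferentiableAt_inner hY' hZ),
          mvfderiv_fun_add (mdifferentiableAt_inner hX hY) (mdifferentiableAt_inner hX hY'),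
          mlieBracket_add_right hY hY', mlieBracket_add_left hY hY']
        ring
      leibniz := by
        intro Y f x hY hf _
        refine leviCivitaFun_ext fun X Z hX hZ => ?_
        have hfY := hf.smul_section hY
        have h := inner_leviCivitaFun hX hfY hZ
        have h1 := mdifferentiableAt_inner hY hZ
        have h2 := mdifferentiableAt_inner hX hY
        change inner ℝ (leviCivitaFun (f • Y) x (X x)) (Z x) = _ at h
        rw [h, add_apply, inner_add_left, smul_apply,
          inner_smul_left, inner_leviCivitaFun hX hY hZ]
        change koszul X (f • Y) Z x = _
        simp [koszul, inner_add_left, inner_smul_left, inner_smul_right,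
          mvfderiv_fun_mul hf h1, mvfderiv_fun_mul hf h2,
          mlieBracket_smul_left hf hY, mlieBracket_smul_right hf hY]
        rw [real_inner_comm (Y x) (X x)]
        ring }

/-- The Levi-Civita connection is torsion-free. -/
lemma leviCivita_torsion :
    (leviCivita : CovariantDerivative I E (TangentSpace I : M → Type _)).torsion = 0 := by
  rw [CovariantDerivative.torsion_eq_zero_iff]
  intro X Y x hX hY
  refine ext_inner_right ℝ fun w => ?_
  have hZ : MDiffAt (T% (extend E w : Π x : M, TangentSpace I x)) x := mdifferentiableAt_extend ..
  have h1 := inner_leviCivitaFun hX hY hZ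
  have h2 := inner_leviCivitaFun hY hX hZ
  rw [extend_apply_self] at h1 h2
  change inner ℝ (leviCivitaFun Y x (X x) - leviCivitaFun X x (Y x)) w = _
  rw [inner_sub_left, h1, h2]
  simp only [koszul, extend_apply_self, mlieBracket_swap_apply (V := Y) (W := X), inner_neg_left,
    real_inner_comm]
  ring

/-- The Levi-Civita connection is compatible with the metric. -/
lemma leviCivita_metric {x : M} {X Y Z : Π x : M, TangentSpace I x}
    (hX : MDiffAt (T% X) x) (hY : MDiffAt (T% Y) x) (hZ : MDiffAt (T% Z) x) :
    d% (fun q => inner ℝ (Y q) (Z q)) x (X x) =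
      inner ℝ (leviCivita Y x (X x)) (Z x) + inner ℝ (Y x) (leviCivita Z x (X x)) := by
  have h1 := inner_leviCivitaFun hX hY hZ
  have h2 := inner_leviCivitaFun hX hZ hY
  change _ = inner ℝ (leviCivitaFun Y x (X x)) (Z x) + inner ℝ (Y x) (leviCivitaFun Z x (X x))
  rw [h1, real_inner_comm, h2]
  simp only [koszul, mlieBracket_swap_apply (V := Z) (W := Y), inner_neg_left, real_inner_comm]
  ring
end LeviCivita

/-! ### The twistor space of an oriented Riemannian four-manifold -/

section Twistor

/-- The bundle `End(TM)`, as a smooth manifold: its points are the pairs `(p, J)` with `p : M`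
and `J` an endomorphism of `T_p M`. -/
abbrev EndBundle (M : Type*) [TopologicalSpace M] [ChartedSpace (EuclideanSpace ℝ (Fin 4)) M]
    [IsManifold (𝓡 4) ∞ M] : Type _ :=
  TotalSpace (EuclideanSpace ℝ (Fin 4) →L[ℝ] EuclideanSpace ℝ (Fin 4))
    (fun p : M => TangentSpace (𝓡 4) p →L[ℝ] TangentSpace (𝓡 4) p)

/-- The model with corners of the manifold `End(TM)`. -/
abbrev endModel := (𝓡 4).prod 𝓘(ℝ, EuclideanSpace ℝ (Fin 4) →L[ℝ] EuclideanSpace ℝ (Fin 4))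

variable {M : Type*} [TopologicalSpace M] [ChartedSpace (EuclideanSpace ℝ (Fin 4)) M]
  [IsManifold (𝓡 4) ∞ M]

variable (M) in
/-- An orientation of the four-manifold `M`: a choice of orientation of every tangent space, such
that near every point there is a smooth positively oriented local frame. -/
structure ManifoldOrientation where
  orientation : ∀ p : M, Orientation ℝ (TangentSpace (𝓡 4) p) (Fin 4)
  exists_frame : ∀ p₀ : M, ∃ U ∈ 𝓝 p₀, ∃ X : Fin 4 → Π p : M, TangentSpace (𝓡 4) p,
    (∀ i, ContMDiffOn (𝓡 4) (𝓡 4).tangent ∞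
      (fun p => (⟨p, X i p⟩ : TangentBundle (𝓡 4) M)) U) ∧
    ∀ p ∈ U, ∃ b : Basis (Fin 4) ℝ (TangentSpace (𝓡 4) p),
      (∀ i, b i = X i p) ∧ b.orientation = orientation p

variable [RiemannianBundle (fun p : M => TangentSpace (𝓡 4) p)]
  [IsContMDiffRiemannianBundle (𝓡 4) ∞ (EuclideanSpace ℝ (Fin 4))
    (fun p : M => TangentSpace (𝓡 4) p)]

/-- The **twistor space** `Z = Z_-` of `(M, g)`, as a (six-dimensional, embedded) submanifold of
`End(TM)`: the pairs `(p, J)` such that `J` is a complex structure on `T_p M` compatible with the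
metric, which belongs to the component given by the negatively oriented orthonormal frames: there
is such a frame `e` with `J e₀ = e₁` and `J e₂ = e₃`. -/
def twistorSpace (o : ManifoldOrientation M) : Set (EndBundle M) :=
  {z | (∀ X : TangentSpace (𝓡 4) z.proj, z.snd (z.snd X) = -X) ∧
    (∀ X Y : TangentSpace (𝓡 4) z.proj, inner ℝ (z.snd X) (z.snd Y) = inner ℝ X Y) ∧
    ∃ e : OrthonormalBasis (Fin 4) ℝ (TangentSpace (𝓡 4) z.proj),
      e.toBasis.orientation = -o.orientation z.proj ∧
      z.snd (e 0) = e 1 ∧ z.snd (e 2) = e 3}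

/-- The covariant derivative `(∇_ξ σ)(Y)` at `p` of a section `σ` of `End(TM)`, for the connection
induced by the Levi-Civita connection: `(∇_ξ σ)(Y) = ∇_ξ (σ(Y)) - σ(∇_ξ Y)`, where the vector `Y`
at `p` is extended to a smooth local vector field. -/
def covEnd (σ : Π p : M, TangentSpace (𝓡 4) p →L[ℝ] TangentSpace (𝓡 4) p) (p : M)
    (ξ Y : TangentSpace (𝓡 4) p) : TangentSpace (𝓡 4) p :=
  let Yext : Π q : M, TangentSpace (𝓡 4) q := extend (EuclideanSpace ℝ (Fin 4)) Y
  leviCivita (fun q => σ q (Yext q)) p ξ - σ p (leviCivita Yext p ξ)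

/-- The connection map `TEnd(TM) → End(TM)`. For a tangent vector `w` of `End(TM)` at `z = (p, J)`,
it is the endomorphism `K(w)` of `T_p M` that is the vertical part of `w` with respect to the
horizontal distribution of the induced connection, evaluated here on `Y`.
With `ξ` the projection of `w` to `T_p M` and `σ` a smooth local section of `End(TM)` through `z`,
the vector `w - dσ(ξ)` is tangent to the fibre `End(T_p M)`, hence an endomorphism `A` of `T_p M`,
and `K(w) = A + ∇_ξ σ`. So `K(dσ(ξ)) = ∇_ξ σ` for sections `σ`, and `K` is the identity on vertical
vectors. In the preferred chart at `z` the fibre `End(T_p M)` has its own linear coordinates, so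
that `A` is the second component of `w - dσ(ξ)`. -/
def connector (z : EndBundle M) (w : TangentSpace endModel z) (Y : TangentSpace (𝓡 4) z.proj) :
    TangentSpace (𝓡 4) z.proj :=
  let ξ : TangentSpace (𝓡 4) z.proj := mfderiv endModel (𝓡 4) TotalSpace.proj z w
  let σ : Π q : M, TangentSpace (𝓡 4) q →L[ℝ] TangentSpace (𝓡 4) q :=
    extend (EuclideanSpace ℝ (Fin 4) →L[ℝ] EuclideanSpace ℝ (Fin 4)) z.snd
  let dσ : TangentSpace endModel (⟨z.proj, σ z.proj⟩ : EndBundle M) :=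
    mfderiv (𝓡 4) endModel (fun q => (⟨q, σ q⟩ : EndBundle M)) z.proj ξ
  let A : TangentSpace (𝓡 4) z.proj →L[ℝ] TangentSpace (𝓡 4) z.proj := w.2 - dσ.2
  A Y + covEnd σ z.proj ξ Y

/-- The metric `g_t` of the twistor space, at `z = (p, J)`: the horizontal and vertical subspaces are
orthogonal, the projection to `(M, g)` is isometric on horizontal vectors, and on the fibre the
metric is `t² / 4` times the trace inner product `tr(Aᵀ B)` of endomorphisms of `T_p M`, which
makes the fibre a round two-sphere of radius `t`. It is written for all tangent vectors of
`End(TM)` at `z`, and is to be applied to those that are tangent to the twistor space. -/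
def twistorMetric (t : ℝ) (z : EndBundle M) (v w : TangentSpace endModel z) : ℝ :=
  inner ℝ (mfderiv endModel (𝓡 4) TotalSpace.proj z v : TangentSpace (𝓡 4) z.proj)
    (mfderiv endModel (𝓡 4) TotalSpace.proj z w : TangentSpace (𝓡 4) z.proj) +
  t ^ 2 / 4 * ∑ i, inner ℝ
    (connector z v (stdOrthonormalBasis ℝ (TangentSpace (𝓡 4) z.proj) i))
    (connector z w (stdOrthonormalBasis ℝ (TangentSpace (𝓡 4) z.proj) i))

end Twistor

/-! ### Local conformal flatness -/

section LCF
variable {F : Type*} [NormedAddCommGroup F] [NormedSpace ℝ F]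
  {K : Type*} [TopologicalSpace K] {J : ModelWithCorners ℝ F K}
  {N : Type*} [TopologicalSpace N] [ChartedSpace K N]

/-- Let `S` be an `n`-dimensional embedded submanifold of the smooth manifold `N`, and let `G z`,
restricted to the vectors tangent to `S` at `z`, be a Riemannian metric on `S`. The Riemannian
manifold `(S, G)` is *locally conformally flat* if every point of `S` has an open neighbourhood in
`S` with a chart `φ` to an open subset of `ℝⁿ` that is conformal: the inverse of `φ` is smooth as a
map to `N` and pulls `G` back to a positive smooth multiple `ρ` of the Euclidean metric. (The last
condition makes the inverse of `φ` an immersion, so `φ` is a chart of the submanifold `S`.) -/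
def IsLocallyConformallyFlat (n : ℕ) (S : Set N)
    (G : ∀ z : N, TangentSpace J z → TangentSpace J z → ℝ) : Prop :=
  ∀ z : S, ∃ (φ : OpenPartialHomeomorph S (EuclideanSpace ℝ (Fin n)))
    (ρ : EuclideanSpace ℝ (Fin n) → ℝ),
    z ∈ φ.source ∧
    ContMDiffOn (𝓡 n) J ∞ (fun x => (φ.symm x : N)) φ.target ∧
    ContDiffOn ℝ ∞ ρ φ.target ∧
    ∀ x ∈ φ.target, 0 < ρ x ∧ ∀ v w : EuclideanSpace ℝ (Fin n),
      G (φ.symm x) (mfderiv (𝓡 n) J (fun y => (φ.symm y : N)) x v)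
        (mfderiv (𝓡 n) J (fun y => (φ.symm y : N)) x w) = ρ x * inner ℝ v w
end LCF

end

set_option linter.unusedSectionVars false

/-! ### Connections and vector-valued one-forms on an open subset of a vector space -/

section Calculus

variable {W : Type*} [NormedAddCommGroup W] [NormedSpace ℝ W]
  {B : Type*} [NormedAddCommGroup B] [NormedSpace ℝ B]
  {G : Type*} [NormedAddCommGroup G] [NormedSpace ℝ G]

/-! Fix p in M. A conformally flat chart near a point of the fibre over p is a map from an open set
of ℝ⁶ into Z, and everything is pulled back to ℝ⁶. A negatively oriented orthonormal frame of M
turns the horizontal part of the derivative into an ℝ⁴-valued one-form θ, torsion-free for the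
Levi-Civita form. It also presents Z as the unit sphere bundle of the three-dimensional bundle Λ₋,
with tautological section Y. The vertical part is E = t∇Y, and its covariant exterior derivative is
t times the curvature of Λ₋ applied to Y, written tF. Conformal flatness says |θ|² + |E|² = ρ|·|².

The curvature of a plane is now computed twice. From ρ only the Hessian enters, and for orthogonal
vectors of equal length the result is a term in one vector plus a term in the other; hence K(V₀,V₁)
+ K(eᵢ,eⱼ) = K(V₀,eᵢ) + K(V₁,eⱼ) for vertical V and horizontal e (`planeCurv_add`). From the bundle
side, the Gauss equation `planeCurv_inner` and the Koszul formula give O'Neill's values: 1/t² on the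
fibre, K_M − ¾|tF(eᵢ,eⱼ)|² on horizontal planes, ¼ Σₖ⟨tF(eₖ,eᵢ),V⟩² on mixed planes. The remaining
terms are squares of derivatives of log ρ, which cancel. The outcome is `Lifts.curv_identity`.

Every point of the fibre has such a chart, so the identity holds for every orthonormal basis f of
three-space, with Y = f₂ and tF(eᵢ,eⱼ) = nᵢⱼ × f₂. Varying f shows that the forms 3 n₀ⱼ⊗n₀ⱼ + Σₖ
n₀ₖ⊗n₀ₖ are multiples of the inner product; summing over j, so is each n₀ⱼ⊗n₀ⱼ, and having rank at
most one in dimension three it vanishes (`asd_eq_zero_of_identity`). Thus Λ₋ is flat at p and the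
identity leaves K_M(eᵢ,eⱼ) = −1/t². But flatness of Λ₋ and the Bianchi identity force the curvatures
of the planes through e₀ to add up to zero (`false_of_asdPart_eq_zero`), a contradiction.

It remains to connect the invariant definitions on End(TM) with this local picture:
`inner_connector` expresses the vertical part by derivatives of matrix entries,
`asdMatrix_add_asdAct` recognises the induced connection of Λ₋, and `twistorMetric_mfderiv` combines
them. -/

/-- The covariant derivative of `s` in the constant direction `a`, for the connection form `C`. -/
noncomputable def covDir (C : W → W →L[ℝ] G →L[ℝ] G) (a : W) (s : W → G) (x : W) : G :=
  fderiv ℝ s x a + C x a (s x)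

/-- The exterior derivative of a vector-valued one-form. -/
noncomputable def extD (α : W → W →L[ℝ] G) (x a b : W) : G :=
  fderiv ℝ α x a b - fderiv ℝ α x b a

/-- The curvature of the connection form `C`. -/
noncomputable def curv (C : W → W →L[ℝ] G →L[ℝ] G) (x a b : W) : G →L[ℝ] G :=
  extD C x a b + (C x a ∘L C x b - C x b ∘L C x a)

lemma curv_apply (C : W → W →L[ℝ] G →L[ℝ] G) (x a b : W) (v : G) :
    curv C x a b v =
        fderiv ℝ C x a b v - fderiv ℝ C x b a v + (C x a (C x b v) - C x b (C x a v)) :=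
  rfl

/-- The covariant exterior derivative of the one-form `Θ`, for the connection form `C`. -/
noncomputable def tors (C : W → W →L[ℝ] G →L[ℝ] G) (Θ : W → W →L[ℝ] G) (x a b : W) : G :=
  extD Θ x a b + (C x a (Θ x b) - C x b (Θ x a))

/-- The pullback of the one-form `α` by `X`. -/
noncomputable def pullForm (X : W → B) (α : B → B →L[ℝ] G) (x : W) : W →L[ℝ] G :=
  α (X x) ∘L fderiv ℝ X x

lemma fderiv_eval {α : W → W →L[ℝ] G} {x : W} (h : DifferentiableAt ℝ α x) (a b : W) :
    fderiv ℝ (fun y => α y b) x a = fderiv ℝ α x a b := by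
  have := h.hasFDerivAt.clm_apply (hasFDerivAt_const b x)
  rw [this.fderiv]; simp

lemma tors_eq {C : W → W →L[ℝ] G →L[ℝ] G} {Θ : W → W →L[ℝ] G} {x : W}
    (h : DifferentiableAt ℝ Θ x) (a b : W) :
    tors C Θ x a b = covDir C a (fun y => Θ y b) x - covDir C b (fun y => Θ y a) x := by
  simp only [tors, covDir, extD, fderiv_eval h]; abel

lemma covDir_sub {C : W → W →L[ℝ] G →L[ℝ] G} {a : W} {s r : W → G} {x : W}
    (hs : DifferentiableAt ℝ s x) (hr : DifferentiableAt ℝ r x) :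
    covDir C a (fun y => s y - r y) x = covDir C a s x - covDir C a r x := by
  simp only [covDir, fderiv_fun_sub hs hr, map_sub, sub_apply]
  abel

lemma covDir_congr {C : W → W →L[ℝ] G →L[ℝ] G} {a : W} {s r : W → G} {x : W}
    (h : s =ᶠ[𝓝 x] r) : covDir C a s x = covDir C a r x := by
  simp only [covDir, h.fderiv_eq, h.eq_of_nhds]

lemma ContDiffAt.covDir {C : W → W →L[ℝ] G →L[ℝ] G} {a : W} {s : W → G} {x : W} {m n : WithTop ℕ∞}
    (hC : ContDiffAt ℝ m C x) (hs : ContDiffAt ℝ n s x) (hmn : m + 1 ≤ n) :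
    ContDiffAt ℝ m (covDir C a s) x := by
  have h1 : ContDiffAt ℝ m (fun y => fderiv ℝ s y a) x :=
    (hs.fderiv_right hmn).clm_apply contDiffAt_const
  have h2 : ContDiffAt ℝ m (fun y => C y a (s y)) x :=
    (hC.clm_apply contDiffAt_const).clm_apply (hs.of_le (le_trans le_self_add hmn))
  exact h1.add h2

/-- The directions are constant, hence commute, so no bracket term appears; symmetry of the second
derivative leaves only the curvature. -/
lemma covDir_comm {C : W → W →L[ℝ] G →L[ℝ] G} {s : W → G} {x : W} (a b : W)
    (hC : ContDiffAt ℝ 1 C x) (hs : ContDiffAt ℝ 2 s x) :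
    covDir C a (covDir C b s) x - covDir C b (covDir C a s) x = curv C x a b (s x) := by
  have hC' : DifferentiableAt ℝ C x := hC.differentiableAt (by norm_num)
  have hs1 : DifferentiableAt ℝ s x := hs.differentiableAt (by norm_num)
  have hs2 : DifferentiableAt ℝ (fderiv ℝ s) x :=
    (hs.fderiv_right (m := 1) (by norm_num)).differentiableAt (by norm_num)
  have key : ∀ a b : W, fderiv ℝ (covDir C b s) x a =
      fderiv ℝ (fderiv ℝ s) x a b + (fderiv ℝ C x a b (s x) + C x b (fderiv ℝ s x a)) := by
    intro a b
    have h1 := hs2.hasFDerivAt.clm_apply (hasFDerivAt_const b x)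
    have hCb : DifferentiableAt ℝ (fun y => C y b) x := hC'.clm_apply (differentiableAt_const b)
    have h3 : HasFDerivAt (covDir C b s) _ x := h1.add (hCb.hasFDerivAt.clm_apply hs1.hasFDerivAt)
    rw [h3.fderiv, ← fderiv_eval hC' a b, add_comm (fderiv ℝ (fun y => C y b) x a (s x))]
    simp
  have hsymm : fderiv ℝ (fderiv ℝ s) x a b = fderiv ℝ (fderiv ℝ s) x b a :=
    (hs.isSymmSndFDerivAt (by simp)).eq a b
  simp only [covDir] at key ⊢
  rw [key a b, key b a, hsymm]
  rw [curv_apply, (C x a).map_add, (C x b).map_add]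
  abel

/-- The first Bianchi identity for a connection without torsion. -/
lemma curv_cyclic {C : W → W →L[ℝ] G →L[ℝ] G} {Θ : W → W →L[ℝ] G} {x : W}
    (hC : ContDiffAt ℝ 1 C x) (hΘ : ContDiffAt ℝ 2 Θ x)
    (hT : ∀ᶠ y in 𝓝 x, ∀ a b, tors C Θ y a b = 0) (a b c : W) :
    curv C x a b (Θ x c) + curv C x b c (Θ x a) + curv C x c a (Θ x b) = 0 := by
  have hev : ∀ a : W, ContDiffAt ℝ 2 (fun y => Θ y a) x := fun a => hΘ.clm_apply contDiffAt_const
  have hd : ∀ᶠ y in 𝓝 x, DifferentiableAt ℝ Θ y :=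
    (hΘ.eventually (by simp)).mono fun y h => h.differentiableAt (by norm_num)
  have hsym : ∀ a b : W, covDir C a (fun y => Θ y b) =ᶠ[𝓝 x] covDir C b (fun y => Θ y a) := by
    intro a b
    filter_upwards [hT, hd] with y hy hdy
    have := hy a b
    rw [tors_eq hdy] at this
    exact sub_eq_zero.mp this
  rw [← covDir_comm a b hC (hev c), ← covDir_comm b c hC (hev a), ← covDir_comm c a hC (hev b),
    covDir_congr (a := a) (hsym b c), covDir_congr (a := b) (hsym c a),
    covDir_congr (a := c) (hsym a b)]
  abel

/-- The extra term contains the second derivative of `X` and dies by its symmetry. -/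
lemma extD_pullForm {X : W → B} {α : B → B →L[ℝ] G} {x : W} (hX : ContDiffAt ℝ 2 X x)
    (hα : DifferentiableAt ℝ α (X x)) (a b : W) :
    extD (pullForm X α) x a b = extD α (X x) (fderiv ℝ X x a) (fderiv ℝ X x b) := by
  have hX1 : DifferentiableAt ℝ X x := hX.differentiableAt (by norm_num)
  have hX2 : DifferentiableAt ℝ (fderiv ℝ X) x :=
    (hX.fderiv_right (m := 1) (by norm_num)).differentiableAt (by norm_num)
  have h := (hα.hasFDerivAt.comp x hX1.hasFDerivAt).clm_comp hX2.hasFDerivAt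
  have h' : HasFDerivAt (pullForm X α) _ x := h
  have hsymm : fderiv ℝ (fderiv ℝ X) x a b = fderiv ℝ (fderiv ℝ X) x b a :=
    (hX.isSymmSndFDerivAt (by simp)).eq a b
  simp only [extD, h'.fderiv]
  simp [hsymm]

lemma tors_pullForm {X : W → B} {C : B → B →L[ℝ] G →L[ℝ] G} {θ : B → B →L[ℝ] G} {x : W}
    (hX : ContDiffAt ℝ 2 X x) (hθ : DifferentiableAt ℝ θ (X x)) (a b : W) :
    tors (pullForm X C) (pullForm X θ) x a b
      = tors C θ (X x) (fderiv ℝ X x a) (fderiv ℝ X x b) := by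
  simp [tors, extD_pullForm hX hθ, pullForm]

lemma curv_pullForm {X : W → B} {C : B → B →L[ℝ] G →L[ℝ] G} {x : W}
    (hX : ContDiffAt ℝ 2 X x) (hC : DifferentiableAt ℝ C (X x)) (a b : W) :
    curv (pullForm X C) x a b = curv C (X x) (fderiv ℝ X x a) (fderiv ℝ X x b) := by
  simp [curv, extD_pullForm hX hC, pullForm]

lemma ContDiffAt.pullForm {X : W → B} {α : B → B →L[ℝ] G} {x : W} {m n : WithTop ℕ∞}
    (hX : ContDiffAt ℝ n X x) (hα : ContDiffAt ℝ m α (X x)) (hmn : m + 1 ≤ n) :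
    ContDiffAt ℝ m (pullForm X α) x :=
  (hα.comp x (hX.of_le (le_trans le_self_add hmn))).clm_comp (hX.fderiv_right hmn)

end Calculus

/-! ### Second derivatives of a metric and the Gauss equation -/

section MetricCalculus

variable {W : Type*} [NormedAddCommGroup W] [NormedSpace ℝ W]
  {V : Type*} [NormedAddCommGroup V] [InnerProductSpace ℝ V]

/-- The second derivative of `f` along the constant directions `a` and `b`. -/
noncomputable def secondDir (f : W → ℝ) (x a b : W) : ℝ :=
  fderiv ℝ (fun y => fderiv ℝ f y a) x b

lemma fderiv_inner_covDir {C : W → W →L[ℝ] V →L[ℝ] V} {s r : W → V} {x : W}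
    (hs : DifferentiableAt ℝ s x) (hr : DifferentiableAt ℝ r x)
    (hC : ∀ a u v, inner ℝ (C x a u) v + inner ℝ u (C x a v) = 0) (a : W) :
    fderiv ℝ (fun y => inner ℝ (s y) (r y)) x a =
      inner ℝ (covDir C a s x) (r x) + inner ℝ (s x) (covDir C a r x) := by
  rw [fderiv_inner_apply ℝ hs hr]
  have := hC a (s x) (r x)
  simp only [covDir, inner_add_left, inner_add_right]
  linarith

lemma secondDir_inner {C : W → W →L[ℝ] V →L[ℝ] V} {s r : W → V} {x : W}
    (hCd : ContDiffAt ℝ 1 C x) (hs : ContDiffAt ℝ 2 s x) (hr : ContDiffAt ℝ 2 r x)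
    (hC : ∀ᶠ y in 𝓝 x, ∀ a u v, inner ℝ (C y a u) v + inner ℝ u (C y a v) = 0) (a b : W) :
    secondDir (fun y => inner ℝ (s y) (r y)) x a b =
      inner ℝ (covDir C b (covDir C a s) x) (r x) + inner ℝ (covDir C a s x) (covDir C b r x) +
      inner ℝ (covDir C b s x) (covDir C a r x) + inner ℝ (s x) (covDir C b (covDir C a r) x) := by
  have h1 : (fun y => fderiv ℝ (fun y => inner ℝ (s y) (r y)) y a) =ᶠ[𝓝 x]
      fun y => inner ℝ (covDir C a s y) (r y) + inner ℝ (s y) (covDir C a r y) := by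
    filter_upwards [hC, hs.eventually (by simp), hr.eventually (by simp)] with y hy hsy hry
    exact fderiv_inner_covDir (hsy.differentiableAt (by norm_num))
      (hry.differentiableAt (by norm_num)) hy a
  have ds := hs.differentiableAt (n := 2) (by norm_num)
  have dr := hr.differentiableAt (n := 2) (by norm_num)
  have dds := (hCd.covDir (a := a) hs (by norm_num)).differentiableAt (by norm_num)
  have ddr := (hCd.covDir (a := a) hr (by norm_num)).differentiableAt (by norm_num)
  rw [secondDir, h1.fderiv_eq, fderiv_fun_add (dds.inner ℝ dr) (ds.inner ℝ ddr)]
  rw [add_apply, fderiv_inner_covDir dds dr hC.self_of_nhds,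
    fderiv_inner_covDir ds ddr hC.self_of_nhds]
  ring

/-- The combination of second derivatives of a family of bilinear forms `h` which gives the
sectional curvature of the plane spanned by `a` and `b` in normal coordinates. -/
noncomputable def planeCurv (h : W → W → W → ℝ) (x a b : W) : ℝ :=
  2 * secondDir (fun y => h y a b) x a b - secondDir (fun y => h y b b) x a a
    - secondDir (fun y => h y a a) x b b

/-- The Gauss equation for the bilinear form induced by a one-form with values in a vector bundle
with a metric connection. -/
lemma planeCurv_inner {C : W → W →L[ℝ] V →L[ℝ] V} {Θ : W → W →L[ℝ] V} {x : W}
    (hCd : ContDiffAt ℝ 1 C x) (hΘ : ContDiffAt ℝ 2 Θ x)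
    (hC : ∀ᶠ y in 𝓝 x, ∀ a u v, inner ℝ (C y a u) v + inner ℝ u (C y a v) = 0) (a b : W) :
    planeCurv (fun y v w => inner ℝ (Θ y v) (Θ y w)) x a b =
      2 * (inner ℝ (curv C x b a (Θ x a)) (Θ x b)
        + inner ℝ (covDir C a (fun y => tors C Θ y b a) x) (Θ x b)
        + inner ℝ (covDir C b (fun y => tors C Θ y a b) x) (Θ x a)
        + inner ℝ (covDir C a (fun y => Θ y a) x) (covDir C b (fun y => Θ y b) x)
        - inner ℝ (covDir C a (fun y => Θ y b) x) (covDir C b (fun y => Θ y a) x)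
        - inner ℝ (tors C Θ x a b) (tors C Θ x a b)) := by
  have hev : ∀ a : W, ContDiffAt ℝ 2 (fun y => Θ y a) x := fun a => hΘ.clm_apply contDiffAt_const
  have hd : ∀ᶠ y in 𝓝 x, DifferentiableAt ℝ Θ y :=
    (hΘ.eventually (by simp)).mono fun y h => h.differentiableAt (by norm_num)
  have dd : ∀ a b : W, DifferentiableAt ℝ (covDir C a (fun y => Θ y b)) x := fun a b =>
    (hCd.covDir (hev b) (by norm_num)).differentiableAt (by norm_num)
  have hT : ∀ a b c : W, covDir C c (fun y => tors C Θ y a b) x =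
      covDir C c (covDir C a (fun y => Θ y b)) x - covDir C c (covDir C b (fun y => Θ y a)) x := by
    intro a b c
    rw [← covDir_sub (dd a b) (dd b a)]
    apply covDir_congr
    filter_upwards [hd] with y hy
    exact tors_eq hy a b
  -- The second covariant derivatives of `Θ` combine into derivatives of the torsion, except for one
  -- commutator, which is the curvature term.
  have hcomm := covDir_comm b a hCd (hev a)
  rw [planeCurv, secondDir_inner hCd (hev a) (hev b) hC, secondDir_inner hCd (hev b) (hev b) hC,
    secondDir_inner hCd (hev a) (hev a) hC, hT, hT, tors_eq hd.self_of_nhds, ← hcomm]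
  simp only [inner_sub_left, inner_sub_right]
  rw [real_inner_comm (covDir C b (covDir C a fun y => Θ y b) x),
    real_inner_comm (covDir C a (covDir C a fun y => Θ y b) x),
    real_inner_comm (covDir C b (covDir C b fun y => Θ y a) x),
    real_inner_comm (covDir C b (fun y => Θ y b) x) (covDir C a (fun y => Θ y a) x),
    real_inner_comm (covDir C a (fun y => Θ y b) x) (covDir C b (fun y => Θ y a) x)]
  ring

/-- For orthogonal `a`, `b` of equal length this is a function of `a` plus a function of `b`; that
additivity is the only use made of conformal flatness at second order. -/
lemma planeCurv_smul_inner {W : Type*} [NormedAddCommGroup W] [InnerProductSpace ℝ W]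
    {ρ : W → ℝ} {x : W} (hρ : ContDiffAt ℝ 2 ρ x) (a b : W) :
    planeCurv (fun y v w => ρ y * inner ℝ v w) x a b =
      2 * secondDir ρ x a b * inner ℝ a b - secondDir ρ x a a * inner ℝ b b
        - secondDir ρ x b b * inner ℝ a a := by
  have key : ∀ (c : ℝ) (a b : W), secondDir (fun y => ρ y * c) x a b = secondDir ρ x a b * c := by
    intro c a b
    have h1 : (fun y => fderiv ℝ (fun z => ρ z * c) y a) =ᶠ[𝓝 x] fun y => fderiv ℝ ρ y a * c := by
      filter_upwards [hρ.eventually (by simp)] with y hy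
      rw [fderiv_mul_const (hy.differentiableAt (by norm_num))]
      simp [mul_comm]
    have h2 : DifferentiableAt ℝ (fun y => fderiv ℝ ρ y a) x :=
      ((hρ.fderiv_right (m := 1) (by norm_num)).clm_apply
        contDiffAt_const).differentiableAt (by norm_num)
    rw [secondDir, h1.fderiv_eq, fderiv_mul_const h2]
    simp [secondDir, mul_comm]
  simp only [planeCurv, key]
  ring

lemma secondDir_congr {f g : W → ℝ} {x : W} (h : f =ᶠ[𝓝 x] g) (a b : W) :
    secondDir f x a b = secondDir g x a b := by
  have : (fun y => fderiv ℝ f y a) =ᶠ[𝓝 x] fun y => fderiv ℝ g y a :=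
    (h.fderiv (𝕜 := ℝ)).mono fun y hy => by simp [hy]
  rw [secondDir, this.fderiv_eq, secondDir]

lemma secondDir_add {f g : W → ℝ} {x : W} (hf : ContDiffAt ℝ 2 f x) (hg : ContDiffAt ℝ 2 g x)
    (a b : W) :
    secondDir (fun y => f y + g y) x a b = secondDir f x a b + secondDir g x a b := by
  have h1 : (fun y => fderiv ℝ (fun z => f z + g z) y a) =ᶠ[𝓝 x]
      fun y => fderiv ℝ f y a + fderiv ℝ g y a := by
    filter_upwards [hf.eventually (by simp), hg.eventually (by simp)] with y hy hy'
    rw [fderiv_fun_add (hy.differentiableAt (by norm_num)) (hy'.differentiableAt (by norm_num))]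
    simp
  have h2 : ∀ {f : W → ℝ}, ContDiffAt ℝ 2 f x → DifferentiableAt ℝ (fun y => fderiv ℝ f y a) x :=
    fun hf => ((hf.fderiv_right (m := 1) (by norm_num)).clm_apply
        contDiffAt_const).differentiableAt (by norm_num)
  rw [secondDir, h1.fderiv_eq, fderiv_fun_add (h2 hf) (h2 hg)]
  simp [secondDir]

end MetricCalculus

/-! ### Conformally flat charts of a bundle of spheres -/

section SphereBundle

variable {W : Type*} [NormedAddCommGroup W] [InnerProductSpace ℝ W]
  {H : Type*} [NormedAddCommGroup H] [InnerProductSpace ℝ H]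
  {L : Type*} [NormedAddCommGroup L] [InnerProductSpace ℝ L]

/-- The vertical part, scaled by `t`, of the derivative of the section `Y`. -/
noncomputable def vertForm (t : ℝ) (C : W → W →L[ℝ] L →L[ℝ] L) (Y : W → L) (x : W) : W →L[ℝ] L :=
  t • (fderiv ℝ Y x + ContinuousLinearMap.apply ℝ L (Y x) ∘L C x)

lemma vertForm_apply (t : ℝ) (C : W → W →L[ℝ] L →L[ℝ] L) (Y : W → L) (x v : W) :
    vertForm t C Y x v = t • covDir C v Y x := rfl

lemma contDiffAt_vertForm {t : ℝ} {C : W → W →L[ℝ] L →L[ℝ] L} {Y : W → L} {x : W}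
    (hC : ContDiffAt ℝ 2 C x) (hY : ContDiffAt ℝ 3 Y x) :
    ContDiffAt ℝ 2 (vertForm t C Y) x := by
  have h1 : ContDiffAt ℝ 2 (fderiv ℝ Y) x := hY.fderiv_right (by norm_num)
  have h0 : ContDiff ℝ 2 (ContinuousLinearMap.apply ℝ L : L →L[ℝ] (L →L[ℝ] L) →L[ℝ] L) :=
    ContinuousLinearMap.contDiff _
  have h2 := h0.contDiffAt.comp x (hY.of_le (m := 2) (by norm_num))
  exact (h1.add (h2.clm_comp hC)).const_smul t

/-- The form is `t∇Y`, and antisymmetrising a second covariant derivative produces curvature. -/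
lemma tors_vertForm {t : ℝ} {C : W → W →L[ℝ] L →L[ℝ] L} {Y : W → L} {x : W}
    (hC : ContDiffAt ℝ 2 C x) (hY : ContDiffAt ℝ 3 Y x) (a b : W) :
    tors C (vertForm t C Y) x a b = t • curv C x a b (Y x) := by
  have hC1 : ContDiffAt ℝ 1 C x := hC.of_le (by norm_num)
  rw [tors_eq ((contDiffAt_vertForm hC hY).differentiableAt (by norm_num)),
    ← covDir_comm a b hC1 (hY.of_le (by norm_num)), smul_sub]
  have key : ∀ a b : W, covDir C a (fun y => vertForm t C Y y b) x
      = t • covDir C a (covDir C b Y) x := by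
    intro a b
    have hd : DifferentiableAt ℝ (covDir C b Y) x :=
      (hC.covDir (a := b) hY (by norm_num)).differentiableAt (by norm_num)
    simp only [vertForm_apply]
    rw [covDir, fderiv_fun_const_smul hd, smul_apply, map_smul, ← smul_add]
    rfl
  rw [key, key]

/-- A chart, near `x₀`, of a bundle of round spheres of radius `t` over a Riemannian manifold, in
which the metric is conformal to the flat one. Here `θ` and `CH` are the pullbacks of an orthonormal
coframe and of the Levi-Civita connection, `Y` is the tautological section of the vector bundle
which contains the spheres, `CL` its connection, and `F` the curvature of `CL`, applied to `Y`. -/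
structure ConformalSphereChart (W H L : Type*) [NormedAddCommGroup W] [InnerProductSpace ℝ W]
    [NormedAddCommGroup H] [InnerProductSpace ℝ H] [NormedAddCommGroup L] [InnerProductSpace ℝ L]
    (t : ℝ) (x₀ : W) where
  θ : W → W →L[ℝ] H
  CH : W → W →L[ℝ] H →L[ℝ] H
  CL : W → W →L[ℝ] L →L[ℝ] L
  Y : W → L
  F : W → H →L[ℝ] H →L[ℝ] L
  ρ : W → ℝ
  contDiffAt_θ : ContDiffAt ℝ 2 θ x₀
  contDiffAt_CH : ContDiffAt ℝ 1 CH x₀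
  contDiffAt_CL : ContDiffAt ℝ 2 CL x₀
  contDiffAt_Y : ContDiffAt ℝ 3 Y x₀
  contDiffAt_F : ContDiffAt ℝ 1 F x₀
  contDiffAt_ρ : ContDiffAt ℝ 2 ρ x₀
  ρ_pos : 0 < ρ x₀
  skew_CH : ∀ᶠ y in 𝓝 x₀, ∀ a u v, inner ℝ (CH y a u) v + inner ℝ u (CH y a v) = 0
  skew_CL : ∀ᶠ y in 𝓝 x₀, ∀ a u v, inner ℝ (CL y a u) v + inner ℝ u (CL y a v) = 0
  inner_Y : ∀ᶠ y in 𝓝 x₀, inner ℝ (Y y) (Y y) = (1 : ℝ)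
  tors_θ : ∀ᶠ y in 𝓝 x₀, ∀ a b, tors CH θ y a b = 0
  curv_CL : ∀ᶠ y in 𝓝 x₀, ∀ a b, curv CL y a b (Y y) = F y (θ y a) (θ y b)
  curv_CL_horizontal : ∀ a b, θ x₀ a = 0 → curv CL x₀ a b = 0
  conformal : ∀ᶠ y in 𝓝 x₀, ∀ v w, inner ℝ (θ y v) (θ y w)
    + inner ℝ (vertForm t CL Y y v) (vertForm t CL Y y w) = ρ y * inner ℝ v w

namespace ConformalSphereChart

variable {t : ℝ} {x₀ : W} (D : ConformalSphereChart W H L t x₀)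

/-- The scaled vertical part of the derivative of the chart. -/
noncomputable def E : W → W →L[ℝ] L := vertForm t D.CL D.Y

/-- The covariant derivative at `x₀` of the horizontal part of the derivative of the chart. -/
noncomputable def dθ (a v : W) : H := covDir D.CH a (fun y => D.θ y v) x₀

/-- The covariant derivative at `x₀` of the vertical part of the derivative of the chart. -/
noncomputable def dE (a v : W) : L := covDir D.CL a (fun y => D.E y v) x₀

/-- The logarithmic derivative of the conformal factor. -/
noncomputable def dlogρ (a : W) : ℝ := fderiv ℝ D.ρ x₀ a / D.ρ x₀

lemma contDiffAt_E : ContDiffAt ℝ 2 D.E x₀ := contDiffAt_vertForm D.contDiffAt_CL D.contDiffAt_Y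

lemma tors_E : ∀ᶠ y in 𝓝 x₀, ∀ a b, tors D.CL D.E y a b = t • D.F y (D.θ y a) (D.θ y b) := by
  filter_upwards [D.curv_CL, D.contDiffAt_CL.eventually (by simp),
    D.contDiffAt_Y.eventually (by simp)] with y hy hC hY a b
  rw [E, tors_vertForm hC hY, hy]

lemma dθ_comm (a v : W) : D.dθ a v = D.dθ v a := by
  have h := D.tors_θ.self_of_nhds a v
  rw [tors_eq (D.contDiffAt_θ.differentiableAt (by norm_num))] at h
  exact sub_eq_zero.mp h

lemma dE_sub (a v : W) : D.dE a v - D.dE v a = t • D.F x₀ (D.θ x₀ a) (D.θ x₀ v) := by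
  rw [← D.tors_E.self_of_nhds a v, tors_eq (D.contDiffAt_E.differentiableAt (by norm_num))]
  rfl

lemma differentiableAt_θ (v : W) : DifferentiableAt ℝ (fun y => D.θ y v) x₀ :=
  (D.contDiffAt_θ.differentiableAt (by norm_num)).clm_apply (differentiableAt_const v)

lemma differentiableAt_E (v : W) : DifferentiableAt ℝ (fun y => D.E y v) x₀ :=
  (D.contDiffAt_E.differentiableAt (by norm_num)).clm_apply (differentiableAt_const v)

/-- Both connections are metric, so differentiating the conformality relation gives covariant
derivatives; the Euclidean product on the right is then eliminated by conformality at the point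
itself. -/
lemma conformal_deriv (a v w : W) :
    inner ℝ (D.dθ a v) (D.θ x₀ w) + inner ℝ (D.θ x₀ v) (D.dθ a w)
      + (inner ℝ (D.dE a v) (D.E x₀ w) + inner ℝ (D.E x₀ v) (D.dE a w))
      = D.dlogρ a * (inner ℝ (D.θ x₀ v) (D.θ x₀ w) + inner ℝ (D.E x₀ v) (D.E x₀ w)) := by
  have h : (fun y => inner ℝ (D.θ y v) (D.θ y w) + inner ℝ (D.E y v) (D.E y w)) =ᶠ[𝓝 x₀]
      fun y => D.ρ y * inner ℝ v w := D.conformal.mono fun y hy => hy v w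
  have h' := congrArg (fun f => f a) (h.fderiv_eq (𝕜 := ℝ))
  rw [fderiv_fun_add ((D.differentiableAt_θ v).inner ℝ (D.differentiableAt_θ w))
    ((D.differentiableAt_E v).inner ℝ (D.differentiableAt_E w)),
    fderiv_mul_const (D.contDiffAt_ρ.differentiableAt (by norm_num))] at h'
  simp only [add_apply, smul_apply] at h'
  rw [fderiv_inner_covDir (D.differentiableAt_θ v) (D.differentiableAt_θ w)
    D.skew_CH.self_of_nhds, fderiv_inner_covDir (D.differentiableAt_E v) (D.differentiableAt_E w)
    D.skew_CL.self_of_nhds] at h'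
  have h0 := h.self_of_nhds
  simp only at h0
  rw [h0, dlogρ]
  have := D.ρ_pos.ne'
  simp only [dθ, dE]
  rw [h']
  simp only [smul_eq_mul]
  field_simp

/-- The Koszul formula. -/
lemma koszul_formula (a v w : W) :
    2 * (inner ℝ (D.dθ a v) (D.θ x₀ w) + inner ℝ (D.dE a v) (D.E x₀ w)) =
      D.dlogρ a * (inner ℝ (D.θ x₀ v) (D.θ x₀ w) + inner ℝ (D.E x₀ v) (D.E x₀ w))
      + D.dlogρ v * (inner ℝ (D.θ x₀ a) (D.θ x₀ w) + inner ℝ (D.E x₀ a) (D.E x₀ w))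
      - D.dlogρ w * (inner ℝ (D.θ x₀ a) (D.θ x₀ v) + inner ℝ (D.E x₀ a) (D.E x₀ v))
      + t * (inner ℝ (D.F x₀ (D.θ x₀ a) (D.θ x₀ v)) (D.E x₀ w)
        + inner ℝ (D.F x₀ (D.θ x₀ w) (D.θ x₀ a)) (D.E x₀ v)
        + inner ℝ (D.F x₀ (D.θ x₀ w) (D.θ x₀ v)) (D.E x₀ a)) := by
  have h1 := D.conformal_deriv a v w
  have h2 := D.conformal_deriv v a w
  have h3 := D.conformal_deriv w a v
  have s1 := congrArg (fun u => inner ℝ u (D.E x₀ w)) (D.dE_sub a v)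
  have s2 := congrArg (fun u => inner ℝ u (D.E x₀ v)) (D.dE_sub w a)
  have s3 := congrArg (fun u => inner ℝ u (D.E x₀ a)) (D.dE_sub w v)
  simp only [inner_sub_left, inner_smul_left, conj_trivial] at s1 s2 s3
  rw [D.dθ_comm v a] at h2
  rw [D.dθ_comm w a, D.dθ_comm w v] at h3
  rw [real_inner_comm (D.dθ a w), real_inner_comm (D.dE a w)] at h1
  rw [real_inner_comm (D.dθ v w), real_inner_comm (D.dE v w)] at h2
  rw [real_inner_comm (D.dθ v w), real_inner_comm (D.dE w v)] at h3
  -- The usual Koszul combination: the sum of the relations for `a` and `v` minus the one for `w`.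
  -- The horizontal derivative is symmetric, while each swap in the vertical one costs a curvature
  -- term.
  linarith

/-- From |Y| = 1 the form `E` takes values in the complement of `Y`, and ⟨E,Y⟩ = 0 is differentiated
once more. This is the second fundamental form of a sphere of radius `t`, the source of the summand
1/t² in the curvature of the fibre. -/
lemma inner_dE_Y (ht : t ≠ 0) (a v : W) :
    inner ℝ (D.dE a v) (D.Y x₀) = - (1 / t) * inner ℝ (D.E x₀ v) (D.E x₀ a) := by
  have hY1 : ∀ᶠ y in 𝓝 x₀, DifferentiableAt ℝ D.Y y :=
    (D.contDiffAt_Y.eventually (by simp)).mono fun y h => h.differentiableAt (by norm_num)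
  have h0 : (fun y => inner ℝ (D.E y v) (D.Y y)) =ᶠ[𝓝 x₀] fun _ => 0 := by
    filter_upwards [D.inner_Y.eventually_nhds, D.skew_CL, hY1] with y hy hs hd
    have h1 := fderiv_inner_covDir hd hd hs v
    have h2 : (fun z => inner ℝ (D.Y z) (D.Y z)) =ᶠ[𝓝 y] fun _ => (1 : ℝ) := hy
    rw [h2.fderiv_eq, real_inner_comm] at h1
    simp only [fderiv_fun_const, Pi.zero_apply, zero_apply] at h1
    simp only [E, vertForm_apply, inner_smul_left, conj_trivial]
    rw [real_inner_comm]
    rw [show inner ℝ (D.Y y) (covDir D.CL v D.Y y) = (0 : ℝ) by linarith, mul_zero]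
  have h1 := congrArg (fun f => f a) (h0.fderiv_eq (𝕜 := ℝ))
  simp only [fderiv_fun_const, Pi.zero_apply, zero_apply] at h1
  rw [fderiv_inner_covDir (D.differentiableAt_E v) hY1.self_of_nhds D.skew_CL.self_of_nhds] at h1
  have h2 : inner ℝ (D.E x₀ v) (D.E x₀ a) = t * inner ℝ (D.E x₀ v) (covDir D.CL a D.Y x₀) := by
    simp only [E, vertForm_apply, inner_smul_right]
  rw [h2]
  simp only [dE]
  field_simp
  linarith

lemma planeCurv_eq (a b : W) :
    planeCurv (fun y v w => inner ℝ (D.θ y v) (D.θ y w)) x₀ a b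
      + planeCurv (fun y v w => inner ℝ (D.E y v) (D.E y w)) x₀ a b =
      2 * secondDir D.ρ x₀ a b * inner ℝ a b - secondDir D.ρ x₀ a a * inner ℝ b b
        - secondDir D.ρ x₀ b b * inner ℝ a a := by
  rw [← planeCurv_smul_inner D.contDiffAt_ρ]
  have hθ : ∀ v w, ContDiffAt ℝ 2 (fun y => inner ℝ (D.θ y v) (D.θ y w)) x₀ := fun v w =>
    (D.contDiffAt_θ.clm_apply contDiffAt_const).inner ℝ (D.contDiffAt_θ.clm_apply contDiffAt_const)
  have hE : ∀ v w, ContDiffAt ℝ 2 (fun y => inner ℝ (D.E y v) (D.E y w)) x₀ := fun v w =>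
    (D.contDiffAt_E.clm_apply contDiffAt_const).inner ℝ (D.contDiffAt_E.clm_apply contDiffAt_const)
  have key : ∀ v w a b, secondDir (fun y => D.ρ y * inner ℝ v w) x₀ a b =
      secondDir (fun y => inner ℝ (D.θ y v) (D.θ y w)) x₀ a b
      + secondDir (fun y => inner ℝ (D.E y v) (D.E y w)) x₀ a b := by
    intro v w a b
    rw [← secondDir_add (hθ v w) (hE v w)]
    exact secondDir_congr (D.conformal.mono fun y hy => (hy v w).symm) a b
  simp only [planeCurv, key]
  ring

lemma planeCurv_θ (a b : W) :
    planeCurv (fun y v w => inner ℝ (D.θ y v) (D.θ y w)) x₀ a b =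
      2 * (inner ℝ (curv D.CH x₀ b a (D.θ x₀ a)) (D.θ x₀ b)
        + inner ℝ (D.dθ a a) (D.dθ b b) - inner ℝ (D.dθ a b) (D.dθ a b)) := by
  have h0 : ∀ a b c, covDir D.CH c (fun y => tors D.CH D.θ y a b) x₀ = 0 := by
    intro a b c
    rw [covDir_congr (r := fun _ => 0) (D.tors_θ.mono fun y hy => hy a b)]
    simp [covDir]
  rw [planeCurv_inner D.contDiffAt_CH D.contDiffAt_θ D.skew_CH, h0, h0,
    D.tors_θ.self_of_nhds]
  have := D.dθ_comm b a
  simp only [dθ] at this ⊢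
  rw [this]
  simp

lemma planeCurv_E (a b : W) :
    planeCurv (fun y v w => inner ℝ (D.E y v) (D.E y w)) x₀ a b =
      2 * (inner ℝ (curv D.CL x₀ b a (D.E x₀ a)) (D.E x₀ b)
        + inner ℝ (covDir D.CL a (fun y => t • D.F y (D.θ y b) (D.θ y a)) x₀) (D.E x₀ b)
        + inner ℝ (covDir D.CL b (fun y => t • D.F y (D.θ y a) (D.θ y b)) x₀) (D.E x₀ a)
        + inner ℝ (D.dE a a) (D.dE b b) - inner ℝ (D.dE a b) (D.dE b a)
        - t ^ 2 * inner ℝ (D.F x₀ (D.θ x₀ a) (D.θ x₀ b)) (D.F x₀ (D.θ x₀ a) (D.θ x₀ b))) := by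
  have h0 : ∀ a b c, covDir D.CL c (fun y => tors D.CL D.E y a b) x₀ =
      covDir D.CL c (fun y => t • D.F y (D.θ y a) (D.θ y b)) x₀ := by
    intro a b c
    exact covDir_congr (D.tors_E.mono fun y hy => hy a b)
  rw [planeCurv_inner (D.contDiffAt_CL.of_le (by norm_num)) D.contDiffAt_E D.skew_CL, h0, h0,
    D.tors_E.self_of_nhds]
  simp only [dE, inner_smul_left, inner_smul_right, conj_trivial]
  ring

/-- Since `θ b` vanishes at the point, the product rule leaves only its derivative; neither the
derivative of `F` nor the connection term survives. -/
lemma covDir_F (a b c : W) (hb : D.θ x₀ b = 0) :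
    covDir D.CL a (fun y => t • D.F y (D.θ y b) (D.θ y c)) x₀
      = t • D.F x₀ (D.dθ a b) (D.θ x₀ c) := by
  have hF := (D.contDiffAt_F.differentiableAt (by norm_num))
  have h1 := (hF.hasFDerivAt.clm_apply (D.differentiableAt_θ b).hasFDerivAt)
  have h2 := (h1.clm_apply (D.differentiableAt_θ c).hasFDerivAt).const_smul t
  have h3 : HasFDerivAt (fun y => t • D.F y (D.θ y b) (D.θ y c)) _ x₀ := h2
  rw [covDir, h3.fderiv]
  simp [hb, dθ, covDir]

end ConformalSphereChart

end SphereBundle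

/-! ### Covariant derivatives along horizontal and vertical lifts -/

section SphereBundle

variable {W : Type*} [NormedAddCommGroup W] [InnerProductSpace ℝ W]
  {H : Type*} [NormedAddCommGroup H] [InnerProductSpace ℝ H]
  {L : Type*} [NormedAddCommGroup L] [InnerProductSpace ℝ L]

namespace ConformalSphereChart

variable {t : ℝ} {x₀ : W} (D : ConformalSphereChart W H L t x₀)

/-- Lifts to the chart of an orthonormal basis `e` of the horizontal space and of an orthonormal
basis `f` of the vertical space, which is completed by the section `Y`. -/
structure Lifts {ι : Type*} [Fintype ι] (e : OrthonormalBasis ι ℝ H)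
    (f : OrthonormalBasis (Fin 3) ℝ L) (hor : ι → W) (ver : Fin 2 → W) : Prop where
  Y_eq : D.Y x₀ = f 2
  θ_hor : ∀ i, D.θ x₀ (hor i) = e i
  E_hor : ∀ i, D.E x₀ (hor i) = 0
  θ_ver : ∀ k, D.θ x₀ (ver k) = 0
  E_ver : ∀ k, D.E x₀ (ver k) = f k.castSucc

variable {D} {ι : Type*} [Fintype ι] [DecidableEq ι] {e : OrthonormalBasis ι ℝ H}
  {f : OrthonormalBasis (Fin 3) ℝ L} {hor : ι → W} {ver : Fin 2 → W}

namespace Lifts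

lemma ext_hor {u v : H} (h : ∀ i, inner ℝ u (e i) = inner ℝ v (e i)) : u = v :=
  e.repr.injective (by ext i; simpa [e.repr_apply_apply, real_inner_comm] using h i)

lemma ext_ver {u v : L} (h : ∀ i, inner ℝ u (f i) = inner ℝ v (f i)) : u = v :=
  ext_hor (e := f) h

variable (hD : D.Lifts e f hor ver)
include hD

lemma F_swap (i j : ι) : t • D.F x₀ (e i) (e j) = - (t • D.F x₀ (e j) (e i)) := by
  rw [← hD.θ_hor i, ← hD.θ_hor j, ← D.dE_sub, ← D.dE_sub, neg_sub]

/-- The two vertical components come from the Koszul formula, and the component along `Y` is zero by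
`inner_dE_Y`. Half of `tF` is O'Neill's integrability tensor; the other term is the effect of the
conformal factor. -/
lemma dE_hor_hor (ht : t ≠ 0) (i j : ι) :
    D.dE (hor i) (hor j) = (1 / 2 : ℝ) • (t • D.F x₀ (e i) (e j)
      - inner ℝ (e i) (e j) • ∑ k, D.dlogρ (ver k) • f k.castSucc) := by
  have hv : ∀ k : Fin 2, inner ℝ (D.dE (hor i) (hor j)) (f k.castSucc) =
      1 / 2 * (t * inner ℝ (D.F x₀ (e i) (e j)) (f k.castSucc)
        - inner ℝ (e i) (e j) * D.dlogρ (ver k)) := by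
    intro k
    have h := D.koszul_formula (hor i) (hor j) (ver k)
    simp only [hD.θ_ver, hD.θ_hor, hD.E_hor, hD.E_ver, map_zero, inner_zero_left, inner_zero_right,
      zero_apply] at h
    linarith
  have hY : ∀ i j, inner ℝ (D.dE (hor i) (hor j)) (f 2) = (0 : ℝ) := by
    intro i j
    rw [← hD.Y_eq, D.inner_dE_Y ht, hD.E_hor, inner_zero_left, mul_zero]
  -- The curvature term is a difference of derivatives of `E`, which have no component along `Y`.
  have hF : t * inner ℝ (D.F x₀ (e i) (e j)) (f 2) = (0 : ℝ) := by
    have h := congrArg (fun u => inner ℝ u (f 2)) (D.dE_sub (hor i) (hor j))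
    simpa [inner_sub_left, hY, hD.θ_hor, inner_smul_left] using h.symm
  refine ext_ver (f := f) fun m => ?_
  have h0 := hv 0
  have h1 := hv 1
  have o := orthonormal_iff_ite.mp f.orthonormal
  fin_cases m
  · simp [Fin.sum_univ_two, inner_smul_left, inner_sub_left, inner_add_left, o] at h0 ⊢
    rw [h0]
  · simp [Fin.sum_univ_two, inner_smul_left, inner_sub_left, inner_add_left, o] at h1 ⊢
    rw [h1]
  · simp [Fin.sum_univ_two, inner_smul_left, inner_sub_left, inner_add_left, o, hY, hF]

lemma dθ_hor_hor (i j : ι) :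
    D.dθ (hor i) (hor j) = (1 / 2 : ℝ) • (D.dlogρ (hor i) • e j + D.dlogρ (hor j) • e i
      - inner ℝ (e i) (e j) • ∑ k, D.dlogρ (hor k) • e k) := by
  refine ext_hor (e := e) fun m => ?_
  have h := D.koszul_formula (hor i) (hor j) (hor m)
  have o := orthonormal_iff_ite.mp e.orthonormal
  simp only [hD.θ_hor, hD.E_hor, inner_zero_right] at h
  simp only [inner_smul_left, inner_sub_left, inner_add_left, sum_inner, conj_trivial]
  have : ∑ k, D.dlogρ (hor k) * inner ℝ (e k) (e m) = D.dlogρ (hor m) := by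
    simp [o]
  rw [this]
  linarith

lemma dθ_ver_ver (k l : Fin 2) :
    D.dθ (ver k) (ver l) = - (1 / 2 : ℝ) • (inner ℝ (f k.castSucc) (f l.castSucc) •
      ∑ i, D.dlogρ (hor i) • e i) := by
  refine ext_hor (e := e) fun m => ?_
  have h := D.koszul_formula (ver k) (ver l) (hor m)
  have o := orthonormal_iff_ite.mp e.orthonormal
  simp only [hD.θ_hor, hD.E_hor, hD.θ_ver, hD.E_ver, inner_zero_left, inner_zero_right,
    map_zero] at h
  simp only [inner_smul_left, sum_inner, conj_trivial]
  have : ∑ k, D.dlogρ (hor k) * inner ℝ (e k) (e m) = D.dlogρ (hor m) := by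
    simp [o]
  rw [this]
  linarith

lemma dE_ver_ver (ht : t ≠ 0) (k l : Fin 2) :
    D.dE (ver k) (ver l) = (1 / 2 : ℝ) • (D.dlogρ (ver k) • f l.castSucc
      + D.dlogρ (ver l) • f k.castSucc
      - inner ℝ (f k.castSucc) (f l.castSucc) • ∑ m, D.dlogρ (ver m) • f m.castSucc)
      - (1 / t * inner ℝ (f k.castSucc) (f l.castSucc)) • f 2 := by
  have hv : ∀ m : Fin 2, inner ℝ (D.dE (ver k) (ver l)) (f m.castSucc) =
      1 / 2 * (D.dlogρ (ver k) * inner ℝ (f l.castSucc) (f m.castSucc)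
        + D.dlogρ (ver l) * inner ℝ (f k.castSucc) (f m.castSucc)
        - inner ℝ (f k.castSucc) (f l.castSucc) * D.dlogρ (ver m)) := by
    intro m
    have h := D.koszul_formula (ver k) (ver l) (ver m)
    simp only [hD.θ_ver, hD.E_ver, map_zero, inner_zero_left, inner_zero_right] at h
    linarith
  have hY := D.inner_dE_Y ht (ver k) (ver l)
  rw [hD.Y_eq, hD.E_ver, hD.E_ver, real_inner_comm (f k.castSucc)] at hY
  have o := orthonormal_iff_ite.mp f.orthonormal
  refine ext_ver (f := f) fun m => ?_
  have h0 := hv 0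
  have h1 := hv 1
  have o2 : ∀ k : Fin 2, inner ℝ (f k.castSucc) (f 2) = (0 : ℝ) := by
    intro k; fin_cases k <;> simp [o]
  simp only [inner_smul_left, inner_sub_left, inner_add_left, conj_trivial, Fin.sum_univ_two]
  fin_cases m
  · simp at h0 ⊢
    rw [h0]
  · simp at h1 ⊢
    rw [h1]
  · have h2 : inner ℝ (f 2) (f 2) = (1 : ℝ) := by simp
    simp only [Fin.reduceFinMk, o2, h2, hY]
    ring

/-- The sum over `j` is the adjoint of the integrability tensor; it is responsible for the curvature
of mixed planes. -/
lemma dθ_hor_ver (i : ι) (k : Fin 2) :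
    D.dθ (hor i) (ver k) = (1 / 2 : ℝ) • (D.dlogρ (ver k) • e i
      + ∑ j, inner ℝ (t • D.F x₀ (e j) (e i)) (f k.castSucc) • e j) := by
  refine ext_hor (e := e) fun m => ?_
  have h := D.koszul_formula (hor i) (ver k) (hor m)
  have o := orthonormal_iff_ite.mp e.orthonormal
  simp only [hD.θ_hor, hD.E_hor, hD.θ_ver, hD.E_ver, inner_zero_left, inner_zero_right,
    map_zero] at h
  simp only [inner_smul_left, inner_add_left, sum_inner, conj_trivial]
  have : ∑ j, t * inner ℝ (D.F x₀ (e j) (e i)) (f k.castSucc) * inner ℝ (e j) (e m) =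
      t * inner ℝ (D.F x₀ (e m) (e i)) (f k.castSucc) := by
    simp [o]
  rw [this]
  linarith

lemma dE_hor_ver (ht : t ≠ 0) (i : ι) (k : Fin 2) :
    D.dE (hor i) (ver k) = (1 / 2 : ℝ) • (D.dlogρ (hor i) • f k.castSucc) := by
  have hv : ∀ m : Fin 2, inner ℝ (D.dE (hor i) (ver k)) (f m.castSucc) =
      1 / 2 * (D.dlogρ (hor i) * inner ℝ (f k.castSucc) (f m.castSucc)) := by
    intro m
    have h := D.koszul_formula (hor i) (ver k) (ver m)
    simp only [hD.θ_ver, hD.E_ver, hD.θ_hor, hD.E_hor, map_zero, inner_zero_left, zero_apply,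
      inner_zero_right] at h
    linarith
  have hY := D.inner_dE_Y ht (hor i) (ver k)
  rw [hD.Y_eq, hD.E_hor, inner_zero_right, mul_zero] at hY
  have o := orthonormal_iff_ite.mp f.orthonormal
  have o2 : inner ℝ (f k.castSucc) (f 2) = (0 : ℝ) := by
    fin_cases k <;> simp [o]
  refine ext_ver (f := f) fun m => ?_
  have h0 := hv 0
  have h1 := hv 1
  simp only [inner_smul_left, conj_trivial]
  fin_cases m
  · simpa using h0
  · simpa using h1
  · simpa [o2] using hY

lemma dE_ver_hor (ht : t ≠ 0) (i : ι) (k : Fin 2) :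
    D.dE (ver k) (hor i) = (1 / 2 : ℝ) • (D.dlogρ (hor i) • f k.castSucc) := by
  rw [← hD.dE_hor_ver ht i k, ← sub_eq_zero, D.dE_sub, hD.θ_ver, hD.θ_hor]
  simp

end Lifts

end ConformalSphereChart

end SphereBundle

/-! ### Sectional curvatures of the total space -/

section SphereBundle

variable {W : Type*} [NormedAddCommGroup W] [InnerProductSpace ℝ W]
  {H : Type*} [NormedAddCommGroup H] [InnerProductSpace ℝ H]
  {L : Type*} [NormedAddCommGroup L] [InnerProductSpace ℝ L]

namespace ConformalSphereChart

variable {t : ℝ} {x₀ : W} {D : ConformalSphereChart W H L t x₀}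
  {ι : Type*} [Fintype ι] [DecidableEq ι] {e : OrthonormalBasis ι ℝ H}
  {f : OrthonormalBasis (Fin 3) ℝ L} {hor : ι → W} {ver : Fin 2 → W}

namespace Lifts

variable (hD : D.Lifts e f hor ver)
include hD

lemma F_self (i : ι) : t • D.F x₀ (e i) (e i) = 0 := by
  have := hD.F_swap i i
  rwa [eq_neg_iff_add_eq_zero, ← two_smul ℝ, smul_eq_zero_iff_right (by norm_num)] at this

lemma inner_sum_sum (c : ι → ℝ) :
    inner ℝ (∑ i, c i • e i) (∑ i, c i • e i) = ∑ i, c i ^ 2 := by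
  have o := orthonormal_iff_ite.mp e.orthonormal
  simp only [sum_inner, inner_sum, inner_smul_left, inner_smul_right, o, sq]
  simp

lemma inner_sum_right (c : ι → ℝ) (j : ι) : inner ℝ (e j) (∑ i, c i • e i) = c j := by
  have o := orthonormal_iff_ite.mp e.orthonormal
  simp [inner_sum, inner_smul_right, o]

lemma inner_sum_left (c : ι → ℝ) (j : ι) : inner ℝ (∑ i, c i • e i) (e j) = c j := by
  rw [real_inner_comm, hD.inner_sum_right]

/-- The bundle curvature vanishes along the fibre, so 1/t² comes from the components of the second
derivatives along `Y`. The factor 2 in front, here and below, is that of `planeCurv`, which is twice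
a sectional curvature. -/
lemma planeCurv_ver_ver (ht : t ≠ 0) :
    planeCurv (fun y v w => inner ℝ (D.θ y v) (D.θ y w)) x₀ (ver 0) (ver 1)
      + planeCurv (fun y v w => inner ℝ (D.E y v) (D.E y w)) x₀ (ver 0) (ver 1) =
    2 * (1 / t ^ 2 - 1 / 2 * (D.dlogρ (ver 0) ^ 2 + D.dlogρ (ver 1) ^ 2)
      + 1 / 4 * ∑ i, D.dlogρ (hor i) ^ 2) := by
  have o := orthonormal_iff_ite.mp f.orthonormal
  have hc : curv D.CL x₀ (ver 1) (ver 0) = 0 := D.curv_CL_horizontal _ _ (hD.θ_ver 1)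
  rw [planeCurv_θ, planeCurv_E, hD.dθ_ver_ver, hD.dθ_ver_ver, hD.dθ_ver_ver, hD.dE_ver_ver ht,
    hD.dE_ver_ver ht, hD.dE_ver_ver ht, hD.dE_ver_ver ht, hD.θ_ver, hD.θ_ver,
    D.covDir_F _ _ _ (hD.θ_ver 1), D.covDir_F _ _ _ (hD.θ_ver 0), hD.θ_ver, hD.θ_ver, hc]
  simp only [o, Fin.sum_univ_two, inner_smul_left, inner_smul_right, inner_sub_left,
    inner_sub_right, inner_add_left, inner_add_right, map_zero, inner_zero_left, zero_apply,
    conj_trivial, hD.inner_sum_sum, smul_zero]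
  simp
  field_simp
  ring

/-- The coefficient −3/4 is −1 from the squared torsion of `E`, plus 1/4 from the product of the two
mixed derivatives of `E`, which are opposite halves of `tF`. -/
lemma planeCurv_hor_hor (ht : t ≠ 0) {i j : ι} (hij : i ≠ j) :
    planeCurv (fun y v w => inner ℝ (D.θ y v) (D.θ y w)) x₀ (hor i) (hor j)
      + planeCurv (fun y v w => inner ℝ (D.E y v) (D.E y w)) x₀ (hor i) (hor j) =
    2 * (inner ℝ (curv D.CH x₀ (hor j) (hor i) (e i)) (e j)
      - 3 / 4 * inner ℝ (t • D.F x₀ (e i) (e j)) (t • D.F x₀ (e i) (e j))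
      - 3 / 4 * (D.dlogρ (hor i) ^ 2 + D.dlogρ (hor j) ^ 2)
      + 1 / 4 * (D.dlogρ (ver 0) ^ 2 + D.dlogρ (ver 1) ^ 2)
      + 1 / 4 * ∑ i, D.dlogρ (hor i) ^ 2) := by
  have o := orthonormal_iff_ite.mp f.orthonormal
  have o' := orthonormal_iff_ite.mp e.orthonormal
  have hsq : t ^ 2 * inner ℝ (D.F x₀ (e i) (e j)) (D.F x₀ (e i) (e j)) =
      inner ℝ (t • D.F x₀ (e i) (e j)) (t • D.F x₀ (e i) (e j)) := by
    simp only [inner_smul_left, inner_smul_right, conj_trivial]; ring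
  rw [planeCurv_θ, planeCurv_E, hD.dθ_hor_hor, hD.dθ_hor_hor, hD.dθ_hor_hor, hD.dE_hor_hor ht,
    hD.dE_hor_hor ht, hD.dE_hor_hor ht, hD.dE_hor_hor ht, hD.θ_hor, hD.θ_hor, hD.E_hor, hD.E_hor,
    hD.F_swap j i, hD.F_self, hD.F_self, hsq]
  generalize t • D.F x₀ (e i) (e j) = T
  simp only [o', if_neg hij, if_neg hij.symm, if_true, one_smul, zero_smul, sub_zero, zero_sub,
    inner_zero_right, map_zero]
  simp only [inner_smul_left, inner_smul_right, inner_sub_left, inner_neg_left, inner_neg_right,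
    inner_sub_right, inner_add_left, inner_add_right, conj_trivial, hD.inner_sum_sum,
    hD.inner_sum_left, hD.inner_sum_right, o', if_neg hij, if_neg hij.symm, if_true,
    Fin.sum_univ_two, o]
  simp
  ring

/-- The coefficient 1/4 is 1/2, from the derivative of the torsion (`hF`), minus 1/4, from the
square of `dθ_hor_ver`. -/
lemma planeCurv_ver_hor (ht : t ≠ 0) (k : Fin 2) (i : ι) :
    planeCurv (fun y v w => inner ℝ (D.θ y v) (D.θ y w)) x₀ (ver k) (hor i)
      + planeCurv (fun y v w => inner ℝ (D.E y v) (D.E y w)) x₀ (ver k) (hor i) =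
    2 * (1 / 4 * ∑ j, inner ℝ (t • D.F x₀ (e j) (e i)) (f k.castSucc) ^ 2
      - 3 / 4 * (D.dlogρ (hor i) ^ 2 + D.dlogρ (ver k) ^ 2)
      + 1 / 4 * (D.dlogρ (ver 0) ^ 2 + D.dlogρ (ver 1) ^ 2)
      + 1 / 4 * ∑ i, D.dlogρ (hor i) ^ 2) := by
  have o := orthonormal_iff_ite.mp f.orthonormal
  have o' := orthonormal_iff_ite.mp e.orthonormal
  have hF : inner ℝ (t • D.F x₀ (D.dθ (hor i) (ver k)) (e i)) (f k.castSucc) =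
      1 / 2 * ∑ j, inner ℝ (t • D.F x₀ (e j) (e i)) (f k.castSucc) ^ 2 := by
    have h0 := hD.F_self i
    rw [hD.dθ_hor_ver]
    simp only [map_smul, map_add, map_sum, smul_apply, add_apply, FunLike.coe_sum,
      Finset.sum_apply, smul_add, Finset.smul_sum, smul_comm t, h0, smul_zero, zero_add,
      sum_inner, inner_smul_left, conj_trivial, Finset.mul_sum]
    exact Finset.sum_congr rfl fun j _ => by ring
  have hcross : inner ℝ (t • D.F x₀ (e i) (e i)) (f k.castSucc) = (0 : ℝ) := by
    rw [hD.F_self, inner_zero_left]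
  have hk : inner ℝ (f k.castSucc) (f 2) = (0 : ℝ) := by fin_cases k <;> simp [o]
  have hm : ∀ m : Fin 2, inner ℝ (f 2) (f m.castSucc) = (0 : ℝ) := by
    intro m; fin_cases m <;> simp [o]
  rw [planeCurv_θ, planeCurv_E, D.covDir_F _ _ _ (hD.θ_ver k), D.dθ_comm (ver k) (hor i),
    hD.dθ_ver_ver, hD.dθ_hor_hor, hD.dE_ver_hor ht, hD.dE_hor_ver ht, hD.dE_hor_hor ht, hD.F_self,
    hD.dE_ver_ver ht, hD.θ_hor, hD.θ_ver, hD.E_hor, hD.E_ver, hF, hD.dθ_hor_ver]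
  simp only [inner_smul_left, inner_smul_right, inner_sub_left, inner_zero_right, map_zero,
    inner_sub_right, inner_add_left, inner_add_right, conj_trivial, hD.inner_sum_sum,
    hD.inner_sum_left, hD.inner_sum_right, o', if_true, zero_apply, inner_zero_left,
    Fin.sum_univ_two, hm, zero_sub, inner_neg_right, one_smul] at hcross ⊢
  rw [hcross]
  fin_cases k <;> simp [o] <;> ring

/-- In a conformally flat space the sectional curvatures of the coordinate planes of an orthogonal
frame satisfy `K₀₁ + Kᵢⱼ = K₀ᵢ + K₁ⱼ`. -/
lemma planeCurv_add {i j : ι} (hij : i ≠ j) :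
    (planeCurv (fun y v w => inner ℝ (D.θ y v) (D.θ y w)) x₀ (ver 0) (ver 1)
      + planeCurv (fun y v w => inner ℝ (D.E y v) (D.E y w)) x₀ (ver 0) (ver 1))
    + (planeCurv (fun y v w => inner ℝ (D.θ y v) (D.θ y w)) x₀ (hor i) (hor j)
      + planeCurv (fun y v w => inner ℝ (D.E y v) (D.E y w)) x₀ (hor i) (hor j)) =
    (planeCurv (fun y v w => inner ℝ (D.θ y v) (D.θ y w)) x₀ (ver 0) (hor i)
      + planeCurv (fun y v w => inner ℝ (D.E y v) (D.E y w)) x₀ (ver 0) (hor i))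
    + (planeCurv (fun y v w => inner ℝ (D.θ y v) (D.θ y w)) x₀ (ver 1) (hor j)
      + planeCurv (fun y v w => inner ℝ (D.E y v) (D.E y w)) x₀ (ver 1) (hor j)) := by
  have o := orthonormal_iff_ite.mp f.orthonormal
  have o' := orthonormal_iff_ite.mp e.orthonormal
  -- By conformality the lifts are orthogonal in the flat metric with common squared length 1/ρ, so
  -- each bracket is minus the sum of two pure second derivatives of ρ, divided by ρ.
  have hW : ∀ v w, inner ℝ v w =
      (inner ℝ (D.θ x₀ v) (D.θ x₀ w) + inner ℝ (D.E x₀ v) (D.E x₀ w)) / D.ρ x₀ := by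
    intro v w
    rw [eq_div_iff D.ρ_pos.ne', mul_comm, ← D.conformal.self_of_nhds v w]
    rfl
  simp only [planeCurv_eq, hW, hD.θ_ver, hD.θ_hor, hD.E_ver, hD.E_hor, inner_zero_left,
    inner_zero_right, o, o', if_neg hij]
  simp
  ring

/-- The sectional curvatures of the base and the curvature of a bundle of round spheres of
radius `t` with a conformally flat metric. -/
theorem curv_identity (ht : t ≠ 0) {i j : ι} (hij : i ≠ j) :
    1 / t ^ 2 + inner ℝ (curv D.CH x₀ (hor j) (hor i) (e i)) (e j)
      - 3 / 4 * inner ℝ (t • D.F x₀ (e i) (e j)) (t • D.F x₀ (e i) (e j)) =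
    1 / 4 * (∑ k, inner ℝ (t • D.F x₀ (e k) (e i)) (f 0) ^ 2
      + ∑ k, inner ℝ (t • D.F x₀ (e k) (e j)) (f 1) ^ 2) := by
  have h := hD.planeCurv_add hij
  rw [hD.planeCurv_ver_ver ht, hD.planeCurv_hor_hor ht hij, hD.planeCurv_ver_hor ht,
    hD.planeCurv_ver_hor ht] at h
  simp only [Fin.castSucc_zero, Fin.castSucc_one] at h
  -- In every plane the derivatives of log ρ enter as −3/4 of the squares belonging to its two
  -- vectors plus 1/4 of all the squares; both sides of the four-term relation contain the same
  -- total.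
  linarith

end Lifts

end ConformalSphereChart

end SphereBundle

/-! ### The action of skew-symmetric endomorphisms on one of the two three-spaces of two-forms -/

section Quaternionic

/-- The cross product of Euclidean three-space. -/
noncomputable def crossE : EuclideanSpace ℝ (Fin 3) →L[ℝ] EuclideanSpace ℝ (Fin 3) →L[ℝ]
    EuclideanSpace ℝ (Fin 3) :=
  (LinearMap.mk₂ ℝ (fun a l => !₂[a 1 * l 2 - a 2 * l 1, a 2 * l 0 - a 0 * l 2,
      a 0 * l 1 - a 1 * l 0])
    (by intro a b l; ext i; fin_cases i <;> simp <;> ring)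
    (by intro c a l; ext i; fin_cases i <;> simp <;> ring)
    (by intro a l m; ext i; fin_cases i <;> simp <;> ring)
    (by intro c a l; ext i; fin_cases i <;> simp <;> ring)).toContinuousBilinearMap

lemma crossE_apply (a l : EuclideanSpace ℝ (Fin 3)) :
    crossE a l = !₂[a 1 * l 2 - a 2 * l 1, a 2 * l 0 - a 0 * l 2, a 0 * l 1 - a 1 * l 0] := rfl

/-- The `(a, b)` entry of `K`, the `b`-th component of the image of the `a`-th basis vector. -/
noncomputable def entry (K : EuclideanSpace ℝ (Fin 4) →L[ℝ] EuclideanSpace ℝ (Fin 4))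
    (a b : Fin 4) : ℝ := K (EuclideanSpace.single a 1) b

/-- The (doubled) component in `Λ₋`, identified with three-space, of an endomorphism. -/
noncomputable def asdPart : (EuclideanSpace ℝ (Fin 4) →L[ℝ] EuclideanSpace ℝ (Fin 4)) →L[ℝ]
    EuclideanSpace ℝ (Fin 3) :=
  LinearMap.toContinuousLinearMap
    { toFun := fun K => !₂[entry K 0 1 + entry K 2 3, entry K 0 2 + entry K 3 1,
        entry K 0 3 + entry K 1 2]
      map_add' := by intro K K'; ext i; fin_cases i <;> simp [entry] <;> ring
      map_smul' := by intro c K; ext i; fin_cases i <;> simp [entry] <;> ring }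

lemma asdPart_apply (K : EuclideanSpace ℝ (Fin 4) →L[ℝ] EuclideanSpace ℝ (Fin 4)) :
    asdPart K = !₂[entry K 0 1 + entry K 2 3, entry K 0 2 + entry K 3 1,
        entry K 0 3 + entry K 1 2] := rfl

/-- The commutator action of skew-symmetric endomorphisms on `Λ₋`. -/
noncomputable def asdAct : (EuclideanSpace ℝ (Fin 4) →L[ℝ] EuclideanSpace ℝ (Fin 4)) →L[ℝ]
    EuclideanSpace ℝ (Fin 3) →L[ℝ] EuclideanSpace ℝ (Fin 3) :=
  crossE ∘L asdPart

lemma asdAct_apply (K : EuclideanSpace ℝ (Fin 4) →L[ℝ] EuclideanSpace ℝ (Fin 4))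
    (l : EuclideanSpace ℝ (Fin 3)) : asdAct K l = crossE (asdPart K) l := rfl

lemma entry_comp (K K' : EuclideanSpace ℝ (Fin 4) →L[ℝ] EuclideanSpace ℝ (Fin 4)) (a b : Fin 4) :
    entry (K ∘L K') a b = ∑ c, entry K' a c * entry K c b := by
  have h : K' (EuclideanSpace.single a 1) =
      ∑ c, entry K' a c • EuclideanSpace.single c (1 : ℝ) := by
    ext i
    simp [entry, Pi.single_apply]
  simp only [entry, ContinuousLinearMap.comp_apply] at h ⊢
  conv_lhs => rw [h]
  simp

lemma entry_sub (K K' : EuclideanSpace ℝ (Fin 4) →L[ℝ] EuclideanSpace ℝ (Fin 4)) (a b : Fin 4) :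
    entry (K - K') a b = entry K a b - entry K' a b := by simp [entry]

lemma entry_eq_inner (K : EuclideanSpace ℝ (Fin 4) →L[ℝ] EuclideanSpace ℝ (Fin 4)) (a b : Fin 4) :
    entry K a b = inner ℝ (K (EuclideanSpace.single a 1)) (EuclideanSpace.single b 1) := by
  simp [entry, EuclideanSpace.inner_single_right]

/-- Skew-symmetry of an endomorphism of Euclidean space. -/
def IsSkew {V : Type*} [NormedAddCommGroup V] [InnerProductSpace ℝ V] (K : V →L[ℝ] V) : Prop :=
  ∀ u v, inner ℝ (K u) v + inner ℝ u (K v) = (0 : ℝ)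

lemma IsSkew.entry_swap {K : EuclideanSpace ℝ (Fin 4) →L[ℝ] EuclideanSpace ℝ (Fin 4)}
    (h : IsSkew K) (a b : Fin 4) : entry K a b = - entry K b a := by
  have := h (EuclideanSpace.single a 1) (EuclideanSpace.single b 1)
  rw [real_inner_comm (K _)] at this
  rw [entry_eq_inner, entry_eq_inner]
  linarith

lemma isSkew_of_entry {K : EuclideanSpace ℝ (Fin 4) →L[ℝ] EuclideanSpace ℝ (Fin 4)}
    (h : ∀ a b, entry K a b = - entry K b a) : IsSkew K := by
  intro u v
  have key : ∀ u v, inner ℝ (K u) v = ∑ a, ∑ b, u a * v b * entry K a b := by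
    intro u v
    have hu : u = ∑ a, u a • EuclideanSpace.single a (1 : ℝ) := by
      ext i; simp [Pi.single_apply]
    conv_lhs => rw [hu]
    simp only [map_sum, map_smul, sum_inner, inner_smul_left, PiLp.inner_apply, entry]
    simp [Finset.mul_sum, mul_assoc]
  rw [real_inner_comm (K v), key, key, Finset.sum_comm, ← Finset.sum_add_distrib]
  refine Finset.sum_eq_zero fun a _ => ?_
  rw [← Finset.sum_add_distrib]
  refine Finset.sum_eq_zero fun b _ => ?_
  rw [h a b]
  ring

/-- The algebra so(4) splits into two copies of so(3), and this is the projection to one of them.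
The doubled normalisation makes the bracket exactly the cross product, with no factor. -/
lemma asdPart_commutator {K K' : EuclideanSpace ℝ (Fin 4) →L[ℝ] EuclideanSpace ℝ (Fin 4)}
    (h : IsSkew K) (h' : IsSkew K') :
    asdPart (K ∘L K' - K' ∘L K) = crossE (asdPart K) (asdPart K') := by
  have d : ∀ {K : EuclideanSpace ℝ (Fin 4) →L[ℝ] EuclideanSpace ℝ (Fin 4)} (_ : IsSkew K) (a),
      entry K a a = 0 := fun hK a => by have := hK.entry_swap a a; linarith
  ext i
  fin_cases i <;>
  · simp [asdPart_apply, crossE_apply, entry_sub, entry_comp, Fin.sum_univ_four, d h, d h',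
      h.entry_swap 1 0, h.entry_swap 2 0, h.entry_swap 3 0, h.entry_swap 2 1, h.entry_swap 1 3,
      h.entry_swap 3 2, h'.entry_swap 1 0, h'.entry_swap 2 0, h'.entry_swap 3 0,
      h'.entry_swap 2 1, h'.entry_swap 1 3, h'.entry_swap 3 2]
    ring

lemma crossE_jacobi (a b l : EuclideanSpace ℝ (Fin 3)) :
    crossE (crossE a b) l = crossE a (crossE b l) - crossE b (crossE a l) := by
  ext i
  fin_cases i <;> simp [crossE_apply] <;> ring

lemma asdAct_commutator {K K' : EuclideanSpace ℝ (Fin 4) →L[ℝ] EuclideanSpace ℝ (Fin 4)}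
    (h : IsSkew K) (h' : IsSkew K') :
    asdAct (K ∘L K' - K' ∘L K) = asdAct K ∘L asdAct K' - asdAct K' ∘L asdAct K := by
  refine ContinuousLinearMap.ext fun l => ?_
  rw [asdAct_apply, asdPart_commutator h h', crossE_jacobi]
  rfl

lemma isSkew_asdAct (K : EuclideanSpace ℝ (Fin 4) →L[ℝ] EuclideanSpace ℝ (Fin 4)) :
    IsSkew (asdAct K) := by
  intro u v
  simp only [asdAct_apply, crossE_apply, PiLp.inner_apply, Fin.sum_univ_three]
  simp
  ring

/-- The matrices of the endomorphisms in `Λ₋`, identified with three-space. -/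
def asdMatrix (y : EuclideanSpace ℝ (Fin 3)) : Fin 4 → Fin 4 → ℝ :=
  ![![0, y 0, y 1, y 2], ![-y 0, 0, y 2, -y 1], ![-y 1, -y 2, 0, y 0], ![-y 2, y 1, -y 0, 0]]

/-- The left side is the derivative of the matrix of J corrected by the connection in both slots,
that is, the entries of ∇J. The induced connection therefore preserves Λ₋ and acts there by
`asdAct`. -/
lemma asdMatrix_add_asdAct {K : EuclideanSpace ℝ (Fin 4) →L[ℝ] EuclideanSpace ℝ (Fin 4)}
    (h : IsSkew K) (y η : EuclideanSpace ℝ (Fin 3)) (a b : Fin 4) :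
    asdMatrix η a b - ∑ c, entry K a c * asdMatrix y c b - ∑ c, entry K b c * asdMatrix y a c
      = asdMatrix (η + asdAct K y) a b := by
  have d : ∀ a, entry K a a = 0 := fun a => by have := h.entry_swap a a; linarith
  fin_cases a <;> fin_cases b <;>
  · simp [asdMatrix, Fin.sum_univ_four, asdAct_apply, crossE_apply, asdPart_apply, d,
      h.entry_swap 1 0, h.entry_swap 2 0, h.entry_swap 3 0, h.entry_swap 2 1, h.entry_swap 1 3,
      h.entry_swap 3 2]
    try ring

/-- The factor 4 cancels the denominator in `t ^ 2 / 4` of the twistor metric. -/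
lemma sum_asdMatrix_mul (y η : EuclideanSpace ℝ (Fin 3)) :
    ∑ a, ∑ b, asdMatrix y a b * asdMatrix η a b = 4 * inner ℝ y η := by
  simp only [Fin.sum_univ_four, PiLp.inner_apply, Fin.sum_univ_three, asdMatrix]
  simp
  ring

/-- Up to sign the product of two basis vectors is the third; squaring makes the orientation of `f`
irrelevant. -/
lemma crossE_inner_sq (f : OrthonormalBasis (Fin 3) ℝ (EuclideanSpace ℝ (Fin 3)))
    (a : EuclideanSpace ℝ (Fin 3)) {i j k : Fin 3} (hij : i ≠ j) (hjk : j ≠ k) (hki : k ≠ i) :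
    inner ℝ (crossE a (f i)) (f j) ^ 2 = (inner ℝ a (f k)) ^ 2 := by
  have hlag : ∀ u v : EuclideanSpace ℝ (Fin 3), inner ℝ (crossE u v) (crossE u v) =
      inner ℝ u u * inner ℝ v v - (inner ℝ u v : ℝ) ^ 2 := by
    intro u v
    simp only [crossE_apply, PiLp.inner_apply, Fin.sum_univ_three]
    simp
    ring
  have htrip : ∀ u v w : EuclideanSpace ℝ (Fin 3),
      inner ℝ (crossE u v) w = (inner ℝ u (crossE v w) : ℝ) := by
    intro u v w
    simp only [crossE_apply, PiLp.inner_apply, Fin.sum_univ_three]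
    simp
    ring
  have hself : ∀ u v : EuclideanSpace ℝ (Fin 3), inner ℝ u (crossE u v) = (0 : ℝ) := by
    intro u v
    simp only [crossE_apply, PiLp.inner_apply, Fin.sum_univ_three]
    simp
    ring
  have hself' : ∀ u v : EuclideanSpace ℝ (Fin 3), inner ℝ v (crossE u v) = (0 : ℝ) := by
    intro u v
    simp only [crossE_apply, PiLp.inner_apply, Fin.sum_univ_three]
    simp
    ring
  have o := orthonormal_iff_ite.mp f.orthonormal
  have huniv : (Finset.univ : Finset (Fin 3)) = {i, j, k} := by
    revert i j k; decide
  have hsum : ∀ u v : EuclideanSpace ℝ (Fin 3), inner ℝ u v =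
      inner ℝ u (f i) * inner ℝ (f i) v + (inner ℝ u (f j) * inner ℝ (f j) v
        + inner ℝ u (f k) * (inner ℝ (f k) v : ℝ)) := by
    intro u v
    rw [← f.sum_inner_mul_inner u v, huniv, Finset.sum_insert (by simp [hij, hki.symm]),
      Finset.sum_insert (by simp [hjk]), Finset.sum_singleton]
  have h1 : (inner ℝ (f k) (crossE (f i) (f j)) : ℝ) ^ 2 = 1 := by
    have := hsum (crossE (f i) (f j)) (crossE (f i) (f j))
    rw [hself, hself', hlag, o, o, o, if_neg hij, real_inner_comm (f k)] at this
    simp at this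
    rw [sq, ← this]
  rw [htrip, hsum, hself, hself', mul_zero, mul_zero, zero_add, zero_add, mul_pow, h1, mul_one]

end Quaternionic

/-! ### The algebraic consequences of the curvature identity -/

section CurvatureAlgebra



/-- Rotation of an orthonormal basis by an eighth of a turn in the plane of the last two vectors. -/
lemma exists_rotated_basis (f : OrthonormalBasis (Fin 3) ℝ (EuclideanSpace ℝ (Fin 3))) :
    ∃ g : OrthonormalBasis (Fin 3) ℝ (EuclideanSpace ℝ (Fin 3)), g 0 = f 0 ∧
      g 1 = (√2)⁻¹ • (f 1 + f 2) ∧ g 2 = (√2)⁻¹ • (f 1 - f 2) := by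
  have o := orthonormal_iff_ite.mp f.orthonormal
  have hs : (√2)⁻¹ * ((√2)⁻¹ * 2) = 1 := by
    rw [← mul_assoc, ← mul_inv, Real.mul_self_sqrt (by norm_num)]; norm_num
  have hv : Orthonormal ℝ (![f 0, (√2)⁻¹ • (f 1 +
      f 2), (√2)⁻¹ • (f 1 - f 2)] : Fin 3 → (EuclideanSpace ℝ (Fin 3))) := by
    rw [orthonormal_iff_ite]
    intro i j
    fin_cases i <;> fin_cases j <;>
    simp only [Fin.zero_eta, Fin.mk_one, Fin.reduceFinMk, Matrix.cons_val, inner_smul_left,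
      inner_smul_right, inner_add_left, inner_add_right, inner_sub_left, inner_sub_right, o] <;>
    simp <;> linarith
  obtain ⟨g, hg⟩ := Orthonormal.exists_orthonormalBasis_extension_of_card_eq (ι := Fin 3)
    (by simp) (v := ![f 0, (√2)⁻¹ • (f 1 + f 2), (√2)⁻¹ • (f 1 - f 2)]) (s := Set.univ)
    (hv.comp _ Subtype.val_injective)
  exact ⟨g, hg 0 trivial, hg 1 trivial, hg 2 trivial⟩

/-- For fixed `j` the identity reads Q(f₁) + P(f₀) = 4κ for all orthonormal bases. Exchanging f₁ and
f₂ gives Q(f₁) = Q(f₂), so `Q` is a multiple of the inner product; adding over `j` removes the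
common sum and isolates the rank-one form of n₀ⱼ. -/
lemma asd_eq_zero_of_identity_zero {n : Fin 4 → Fin 4 → (EuclideanSpace ℝ (Fin 3))} {κ : Fin 4 → ℝ}
    (hn : ∀ i j, n i j = - n j i)
    (h : ∀ (f : OrthonormalBasis (Fin 3) ℝ (EuclideanSpace ℝ (Fin 3))) (j : Fin 4), j ≠ 0 →
      κ j - 3 / 4 * inner ℝ (crossE (n 0 j) (f 2)) (crossE (n 0 j) (f 2)) =
      1 / 4 * (∑ k, inner ℝ (crossE (n k 0) (f 2)) (f 0) ^ 2
        + ∑ k, inner ℝ (crossE (n k j) (f 2)) (f 1) ^ 2)) (j : Fin 4) (hj : j ≠ 0) :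
    n 0 j = 0 := by
  have h0 : n 0 0 = 0 := by
    have := hn 0 0
    rwa [eq_neg_iff_add_eq_zero, ← two_smul ℝ, smul_eq_zero_iff_right (by norm_num)] at this
  let Q (j : Fin 4) (v : (EuclideanSpace ℝ (Fin 3))) : ℝ :=
    3 * inner ℝ (n 0 j) v ^ 2 + ∑ k, inner ℝ (n k 0) v ^ 2
  let P (j : Fin 4) (v : (EuclideanSpace ℝ (Fin 3))) : ℝ :=
    3 * inner ℝ (n 0 j) v ^ 2 + ∑ k, inner ℝ (n k j) v ^ 2
  have hQP : ∀ (f : OrthonormalBasis (Fin 3) ℝ (EuclideanSpace ℝ (Fin 3))) (j : Fin 4), j ≠ 0 →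
      Q j (f 1) + P j (f 0) = 4 * κ j := by
    intro f j hj
    have h1 := h f j hj
    have h2 : inner ℝ (crossE (n 0 j) (f 2)) (crossE (n 0 j) (f 2)) =
        inner ℝ (n 0 j) (f 0) ^ 2 + (inner ℝ (n 0 j) (f 1) : ℝ) ^ 2 := by
      have hself : inner ℝ (crossE (n 0 j) (f 2)) (f 2) = (0 : ℝ) := by
        simp only [crossE_apply, PiLp.inner_apply, Fin.sum_univ_three]
        simp
        ring
      rw [← f.sum_inner_mul_inner, Fin.sum_univ_three, hself,
        ← crossE_inner_sq f _ (i := 2) (j := 0) (k := 1) (by decide) (by decide) (by decide),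
        ← crossE_inner_sq f _ (i := 2) (j := 1) (k := 0) (by decide) (by decide) (by decide),
        real_inner_comm _ (f 0), real_inner_comm _ (f 1)]
      ring
    have h3 : ∀ a, inner ℝ (crossE a (f 2)) (f 0) ^ 2 = (inner ℝ a (f 1) : ℝ) ^ 2 := fun a =>
      crossE_inner_sq f a (by decide) (by decide) (by decide)
    have h4 : ∀ a, inner ℝ (crossE a (f 2)) (f 1) ^ 2 = (inner ℝ a (f 0) : ℝ) ^ 2 := fun a =>
      crossE_inner_sq f a (by decide) (by decide) (by decide)
    simp only [h2, h3, h4] at h1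
    simp only [Q, P]
    linarith
  have hQ : ∀ (f : OrthonormalBasis (Fin 3) ℝ (EuclideanSpace ℝ (Fin 3))) (j :
      Fin 4), j ≠ 0 → Q j (f 1) = Q j (f 2) := by
    intro f j hj
    have h1 := hQP f j hj
    have h2 := hQP (f.reindex (Equiv.swap 1 2)) j hj
    simp only [OrthonormalBasis.reindex_apply, Equiv.symm_swap, Equiv.swap_apply_left,
      Equiv.swap_apply_of_ne_of_ne (show (0 : Fin 3) ≠ 1 by decide)
        (show (0 : Fin 3) ≠ 2 by decide)] at h2
    linarith
  have hzero : ∀ (f : OrthonormalBasis (Fin 3) ℝ (EuclideanSpace ℝ (Fin 3))) (j : Fin 4), j ≠ 0 →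
      inner ℝ (n 0 j) (f 1) = (0 : ℝ) := by
    intro f j hj
    -- Equality on f₁ and f₂ gives the diagonal relation; equality on (f₁ ± f₂)/√2 says that the
    -- polar form of `Q` vanishes on f₁, f₂.
    obtain ⟨g, -, hg1, hg2⟩ := exists_rotated_basis f
    have hdiag := fun j hj => hQ f j hj
    have hoff := fun j hj => hQ g j hj
    simp only [hg1, hg2, Q, inner_smul_right, inner_add_right, inner_sub_right, mul_pow, inv_pow,
      Real.sq_sqrt (show (0 : ℝ) ≤ 2 by norm_num), Fin.sum_univ_four, h0, hn _ 0, inner_neg_left,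
      inner_zero_left, neg_sq] at hdiag hoff
    have d1 := hdiag 1 (by decide)
    have d2 := hdiag 2 (by decide)
    have d3 := hdiag 3 (by decide)
    have o1 := hoff 1 (by decide)
    have o2 := hoff 2 (by decide)
    have o3 := hoff 3 (by decide)
    have fin : ∀ p q : ℝ, p ^ 2 = q ^ 2 → p * q = 0 → p = 0 := by
      intro p q h1 h2
      rcases mul_eq_zero.mp h2 with h | h
      · exact h
      · simpa [h] using h1
    -- With xⱼ = ⟨n₀ⱼ,f₁⟩² − ⟨n₀ⱼ,f₂⟩² the diagonal relations are 3xⱼ + x₁ + x₂ + x₃ = 0, an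
    -- invertible system. The products ⟨n₀ⱼ,f₁⟩⟨n₀ⱼ,f₂⟩ satisfy the same system.
    have hcases : j = 1 ∨ j = 2 ∨ j = 3 := by omega
    rcases hcases with rfl | rfl | rfl
    · exact fin _ (inner ℝ (n 0 1) (f 2)) (by linarith) (by linarith)
    · exact fin _ (inner ℝ (n 0 2) (f 2)) (by linarith) (by linarith)
    · exact fin _ (inner ℝ (n 0 3) (f 2)) (by linarith) (by linarith)
  refine ConformalSphereChart.Lifts.ext_hor (e := EuclideanSpace.basisFun (Fin 3) ℝ) fun i => ?_
  have := hzero ((EuclideanSpace.basisFun (Fin 3) ℝ).reindex (Equiv.swap i 1)) j hj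
  simpa using this

/-- The curvature identity of a conformally flat sphere bundle forces the curvature to vanish. -/
lemma asd_eq_zero_of_identity {n : Fin 4 → Fin 4 → (EuclideanSpace ℝ (Fin 3))} {κ :
    Fin 4 → Fin 4 → ℝ}
    (hn : ∀ i j, n i j = - n j i)
    (h : ∀ (f : OrthonormalBasis (Fin 3) ℝ (EuclideanSpace ℝ (Fin 3))) (i j : Fin 4), i ≠ j →
      κ i j - 3 / 4 * inner ℝ (crossE (n i j) (f 2)) (crossE (n i j) (f 2)) =
      1 / 4 * (∑ k, inner ℝ (crossE (n k i) (f 2)) (f 0) ^ 2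
        + ∑ k, inner ℝ (crossE (n k j) (f 2)) (f 1) ^ 2)) {i j : Fin 4} (hij : i ≠ j) :
    n i j = 0 := by
  let σ : Equiv.Perm (Fin 4) := Equiv.swap 0 i
  have h0 : σ 0 = i := Equiv.swap_apply_left 0 i
  have := asd_eq_zero_of_identity_zero (n := fun a b => n (σ a) (σ b)) (κ := fun a => κ i (σ a))
    (fun a b => hn _ _) (fun f a ha => by
      have h1 := h f i (σ a) (by rw [← h0]; exact fun h' => ha (σ.injective h').symm)
      rw [← Equiv.sum_comp σ fun k => inner ℝ (crossE (n k i) (f 2)) (f 0) ^ 2,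
        ← Equiv.sum_comp σ fun k => inner ℝ (crossE (n k (σ a)) (f 2)) (f 1) ^ 2] at h1
      simpa only [h0] using h1) (σ.symm j) (by
        rw [ne_eq, Equiv.symm_apply_eq, h0]; exact hij.symm)
  simpa [h0] using this

/-- A curvature operator of a four-dimensional space, with vanishing component in `Λ₋`, cannot have
constant negative sectional curvature on the planes through a vector. -/
lemma false_of_asdPart_eq_zero
    {R : Fin 4 → Fin 4 → EuclideanSpace ℝ (Fin 4) →L[ℝ] EuclideanSpace ℝ (Fin 4)}
    (hskew : ∀ c d, IsSkew (R c d)) (hanti : ∀ c d, R c d = - R d c)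
    (hbianchi : ∀ a b c d, entry (R a b) c d + entry (R b c) a d + entry (R c a) b d = 0)
    (hasd : ∀ j, j ≠ 0 → asdPart (R 0 j) = 0)
    {c : ℝ} (hc : c ≠ 0) (hsec : ∀ j, j ≠ 0 → entry (R j 0) 0 j = c) : False := by
  -- Component j − 1 for index j is the one containing the sectional curvature of the plane (0, j).
  -- The three equations add up to −3c plus R₀₁₂₃ + R₀₂₃₁ + R₀₃₁₂, with Rₐᵦ꜀ᵈ standing for `entry (R
  -- a b) c d`.
  have e1 := congrArg (fun v => v 0) (hasd 1 (by decide))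
  have e2 := congrArg (fun v => v 1) (hasd 2 (by decide))
  have e3 := congrArg (fun v => v 2) (hasd 3 (by decide))
  simp [asdPart_apply] at e1 e2 e3
  have s1 := hsec 1 (by decide)
  have s2 := hsec 2 (by decide)
  have s3 := hsec 3 (by decide)
  have sw : ∀ a b c d, entry (R a b) c d = - entry (R b a) c d := by
    intro a b c d
    rw [hanti]; simp [entry]
  have sk : ∀ a b c d, entry (R a b) c d = - entry (R a b) d c := fun a b c d =>
    (hskew a b).entry_swap c d
  -- That sum fixes the first index, whereas the Bianchi hypothesis fixes the last; the four
  -- instances together replace the pair symmetry of the curvature tensor.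
  have b0 := hbianchi 0 1 2 3
  have b1 := hbianchi 0 1 3 2
  have b2 := hbianchi 0 2 3 1
  have b3 := hbianchi 1 2 3 0
  apply hc
  linarith [sw 1 0 0 1, sw 2 0 0 2, sw 3 0 0 3, sw 2 0 1 3, sw 3 0 1 2, sw 3 0 2 1, sw 1 3 0 2,
    sk 0 1 2 3, sk 0 2 1 3, sk 0 3 1 2, sk 1 2 0 3, sk 2 3 0 1, sk 3 1 0 2]

end CurvatureAlgebra

/-! ### The Levi-Civita connection form of an orthonormal frame in a chart -/

section Coframe

/-- The endomorphism with given entries. -/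
noncomputable def ofEntries : (Fin 4 → Fin 4 → ℝ) →L[ℝ]
    (EuclideanSpace ℝ (Fin 4) →L[ℝ] EuclideanSpace ℝ (Fin 4)) :=
  LinearMap.toContinuousLinearMap
    { toFun := fun m => LinearMap.toContinuousLinearMap
        { toFun := fun h => WithLp.toLp 2 fun b => ∑ a, h a * m a b
          map_add' := by intro h h'; ext b; simp [add_mul, Finset.sum_add_distrib]
          map_smul' := by intro c h; ext b; simp [mul_assoc, Finset.mul_sum] }
      map_add' := by intro m m'; ext h b; simp [mul_add, Finset.sum_add_distrib]
      map_smul' := by intro c m; ext h b; simp [mul_left_comm, Finset.mul_sum] }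

lemma ofEntries_apply (m : Fin 4 → Fin 4 → ℝ) (h : EuclideanSpace ℝ (Fin 4)) (b : Fin 4) :
    ofEntries m h b = ∑ a, h a * m a b := rfl

lemma entry_ofEntries (m : Fin 4 → Fin 4 → ℝ) (a b : Fin 4) : entry (ofEntries m) a b = m a b := by
  simp [entry, ofEntries_apply]

variable {B : Type*} [NormedAddCommGroup B] [NormedSpace ℝ B]

/-- The linear isomorphism given by a frame. -/
noncomputable def frameMap (ε : Fin 4 → B → B) (ξ : B) : EuclideanSpace ℝ (Fin 4) →L[ℝ] B :=
  ∑ a, (EuclideanSpace.proj a : EuclideanSpace ℝ (Fin 4) →L[ℝ] ℝ).smulRight (ε a ξ)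

lemma frameMap_apply (ε : Fin 4 → B → B) (ξ : B) (h : EuclideanSpace ℝ (Fin 4)) :
    frameMap ε ξ h = ∑ a, h a • ε a ξ := by
  simp [frameMap]

/-- The dual coframe. -/
noncomputable def coframe (ε : Fin 4 → B → B) (ξ : B) : B →L[ℝ] EuclideanSpace ℝ (Fin 4) :=
  (frameMap ε ξ).inverse

/-- The components of the Lie brackets of the vectors of a frame. -/
noncomputable def structureFun (ε : Fin 4 → B → B) (ξ : B) (a b c : Fin 4) : ℝ :=
  coframe ε ξ (lieBracket ℝ (ε a) (ε b) ξ) c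

/-- The connection coefficients of the metric for which the frame is orthonormal. -/
noncomputable def connCoeff (ε : Fin 4 → B → B) (ξ : B) (a b c : Fin 4) : ℝ :=
  1 / 2 * (structureFun ε ξ a b c - structureFun ε ξ a c b - structureFun ε ξ b c a)

/-- The connection form of the metric for which the frame is orthonormal. -/
noncomputable def connForm (ε : Fin 4 → B → B) (ξ : B) :
    B →L[ℝ] EuclideanSpace ℝ (Fin 4) →L[ℝ] EuclideanSpace ℝ (Fin 4) :=
  ∑ a, ((EuclideanSpace.proj a : EuclideanSpace ℝ (Fin 4) →L[ℝ] ℝ) ∘L coframe ε ξ).smulRight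
    (ofEntries (connCoeff ε ξ a))

lemma connForm_apply (ε : Fin 4 → B → B) (ξ u : B) :
    connForm ε ξ u = ∑ a, coframe ε ξ u a • ofEntries (connCoeff ε ξ a) := by
  simp [connForm, sum_apply]

lemma entry_connForm (ε : Fin 4 → B → B) (ξ u : B) (b c : Fin 4) :
    entry (connForm ε ξ u) b c = ∑ a, coframe ε ξ u a * connCoeff ε ξ a b c := by
  have := fun a => entry_ofEntries (connCoeff ε ξ a) b c
  simp only [entry] at this ⊢
  rw [connForm_apply]
  simp [this, sum_apply]

lemma structureFun_swap (ε : Fin 4 → B → B) (ξ : B) (a b c : Fin 4) :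
    structureFun ε ξ a b c = - structureFun ε ξ b a c := by
  simp only [structureFun]
  rw [lieBracket_swap]
  simp

lemma isSkew_connForm (ε : Fin 4 → B → B) (ξ u : B) : IsSkew (connForm ε ξ u) := by
  refine isSkew_of_entry fun b c => ?_
  rw [entry_connForm, entry_connForm, ← Finset.sum_neg_distrib]
  refine Finset.sum_congr rfl fun a _ => ?_
  simp only [connCoeff]
  rw [structureFun_swap ε ξ c b a]
  ring

lemma connCoeff_sub (ε : Fin 4 → B → B) (ξ : B) (a b c : Fin 4) :
    connCoeff ε ξ a b c - connCoeff ε ξ b a c = structureFun ε ξ a b c := by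
  simp only [connCoeff]
  rw [structureFun_swap ε ξ b a c]
  ring

section Invertible

variable {ε : Fin 4 → B → B} {ξ : B}

lemma coframe_frameMap (h : (frameMap ε ξ).IsInvertible) (v : EuclideanSpace ℝ (Fin 4)) :
    coframe ε ξ (frameMap ε ξ v) = v := by
  rw [coframe, ← ContinuousLinearMap.comp_apply, h.inverse_comp_self]; rfl

lemma frameMap_coframe (h : (frameMap ε ξ).IsInvertible) (u : B) :
    frameMap ε ξ (coframe ε ξ u) = u := by
  rw [coframe, ← ContinuousLinearMap.comp_apply, h.self_comp_inverse]; rfl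

lemma frameMap_single (a : Fin 4) : frameMap ε ξ (EuclideanSpace.single a 1) = ε a ξ := by
  simp [frameMap_apply]

lemma coframe_frame (h : (frameMap ε ξ).IsInvertible) (a : Fin 4) :
    coframe ε ξ (ε a ξ) = EuclideanSpace.single a 1 := by
  rw [← frameMap_single (ε := ε) (ξ := ξ) a, coframe_frameMap h]

lemma contDiffAt_frameMap {n : WithTop ℕ∞} (hε : ∀ a, ContDiffAt ℝ n (ε a) ξ) :
    ContDiffAt ℝ n (frameMap ε) ξ := by
  unfold frameMap
  refine ContDiffAt.sum fun a _ => ?_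
  exact contDiffAt_const.smulRight (hε a)

lemma contDiffAt_coframe [CompleteSpace B] {n : WithTop ℕ∞} (hε : ∀ a, ContDiffAt ℝ n (ε a) ξ)
    (h : (frameMap ε ξ).IsInvertible) : ContDiffAt ℝ n (coframe ε) ξ :=
  h.contDiffAt_map_inverse.comp ξ (contDiffAt_frameMap hε)

lemma contDiffAt_structureFun [CompleteSpace B] {m n : WithTop ℕ∞}
    (hε : ∀ a, ContDiffAt ℝ n (ε a) ξ) (hmn : m + 1 ≤ n) (h : (frameMap ε ξ).IsInvertible)
    (a b c : Fin 4) : ContDiffAt ℝ m (fun ξ => structureFun ε ξ a b c) ξ := by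
  have h1 := (contDiffAt_coframe (fun a => (hε a).of_le (le_trans le_self_add hmn)) h).clm_apply
    (ContDiffAt.lieBracket_vectorField (hε a) (hε b) hmn)
  exact (EuclideanSpace.proj c : EuclideanSpace ℝ (Fin 4) →L[ℝ] ℝ).contDiff.contDiffAt.comp ξ h1

lemma contDiffAt_connForm [CompleteSpace B] {m n : WithTop ℕ∞}
    (hε : ∀ a, ContDiffAt ℝ n (ε a) ξ) (hmn : m + 1 ≤ n) (h : (frameMap ε ξ).IsInvertible) :
    ContDiffAt ℝ m (connForm ε) ξ := by
  have hs := contDiffAt_structureFun hε hmn h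
  unfold connForm
  refine ContDiffAt.sum fun a _ => ?_
  refine ContDiffAt.smulRight ?_ ?_
  · exact contDiffAt_const.clm_comp
      (contDiffAt_coframe (fun a => (hε a).of_le (le_trans le_self_add hmn)) h)
  · refine ofEntries.contDiff.contDiffAt.comp ξ ?_
    refine contDiffAt_pi.mpr fun b => contDiffAt_pi.mpr fun c => ?_
    exact contDiffAt_const.mul (((hs a b c).sub (hs a c b)).sub (hs b c a))

/-- Differentiating the duality of frame and coframe turns dθ on frame vectors into minus their
bracket, which the antisymmetric part of the connection coefficients cancels. Bilinearity extends
this to all vectors. -/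
lemma tors_connForm [CompleteSpace B] (hε : ∀ a, ContDiffAt ℝ 1 (ε a) ξ)
    (h : ∀ᶠ ζ in 𝓝 ξ, (frameMap ε ζ).IsInvertible) (u v : B) :
    tors (connForm ε) (coframe ε) ξ u v = 0 := by
  have hi := h.self_of_nhds
  have hd := (contDiffAt_coframe hε hi).differentiableAt (by norm_num)
  have key : ∀ a b, tors (connForm ε) (coframe ε) ξ (ε a ξ) (ε b ξ) = 0 := by
    intro a b
    have h1 : ∀ (b : Fin 4) (w : B), fderiv ℝ (coframe ε) ξ w (ε b ξ) =
        - coframe ε ξ (fderiv ℝ (ε b) ξ w) := by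
      intro b w
      have h2 : (fun ζ => coframe ε ζ (ε b ζ)) =ᶠ[𝓝 ξ] fun _ => EuclideanSpace.single b 1 :=
        h.mono fun ζ hζ => coframe_frame hζ b
      have h3 := congrArg (fun f => f w) (h2.fderiv_eq (𝕜 := ℝ))
      have h4 := hd.hasFDerivAt.clm_apply ((hε b).differentiableAt (by norm_num)).hasFDerivAt
      simp only [h4.fderiv] at h3
      simp at h3
      rw [eq_neg_iff_add_eq_zero, ← h3, add_comm]
    have h5 : ∀ a b c, connForm ε ξ (ε a ξ) (coframe ε ξ (ε b ξ)) c = connCoeff ε ξ a b c := by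
      intro a b c
      rw [coframe_frame hi]
      change entry _ b c = _
      rw [entry_connForm, coframe_frame hi]
      simp
    ext c
    have h6 := connCoeff_sub ε ξ a b c
    rw [← h5, ← h5, structureFun, lieBracket, map_sub] at h6
    rw [tors, extD, h1, h1]
    simp at h6 ⊢
    linarith
  have hu : ∀ u, u = ∑ a, coframe ε ξ u a • ε a ξ := fun u => by
    rw [← frameMap_apply, frameMap_coframe hi]
  rw [hu u, hu v]
  let β : B →ₗ[ℝ] B →ₗ[ℝ] EuclideanSpace ℝ (Fin 4) :=
    LinearMap.mk₂ ℝ (tors (connForm ε) (coframe ε) ξ)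
      (by intro u u' v; simp only [tors, extD, map_add, add_apply]; abel)
      (by intro c u v; simp only [tors, extD, map_smul, smul_apply, smul_sub, smul_add])
      (by intro u v v'; simp only [tors, extD, map_add, add_apply]; abel)
      (by intro c u v; simp only [tors, extD, map_smul, smul_apply, smul_sub, smul_add])
  have hβ : ∀ a b, β (ε a ξ) (ε b ξ) = 0 := key
  change β _ _ = 0
  simp [hβ]

end Invertible

end Coframe

/-! ### Bilinearity, regularity and skew-symmetry of the curvature form -/

section CurvatureForm

variable {B : Type*} [NormedAddCommGroup B] [NormedSpace ℝ B]
  {G : Type*} [NormedAddCommGroup G] [NormedSpace ℝ G]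

/-- The exterior derivative of a one-form as a bilinear map. -/
noncomputable def extDBilin (α : B → B →L[ℝ] G) (x : B) : B →ₗ[ℝ] B →ₗ[ℝ] G :=
  LinearMap.mk₂ ℝ (extD α x)
    (by intro u u' v; simp only [extD, map_add, add_apply]; abel)
    (by intro c u v; simp only [extD, map_smul, smul_apply, smul_sub])
    (by intro u v v'; simp only [extD, map_add, add_apply]; abel)
    (by intro c u v; simp only [extD, map_smul, smul_apply, smul_sub])

/-- The commutator of the values of a linear map, as a bilinear map. -/
noncomputable def commutatorBilin {A : Type*} [Ring A] [Algebra ℝ A] (K : B →ₗ[ℝ] A) :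
    B →ₗ[ℝ] B →ₗ[ℝ] A :=
  LinearMap.mk₂ ℝ (fun u v => K u * K v - K v * K u)
    (by intro u u' v; simp only [map_add, add_mul, mul_add]; abel)
    (by intro c u v; simp only [map_smul, smul_sub, smul_mul_assoc, mul_smul_comm])
    (by intro u v v'; simp only [map_add, add_mul, mul_add]; abel)
    (by intro c u v; simp only [map_smul, smul_sub, smul_mul_assoc, mul_smul_comm])

/-- The curvature as a bilinear map. -/
noncomputable def curvBilin (C : B → B →L[ℝ] G →L[ℝ] G) (x : B) : B →ₗ[ℝ] B →ₗ[ℝ] G →L[ℝ] G :=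
  extDBilin C x + commutatorBilin (C x : B →ₗ[ℝ] G →L[ℝ] G)

lemma curvBilin_apply (C : B → B →L[ℝ] G →L[ℝ] G) (x u v : B) :
    curvBilin C x u v = curv C x u v := rfl

lemma curv_swap (C : B → B →L[ℝ] G →L[ℝ] G) (x u v : B) : curv C x u v = - curv C x v u := by
  ext
  simp only [curv_apply, neg_apply]
  abel

lemma contDiffAt_extD {α : B → B →L[ℝ] G} {u v : B → B} {x : B} {m n : WithTop ℕ∞}
    (hα : ContDiffAt ℝ n α x) (hmn : m + 1 ≤ n) (hu : ContDiffAt ℝ m u x)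
    (hv : ContDiffAt ℝ m v x) : ContDiffAt ℝ m (fun y => extD α y (u y) (v y)) x := by
  have h1 : ContDiffAt ℝ m (fderiv ℝ α) x := hα.fderiv_right hmn
  have h2 := (h1.clm_apply hu).clm_apply hv
  have h3 := (h1.clm_apply hv).clm_apply hu
  exact h2.sub h3

lemma contDiffAt_curv {C : B → B →L[ℝ] G →L[ℝ] G} {u v : B → B} {x : B} {m n : WithTop ℕ∞}
    (hC : ContDiffAt ℝ n C x) (hmn : m + 1 ≤ n) (hu : ContDiffAt ℝ m u x)
    (hv : ContDiffAt ℝ m v x) : ContDiffAt ℝ m (fun y => curv C y (u y) (v y)) x := by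
  have h0 : ContDiffAt ℝ m C x := hC.of_le (le_trans le_self_add hmn)
  have hCu : ContDiffAt ℝ m (fun y => C y (u y)) x := h0.clm_apply hu
  have hCv : ContDiffAt ℝ m (fun y => C y (v y)) x := h0.clm_apply hv
  exact (contDiffAt_extD hC hmn hu hv).add ((hCu.clm_comp hCv).sub (hCv.clm_comp hCu))

lemma isSkew_curv {V : Type*} [NormedAddCommGroup V] [InnerProductSpace ℝ V]
    {C : B → B →L[ℝ] V →L[ℝ] V} {x : B} (hC : DifferentiableAt ℝ C x)
    (hs : ∀ᶠ y in 𝓝 x, ∀ a, IsSkew (C y a)) (a b : B) : IsSkew (curv C x a b) := by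
  intro u v
  have key : ∀ a b, inner ℝ (fderiv ℝ C x a b u) v + inner ℝ u (fderiv ℝ C x a b v) = (0 : ℝ) := by
    intro a b
    have h0 : (fun y => inner ℝ (C y b u) v + inner ℝ u (C y b v)) =ᶠ[𝓝 x] fun _ => 0 :=
      hs.mono fun y hy => hy b u v
    have hCb : DifferentiableAt ℝ (fun y => C y b) x := hC.clm_apply (differentiableAt_const b)
    have hu : ∀ u, HasFDerivAt (fun y => C y b u) _ x :=
      fun u => hCb.hasFDerivAt.clm_apply (hasFDerivAt_const u x)
    have h1 := ((hu u).inner ℝ (hasFDerivAt_const v x)).add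
      ((hasFDerivAt_const u x).inner ℝ (hu v))
    have h2 := congrArg (fun f => f a) ((h1.congr_of_eventuallyEq h0.symm).unique
      (hasFDerivAt_const 0 x))
    simpa [fderiv_eval hC] using h2
  have h1 := key a b
  have h2 := key b a
  have s1 := hs.self_of_nhds a (C x b u) v
  have s2 := hs.self_of_nhds b (C x a u) v
  have s3 := hs.self_of_nhds a u (C x b v)
  have s4 := hs.self_of_nhds b u (C x a v)
  simp only [curv_apply, inner_add_left, inner_add_right, inner_sub_left, inner_sub_right]
  linarith

end CurvatureForm

/-! ### The sphere bundle of Λ₋ over a framed chart -/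

section LocalContradiction

variable {W : Type*} [NormedAddCommGroup W] [InnerProductSpace ℝ W]
  {B : Type*} [NormedAddCommGroup B] [NormedSpace ℝ B]

/-- The connection form on `Λ₋` induced by `C`. -/
noncomputable def asdForm
    (C : W → W →L[ℝ] EuclideanSpace ℝ (Fin 4) →L[ℝ] EuclideanSpace ℝ (Fin 4)) (x : W) :
    W →L[ℝ] EuclideanSpace ℝ (Fin 3) →L[ℝ] EuclideanSpace ℝ (Fin 3) :=
  asdAct ∘L C x

-- The map `asdAct` is constant, linear and a Lie algebra homomorphism on skew endomorphisms, so it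
-- commutes with both terms of the curvature.
set_option synthInstance.maxHeartbeats 200000 in
lemma curv_asdForm {C : W → W →L[ℝ] EuclideanSpace ℝ (Fin 4) →L[ℝ] EuclideanSpace ℝ (Fin 4)}
    {x : W} (hC : DifferentiableAt ℝ C x) (hs : ∀ a, IsSkew (C x a)) (a b : W) :
    curv (asdForm C) x a b = asdAct (curv C x a b) := by
  have h1 : ∀ a b, fderiv ℝ (asdForm C) x a b = asdAct (fderiv ℝ C x a b) := by
    intro a b
    have h2 : HasFDerivAt (asdForm C) _ x := (hasFDerivAt_const asdAct x).clm_comp hC.hasFDerivAt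
    rw [h2.fderiv]
    simp
  rw [curv, curv, map_add, asdAct_commutator (hs a) (hs b), extD, extD, map_sub, h1, h1]
  rfl

/-- A chart of the sphere bundle of `Λ₋` in which the twistor metric, for the metric with
orthonormal frame `ε`, is conformal to the flat one. -/
structure ConformalTwistorChart (t : ℝ) (ε : Fin 4 → B → B) (ξ₀ : B) (x₀ : W) (X : W → B)
    (Y : W → EuclideanSpace ℝ (Fin 3)) (ρ : W → ℝ) : Prop where
  X_eq : X x₀ = ξ₀
  contDiffAt_X : ContDiffAt ℝ 4 X x₀
  contDiffAt_Y : ContDiffAt ℝ 3 Y x₀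
  contDiffAt_ρ : ContDiffAt ℝ 2 ρ x₀
  ρ_pos : 0 < ρ x₀
  inner_Y : ∀ᶠ y in 𝓝 x₀, inner ℝ (Y y) (Y y) = (1 : ℝ)
  conformal : ∀ᶠ y in 𝓝 x₀, ∀ v w,
    inner ℝ (coframe ε (X y) (fderiv ℝ X y v)) (coframe ε (X y) (fderiv ℝ X y w))
    + t ^ 2 * inner ℝ (covDir (asdForm (pullForm X (connForm ε))) v Y y)
      (covDir (asdForm (pullForm X (connForm ε))) w Y y) = ρ y * inner ℝ v w

/-- The curvature of the bundle `Λ₋` along the frame `ε`, applied to `y`. -/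
noncomputable def asdCurvApply (ε : Fin 4 → B → B) (ξ : B) (y : EuclideanSpace ℝ (Fin 3)) :
    EuclideanSpace ℝ (Fin 4) →L[ℝ] EuclideanSpace ℝ (Fin 4) →L[ℝ] EuclideanSpace ℝ (Fin 3) :=
  ∑ c, ∑ d, (EuclideanSpace.proj c : EuclideanSpace ℝ (Fin 4) →L[ℝ] ℝ).smulRight
    ((EuclideanSpace.proj d : EuclideanSpace ℝ (Fin 4) →L[ℝ] ℝ).smulRight
      (asdAct (curv (connForm ε) ξ (ε c ξ) (ε d ξ)) y))

lemma asdCurvApply_apply (ε : Fin 4 → B → B) (ξ : B) (y : EuclideanSpace ℝ (Fin 3))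
    (h h' : EuclideanSpace ℝ (Fin 4)) :
    asdCurvApply ε ξ y h h' =
      asdAct (curv (connForm ε) ξ (frameMap ε ξ h) (frameMap ε ξ h')) y := by
  rw [← curvBilin_apply, frameMap_apply, frameMap_apply]
  simp [asdCurvApply, curvBilin_apply, sum_apply, Finset.smul_sum]
  rw [Finset.sum_comm]
  exact Finset.sum_congr rfl fun c _ => Finset.sum_congr rfl fun d _ => smul_comm _ _ _

lemma contDiffAt_asdCurvApply [CompleteSpace B] {ε : Fin 4 → B → B} {X : W → B}
    {Y : W → EuclideanSpace ℝ (Fin 3)} {x : W} (hX : ContDiffAt ℝ 1 X x)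
    (hY : ContDiffAt ℝ 1 Y x) (hε : ∀ a, ContDiffAt ℝ 3 (ε a) (X x))
    (hi : (frameMap ε (X x)).IsInvertible) :
    ContDiffAt ℝ 1 (fun y => asdCurvApply ε (X y) (Y y)) x := by
  unfold asdCurvApply
  refine ContDiffAt.sum fun c _ => ContDiffAt.sum fun d _ => ?_
  refine contDiffAt_const.smulRight (contDiffAt_const.smulRight ?_)
  refine ContDiffAt.clm_apply ?_ hY
  refine asdAct.contDiff.contDiffAt.comp x ?_
  have h1 := contDiffAt_curv (contDiffAt_connForm (m := 2) hε (by norm_num) hi) (m := 1)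
    (by norm_num) ((hε c).of_le (by norm_num)) ((hε d).of_le (by norm_num))
  exact h1.comp x hX

namespace ConformalTwistorChart

variable {t : ℝ} {ε : Fin 4 → B → B} {ξ₀ : B} {x₀ : W} {X : W → B}
  {Y : W → EuclideanSpace ℝ (Fin 3)} {ρ : W → ℝ}

/-- The underlying conformally flat chart of a sphere bundle. -/
noncomputable def toSphereChart [CompleteSpace B] (hc : ConformalTwistorChart t ε ξ₀ x₀ X Y ρ)
    (hε : ∀ a, ContDiffAt ℝ 4 (ε a) ξ₀) (hi : ∀ᶠ ζ in 𝓝 ξ₀, (frameMap ε ζ).IsInvertible) :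
    ConformalSphereChart W (EuclideanSpace ℝ (Fin 4)) (EuclideanSpace ℝ (Fin 3)) t x₀ :=
  have hX : ∀ᶠ y in 𝓝 x₀, ContDiffAt ℝ 4 X y := hc.contDiffAt_X.eventually (by simp)
  have hlim : Filter.Tendsto X (𝓝 x₀) (𝓝 ξ₀) := hc.X_eq ▸ hc.contDiffAt_X.continuousAt
  have hεX : ∀ᶠ y in 𝓝 x₀, ∀ a, ContDiffAt ℝ 4 (ε a) (X y) :=
    hlim.eventually (Filter.eventually_all.mpr fun a => (hε a).eventually (by simp))
  have hiX : ∀ᶠ y in 𝓝 x₀, ∀ᶠ ζ in 𝓝 (X y), (frameMap ε ζ).IsInvertible :=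
    hlim.eventually hi.eventually_nhds
  have hω : ∀ᶠ y in 𝓝 x₀, ContDiffAt ℝ 3 (connForm ε) (X y) := by
    filter_upwards [hεX, hiX] with y h1 h2
    exact contDiffAt_connForm h1 (by norm_num) h2.self_of_nhds
  have hskew : ∀ y a, IsSkew (pullForm X (connForm ε) y a) := fun y a => isSkew_connForm ε _ _
  have hCH : ∀ᶠ y in 𝓝 x₀, ContDiffAt ℝ 3 (pullForm X (connForm ε)) y := by
    filter_upwards [hX, hω] with y h1 h2
    exact h1.pullForm h2 (by norm_num)
  have hcurv : ∀ᶠ y in 𝓝 x₀, ∀ a b, curv (asdForm (pullForm X (connForm ε))) y a b =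
      asdAct (curv (connForm ε) (X y) (fderiv ℝ X y a) (fderiv ℝ X y b)) := by
    filter_upwards [hX, hω, hCH] with y h1 h2 h3 a b
    rw [curv_asdForm (h3.differentiableAt (by norm_num)) (hskew y),
      curv_pullForm (h1.of_le (by norm_num)) (h2.differentiableAt (by norm_num))]
  { θ := pullForm X (coframe ε)
    CH := pullForm X (connForm ε)
    CL := asdForm (pullForm X (connForm ε))
    Y := Y
    F := fun y => asdCurvApply ε (X y) (Y y)
    ρ := ρ
    contDiffAt_θ := hc.contDiffAt_X.pullForm (contDiffAt_coframe (n := 2)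
      (fun a => (hεX.self_of_nhds a).of_le (by norm_num)) hiX.self_of_nhds.self_of_nhds)
      (by norm_num)
    contDiffAt_CH := hCH.self_of_nhds.of_le (by norm_num)
    contDiffAt_CL := contDiffAt_const.clm_comp (hCH.self_of_nhds.of_le (by norm_num))
    contDiffAt_Y := hc.contDiffAt_Y
    contDiffAt_F := contDiffAt_asdCurvApply (hc.contDiffAt_X.of_le (by norm_num))
      (hc.contDiffAt_Y.of_le (by norm_num)) (fun a => (hεX.self_of_nhds a).of_le (by norm_num))
      hiX.self_of_nhds.self_of_nhds
    contDiffAt_ρ := hc.contDiffAt_ρ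
    ρ_pos := hc.ρ_pos
    skew_CH := Filter.Eventually.of_forall hskew
    skew_CL := Filter.Eventually.of_forall fun y a => isSkew_asdAct _
    inner_Y := hc.inner_Y
    tors_θ := by
      filter_upwards [hX, hεX, hiX] with y h1 h2 h3 a b
      have h4 : ∀ a, ContDiffAt ℝ 1 (ε a) (X y) := fun a => (h2 a).of_le (by norm_num)
      rw [tors_pullForm (h1.of_le (by norm_num))
        ((contDiffAt_coframe h4 h3.self_of_nhds).differentiableAt (by norm_num)),
        tors_connForm h4 h3]
    curv_CL := by
      filter_upwards [hcurv, hiX] with y h1 h2 a b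
      rw [h1, asdCurvApply_apply, pullForm, ContinuousLinearMap.comp_apply,
        ContinuousLinearMap.comp_apply, frameMap_coframe h2.self_of_nhds,
        frameMap_coframe h2.self_of_nhds]
    curv_CL_horizontal := by
      intro a b h
      -- The coframe is injective, so the base point does not move along `a`; the curvature is
      -- pulled back from the base.
      have h1 : fderiv ℝ X x₀ a = 0 := by
        rw [← frameMap_coframe hiX.self_of_nhds.self_of_nhds (fderiv ℝ X x₀ a)]
        simp only [pullForm, ContinuousLinearMap.comp_apply] at h
        rw [h, map_zero]
      rw [hcurv.self_of_nhds, h1, ← curvBilin_apply]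
      simp
    conformal := by
      filter_upwards [hc.conformal] with y h v w
      rw [← h v w]
      simp only [vertForm_apply, inner_smul_left, inner_smul_right, conj_trivial, pullForm,
        ContinuousLinearMap.comp_apply]
      ring }

end ConformalTwistorChart

end LocalContradiction

/-! ### Existence of lifts and the contradiction over one fibre -/

section LocalContradiction

namespace ConformalSphereChart

variable {W : Type*} [NormedAddCommGroup W] [InnerProductSpace ℝ W] [FiniteDimensional ℝ W]
  {H : Type*} [NormedAddCommGroup H] [InnerProductSpace ℝ H] [FiniteDimensional ℝ H]
  {L : Type*} [NormedAddCommGroup L] [InnerProductSpace ℝ L] [FiniteDimensional ℝ L]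
  {t : ℝ} {x₀ : W} (D : ConformalSphereChart W H L t x₀)

lemma inner_E_Y (v : W) : inner ℝ (D.E x₀ v) (D.Y x₀) = (0 : ℝ) := by
  have hd : DifferentiableAt ℝ D.Y x₀ := D.contDiffAt_Y.differentiableAt (by norm_num)
  have h1 := fderiv_inner_covDir hd hd D.skew_CL.self_of_nhds v
  have h2 : (fun z => inner ℝ (D.Y z) (D.Y z)) =ᶠ[𝓝 x₀] fun _ => (1 : ℝ) := D.inner_Y
  rw [h2.fderiv_eq, real_inner_comm] at h1
  simp only [fderiv_fun_const, Pi.zero_apply, zero_apply] at h1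
  simp only [E, vertForm_apply, inner_smul_left, conj_trivial]
  rw [real_inner_comm, show inner ℝ (D.Y x₀) (covDir D.CL v D.Y x₀) = (0 : ℝ) by linarith, mul_zero]

/-- For dimensional reasons, horizontal and vertical vectors have lifts to a conformal chart. -/
lemma exists_lift (hdim : finrank ℝ W + 1 = finrank ℝ H + finrank ℝ L) (h : H) (l : L)
    (hl : inner ℝ l (D.Y x₀) = (0 : ℝ)) : ∃ v, D.θ x₀ v = h ∧ D.E x₀ v = l := by
  -- The image of `E` misses the direction `Y`. One extra real parameter along `Y` makes the
  -- dimensions agree, and injectivity is positivity of the conformal metric.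
  let A : W × ℝ →ₗ[ℝ] H × L :=
    { toFun := fun p => (D.θ x₀ p.1, D.E x₀ p.1 + p.2 • D.Y x₀)
      map_add' := by intro p q; simp only [Prod.fst_add, Prod.snd_add, map_add, add_smul,
        Prod.mk_add_mk]; congr 1; abel
      map_smul' := by intro c p; simp [mul_smul] }
  have hY : inner ℝ (D.Y x₀) (D.Y x₀) = (1 : ℝ) := D.inner_Y.self_of_nhds
  have hinj : Function.Injective A := by
    rw [← LinearMap.ker_eq_bot, LinearMap.ker_eq_bot']
    rintro ⟨v, c⟩ hvc
    simp only [A, LinearMap.coe_mk, AddHom.coe_mk, Prod.mk_eq_zero] at hvc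
    obtain ⟨h1, h2⟩ := hvc
    have hc : c = 0 := by
      have := congrArg (fun u => inner ℝ u (D.Y x₀)) h2
      simpa only [inner_add_left, inner_smul_left, D.inner_E_Y, hY, inner_zero_left, conj_trivial,
        zero_add, mul_one] using this
    rw [hc, zero_smul, add_zero] at h2
    have h3 := D.conformal.self_of_nhds v v
    have h2' : vertForm t D.CL D.Y x₀ v = 0 := h2
    rw [h1, h2', inner_zero_left, inner_zero_left, add_zero, eq_comm, mul_eq_zero,
      inner_self_eq_zero] at h3
    rw [hc, h3.resolve_left D.ρ_pos.ne']
    rfl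
  have hsurj : Function.Surjective A :=
    (LinearMap.injective_iff_surjective_of_finrank_eq_finrank (by simp [hdim])).mp hinj
  obtain ⟨⟨v, c⟩, hv⟩ := hsurj (h, l)
  simp only [A, LinearMap.coe_mk, AddHom.coe_mk, Prod.mk.injEq] at hv
  have hc : c = 0 := by
    have := congrArg (fun u => inner ℝ u (D.Y x₀)) hv.2
    simpa only [inner_add_left, inner_smul_left, D.inner_E_Y, hY, hl, conj_trivial, zero_add,
      mul_one] using this
  exact ⟨v, hv.1, by simpa [hc] using hv.2⟩

lemma exists_lifts (hdim : finrank ℝ W + 1 = finrank ℝ H + finrank ℝ L) {ι : Type*} [Fintype ι]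
    [DecidableEq ι] (e : OrthonormalBasis ι ℝ H) (f : OrthonormalBasis (Fin 3) ℝ L)
    (hf : D.Y x₀ = f 2) : ∃ hor ver, D.Lifts e f hor ver := by
  have o := orthonormal_iff_ite.mp f.orthonormal
  choose hor hhor using fun i => D.exists_lift hdim (e i) 0 (inner_zero_left _)
  choose ver hver using fun k : Fin 2 => D.exists_lift hdim 0 (f k.castSucc)
    (by rw [hf]; fin_cases k <;> simp [o])
  exact ⟨hor, ver, hf, fun i => (hhor i).1, fun i => (hhor i).2, fun k => (hver k).1,
    fun k => (hver k).2⟩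

end ConformalSphereChart

variable {W : Type*} [NormedAddCommGroup W] [InnerProductSpace ℝ W] [FiniteDimensional ℝ W]
  {B : Type*} [NormedAddCommGroup B] [NormedSpace ℝ B] [CompleteSpace B]

/-- The curvatures are pulled back from the base, so the chart drops out of `curv_identity`: only
the frame at `ξ₀` and the basis `f` with `f 2 = Y x₀` remain, and identities from different charts
can be compared. -/
lemma ConformalTwistorChart.identity {t : ℝ} {ε : Fin 4 → B → B} {ξ₀ : B} {x₀ : W} {X : W → B}
    {Y : W → EuclideanSpace ℝ (Fin 3)} {ρ : W → ℝ} (ht : t ≠ 0) (hdim : finrank ℝ W = 6)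
    (hc : ConformalTwistorChart t ε ξ₀ x₀ X Y ρ)
    (hε : ∀ a, ContDiffAt ℝ 4 (ε a) ξ₀) (hi : ∀ᶠ ζ in 𝓝 ξ₀, (frameMap ε ζ).IsInvertible)
    {f : OrthonormalBasis (Fin 3) ℝ (EuclideanSpace ℝ (Fin 3))} (hf : Y x₀ = f 2)
    {n : Fin 4 → Fin 4 → EuclideanSpace ℝ (Fin 3)}
    (hn : ∀ a b, n a b = t • asdPart (curv (connForm ε) ξ₀ (ε a ξ₀) (ε b ξ₀)))
    {i j : Fin 4} (hij : i ≠ j) :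
    1 / t ^ 2 + entry (curv (connForm ε) ξ₀ (ε j ξ₀) (ε i ξ₀)) i j
      - 3 / 4 * inner ℝ (crossE (n i j) (f 2)) (crossE (n i j) (f 2)) =
      1 / 4 * (∑ k, inner ℝ (crossE (n k i) (f 2)) (f 0) ^ 2
        + ∑ k, inner ℝ (crossE (n k j) (f 2)) (f 1) ^ 2) := by
  let D := hc.toSphereChart hε hi
  obtain ⟨hor, ver, hD⟩ := D.exists_lifts (by simp [hdim]) (EuclideanSpace.basisFun (Fin 4) ℝ) f hf
  have h := hD.curv_identity ht hij
  have hi0 := hi.self_of_nhds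
  have hF : ∀ a b, t • D.F x₀ (EuclideanSpace.basisFun (Fin 4) ℝ a)
      (EuclideanSpace.basisFun (Fin 4) ℝ b) = crossE (n a b) (f 2) := by
    intro a b
    change t • asdCurvApply ε (X x₀) (Y x₀) _ _ = _
    rw [asdCurvApply_apply, hc.X_eq, hf, EuclideanSpace.basisFun_apply,
      EuclideanSpace.basisFun_apply, frameMap_single, frameMap_single, hn, asdAct_apply, map_smul,
      smul_apply]
  have hX : ∀ a, fderiv ℝ X x₀ (hor a) = ε a ξ₀ := by
    intro a
    have h1 : coframe ε (X x₀) (fderiv ℝ X x₀ (hor a)) = EuclideanSpace.basisFun (Fin 4) ℝ a :=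
      hD.θ_hor a
    rw [hc.X_eq, EuclideanSpace.basisFun_apply] at h1
    rw [← frameMap_coframe hi0 (fderiv ℝ X x₀ (hor a)), h1, frameMap_single]
  have hcurv : curv D.CH x₀ (hor j) (hor i) = curv (connForm ε) ξ₀ (ε j ξ₀) (ε i ξ₀) := by
    change curv (pullForm X (connForm ε)) x₀ _ _ = _
    have hω : ContDiffAt ℝ 3 (connForm ε) (X x₀) := by
      rw [hc.X_eq]; exact contDiffAt_connForm hε (by norm_num) hi0
    rw [curv_pullForm (hc.contDiffAt_X.of_le (by norm_num)) (hω.differentiableAt (by norm_num)),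
      hX, hX, hc.X_eq]
  rw [hcurv] at h
  simp only [hF] at h
  rw [entry_eq_inner]
  simpa only [EuclideanSpace.basisFun_apply] using h

/-- A four-dimensional metric, given by the orthonormal frame `ε`, does not admit conformally flat
charts of its twistor space at all points of the fibre over `ξ₀`. -/
theorem not_forall_conformalTwistorChart {t : ℝ} {ε : Fin 4 → B → B} {ξ₀ : B} (ht : t ≠ 0)
    (hdim : finrank ℝ W = 6)
    (hε : ∀ a, ContDiffAt ℝ 4 (ε a) ξ₀) (hi : ∀ᶠ ζ in 𝓝 ξ₀, (frameMap ε ζ).IsInvertible)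
    (h : ∀ f : OrthonormalBasis (Fin 3) ℝ (EuclideanSpace ℝ (Fin 3)), ∃ (x₀ : W) (X : W → B)
      (Y : W → EuclideanSpace ℝ (Fin 3)) (ρ : W → ℝ),
      ConformalTwistorChart t ε ξ₀ x₀ X Y ρ ∧ Y x₀ = f 2) : False := by
  let R (a b : Fin 4) := curv (connForm ε) ξ₀ (ε a ξ₀) (ε b ξ₀)
  let n (a b : Fin 4) := t • asdPart (R a b)
  have hi0 := hi.self_of_nhds
  have hω : ContDiffAt ℝ 3 (connForm ε) ξ₀ := contDiffAt_connForm hε (by norm_num) hi0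
  have hanti : ∀ a b, R a b = - R b a := fun a b => curv_swap _ _ _ _
  have hid : ∀ (f : OrthonormalBasis (Fin 3) ℝ (EuclideanSpace ℝ (Fin 3))) (i j : Fin 4), i ≠ j →
      (1 / t ^ 2 + entry (R j i) i j)
        - 3 / 4 * inner ℝ (crossE (n i j) (f 2)) (crossE (n i j) (f 2)) =
      1 / 4 * (∑ k, inner ℝ (crossE (n k i) (f 2)) (f 0) ^ 2
        + ∑ k, inner ℝ (crossE (n k j) (f 2)) (f 1) ^ 2) := by
    intro f i j hij
    obtain ⟨x₀, X, Y, ρ, hc, hf⟩ := h f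
    exact hc.identity ht hdim hε hi hf (fun _ _ => rfl) hij
  have hnanti : ∀ i j, n i j = - n j i := by
    intro i j
    simp only [n, hanti i j, map_neg, smul_neg]
  have hn : ∀ i j, n i j = 0 := by
    intro i j
    rcases eq_or_ne i j with rfl | hij
    · have := hnanti i i
      rwa [eq_neg_iff_add_eq_zero, ← two_smul ℝ, smul_eq_zero_iff_right (by norm_num)] at this
    · exact asd_eq_zero_of_identity (κ := fun i j => 1 / t ^ 2 + entry (R j i) i j) hnanti hid hij
  refine false_of_asdPart_eq_zero (R := R) (c := - (1 / t ^ 2))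
    (fun c d => isSkew_curv (hω.differentiableAt (by norm_num))
      (Filter.Eventually.of_forall fun y a => isSkew_connForm ε y a) _ _)
    hanti ?_ ?_ (by simpa using ht) ?_
  · intro a b c d
    have h1 : ∀ᶠ y in 𝓝 ξ₀, ∀ u v, tors (connForm ε) (coframe ε) y u v = 0 := by
      filter_upwards [hi.eventually_nhds, Filter.eventually_all.mpr fun a =>
        (hε a).eventually (by simp)] with y h1 h2 u v
      exact tors_connForm (fun a => (h2 a).of_le (by norm_num)) h1 u v
    have h2 := curv_cyclic (hω.of_le (by norm_num))
      (contDiffAt_coframe (n := 2) (fun a => (hε a).of_le (by norm_num)) hi0) h1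
      (ε a ξ₀) (ε b ξ₀) (ε c ξ₀)
    rw [coframe_frame hi0, coframe_frame hi0, coframe_frame hi0] at h2
    simpa [entry, R] using congrArg (fun v => v d) h2
  · intro j _
    simpa [n, ht] using hn 0 j
  · intro j hj
    -- With n = 0 any basis serves, and the identity reduces to 1/t² + K = 0.
    have := hid (EuclideanSpace.basisFun (Fin 3) ℝ) 0 j hj.symm
    simp only [hn, map_zero, zero_apply, inner_zero_left] at this
    simp at this
    rw [one_div]
    linarith

end LocalContradiction

/-! ### The connector of the endomorphism bundle -/

section Connector

local notation "E₄" => EuclideanSpace ℝ (Fin 4)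

variable {M : Type*} [TopologicalSpace M] [ChartedSpace E₄ M]
  [IsManifold (𝓡 4) ∞ M]

/-- The coordinates of `End(T_p M)` in the trivialization at `p`. -/
lemma inCoordinates_tangent_self (p : M)
    (A : TangentSpace (𝓡 4) p →L[ℝ] TangentSpace (𝓡 4) p) :
    ContinuousLinearMap.inCoordinates E₄ (TangentSpace (𝓡 4) : M → Type _)
      E₄ (TangentSpace (𝓡 4) : M → Type _) p p p p A = A := by
  have h : ∀ v : E₄, (tangentBundleCore (𝓡 4) M).coordChange (achart E₄ p) (achart E₄ p) p v = v :=
    fun v => (tangentBundleCore (𝓡 4) M).coordChange_self _ _ (mem_chart_source _ p) v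
  simp only [ContinuousLinearMap.inCoordinates]
  rw [TangentBundle.continuousLinearMapAt_trivializationAt_eq_core (mem_chart_source _ p),
    TangentBundle.symmL_trivializationAt_eq_core (mem_chart_source _ p)]
  ext v : 1
  exact (h _).trans (congrArg (A : E₄ → E₄) (h v))

lemma hasMFDerivAt_endBundle_proj (z : EndBundle M) :
    HasMFDerivAt endModel (𝓡 4) (TotalSpace.proj : EndBundle M → M) z
      (ContinuousLinearMap.fst ℝ E₄ (E₄ →L[ℝ] E₄)) := by
  have key : ∀ u ∈ (extChartAt endModel z).target,
      writtenInExtChartAt endModel (𝓡 4) z (TotalSpace.proj : EndBundle M → M) u = u.1 := by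
    intro u hu
    rw [FiberBundle.extChartAt_target] at hu
    have h1 : (((extChartAt endModel z).symm u).proj) = (extChartAt (𝓡 4) z.proj).symm u.1 := by
      simp only [FiberBundle.extChartAt]
      exact (trivializationAt (E₄ →L[ℝ] E₄)
        (fun p : M => TangentSpace (𝓡 4) p →L[ℝ] TangentSpace (𝓡 4) p) z.proj).proj_symm_apply'
            hu.1.2
    simp only [writtenInExtChartAt, Function.comp_apply, h1]
    exact (extChartAt (𝓡 4) z.proj).right_inv hu.1.1
  refine ⟨(FiberBundle.continuous_proj _ _).continuousAt, ?_⟩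
  refine (ContinuousLinearMap.fst ℝ E₄ (E₄ →L[ℝ] E₄)).hasFDerivWithinAt.congr_of_eventuallyEq ?_
    (key _ (mem_extChartAt_target z))
  filter_upwards [extChartAt_target_mem_nhdsWithin (I := endModel) z] with u hu using key u hu

lemma hasMFDerivAt_fiber (z : EndBundle M)
    (A : TangentSpace (𝓡 4) z.proj →L[ℝ] TangentSpace (𝓡 4) z.proj) :
    HasMFDerivAt 𝓘(ℝ, ℝ) endModel (fun c : ℝ => (⟨z.proj, z.snd + c • A⟩ : EndBundle M)) 0
      ((1 : ℝ →L[ℝ] ℝ).smulRight ((0, A) : E₄ × (E₄ →L[ℝ] E₄))) := by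
  have hw : ∀ c : ℝ, (extChartAt endModel (⟨z.proj, z.snd +
      (0 : ℝ) • A⟩ : EndBundle M)) (⟨z.proj, z.snd + c • A⟩ : EndBundle M)
      = ((extChartAt (𝓡 4) z.proj z.proj, z.snd + c • A) : E₄ × (E₄ →L[ℝ] E₄)) := by
    intro c
    simp only [FiberBundle.extChartAt]
    refine Prod.ext rfl ?_
    exact inCoordinates_tangent_self _ _
  have hd : HasFDerivAt (fun c : ℝ => ((extChartAt (𝓡 4) z.proj z.proj, z.snd +
      c • A) : E₄ × (E₄ →L[ℝ] E₄)))
     ((1 : ℝ →L[ℝ] ℝ).smulRight ((0, A) : E₄ × (E₄ →L[ℝ] E₄))) 0 := by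
    have h1 : HasFDerivAt (fun c : ℝ => ((extChartAt (𝓡 4) z.proj z.proj, z.snd) :
        E₄ × (E₄ →L[ℝ] E₄)) + c • ((0, A) : E₄ × (E₄ →L[ℝ] E₄)))
       ((1 : ℝ →L[ℝ] ℝ).smulRight ((0, A) : E₄ × (E₄ →L[ℝ] E₄))) 0 := 
      ((1 : ℝ →L[ℝ] ℝ).smulRight ((0, A) : E₄ × (E₄ →L[ℝ] E₄))).hasFDerivAt.const_add _
    refine h1.congr_of_eventuallyEq (Filter.Eventually.of_forall fun c => ?_)
    refine Prod.ext ?_ rfl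
    exact (add_zero (extChartAt (𝓡 4) z.proj z.proj :
        E₄)).symm.trans (congrArg _ (smul_zero c).symm)
  have hcont : ContinuousAt (fun c : ℝ => (⟨z.proj, z.snd + c • A⟩ : EndBundle M)) 0 := by
    rw [FiberBundle.continuousAt_totalSpace]
    refine ⟨continuousAt_const, ?_⟩
    have := hd.continuousAt.snd
    refine this.congr (Filter.Eventually.of_forall fun c => ?_)
    exact (inCoordinates_tangent_self _ _).symm
  refine ⟨hcont, ?_⟩
  refine (HasFDerivAt.congr_of_eventuallyEq hd
    (Filter.Eventually.of_forall fun c => ?_)).hasFDerivWithinAt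
  simp only [writtenInExtChartAt, Function.comp_apply, mfld_simps]
  exact hw c

variable [RiemannianBundle (fun p : M => TangentSpace (𝓡 4) p)]
  [IsContMDiffRiemannianBundle (𝓡 4) ∞ E₄ (fun p : M => TangentSpace (𝓡 4) p)]

/-- Differentiability at a point of a vector field on a four-manifold. -/
abbrev MDiffFieldAt (s : Π p : M, TangentSpace (𝓡 4) p) (p : M) : Prop :=
  MDifferentiableAt (𝓡 4) (𝓡 4).tangent (fun q => (⟨q, s q⟩ : TangentBundle (𝓡 4) M)) p

/-- Smoothness at a point of a vector field on a four-manifold. -/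
abbrev SmoothFieldAt (s : Π p : M, TangentSpace (𝓡 4) p) (p : M) : Prop :=
  ContMDiffAt (𝓡 4) (𝓡 4).tangent ∞ (fun q => (⟨q, s q⟩ : TangentBundle (𝓡 4) M)) p

lemma SmoothFieldAt.mdiffFieldAt {s : Π p : M, TangentSpace (𝓡 4) p} {p : M}
    (h : SmoothFieldAt s p) : MDiffFieldAt s p :=
  h.mdifferentiableAt (by simp)

/-- The matrix entry `⟪J s, r⟫` of an endomorphism with respect to vector fields `s`, `r`. -/
noncomputable def endEntry (s r : Π p : M, TangentSpace (𝓡 4) p) (z : EndBundle M) : ℝ :=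
  inner ℝ (z.snd (s z.proj)) (r z.proj)

lemma isContMDiffRiemannianBundle_one :
    IsContMDiffRiemannianBundle (𝓡 4) 1 E₄ (fun p : M => TangentSpace (𝓡 4) p) :=
  .of_le (n := ∞) (by simp)

lemma mdifferentiableAt_endEntry {s r : Π p : M, TangentSpace (𝓡 4) p} {z : EndBundle M}
    (hs : MDiffFieldAt s z.proj) (hr : MDiffFieldAt r z.proj) :
    MDifferentiableAt endModel 𝓘(ℝ, ℝ) (endEntry s r) z := by
  have hp := (hasMFDerivAt_endBundle_proj z).mdifferentiableAt
  have h1 : MDifferentiableAt endModel endModel (fun w : EndBundle M => (⟨w.proj, w.snd⟩ :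
      EndBundle M)) z :=
    mdifferentiableAt_id
  have h2 := h1.clm_bundle_apply (hs.comp z hp)
  have := isContMDiffRiemannianBundle_one (M := M)
  exact h2.inner_bundle (hr.comp z hp)

lemma contMDiffAt_endEntry {s r : Π p : M, TangentSpace (𝓡 4) p} {z : EndBundle M}
    (hs : SmoothFieldAt s z.proj) (hr : SmoothFieldAt r z.proj) :
    ContMDiffAt endModel 𝓘(ℝ, ℝ) ∞ (endEntry s r) z := by
  have hp : ContMDiffAt endModel (𝓡 4) ∞ (TotalSpace.proj : EndBundle M → M) z :=
    contMDiffAt_proj _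
  have h1 : ContMDiffAt endModel endModel ∞ (fun w : EndBundle M => (⟨w.proj, w.snd⟩ :
      EndBundle M)) z :=
    contMDiffAt_id
  have h2 := h1.clm_bundle_apply (hs.comp z hp)
  exact h2.inner_bundle (hr.comp z hp)

lemma mfderiv_endEntry_vertical {s r : Π p : M, TangentSpace (𝓡 4) p} {z : EndBundle M}
    (hs : MDiffFieldAt s z.proj) (hr : MDiffFieldAt r z.proj)
    (A : TangentSpace (𝓡 4) z.proj →L[ℝ] TangentSpace (𝓡 4) z.proj) :
    mfderiv endModel 𝓘(ℝ, ℝ) (endEntry s r) z ((0, A) : E₄ × (E₄ →L[ℝ] E₄)) =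
      inner ℝ (A (s z.proj)) (r z.proj) := by
  have hf := (mdifferentiableAt_endEntry hs hr).hasMFDerivAt
  -- The curve at 0 is `z.snd + 0 • A`, equal to `z.snd` only propositionally, so the derivative is
  -- transported along that equality.
  have hf' : HasMFDerivAt endModel 𝓘(ℝ, ℝ) (endEntry s r)
    ((fun c : ℝ => (⟨z.proj, z.snd + c • A⟩ : EndBundle M)) 0)
    (mfderiv endModel 𝓘(ℝ, ℝ) (endEntry s r) z) := by
    have h0 : ∀ y : EndBundle M, y = z → HasMFDerivAt endModel 𝓘(ℝ, ℝ) (endEntry s r) y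
      (mfderiv endModel 𝓘(ℝ, ℝ) (endEntry s r) z) := by rintro _ rfl; exact hf
    exact h0 _ (by simp only [zero_smul, add_zero])
  have h := hf'.comp (0 : ℝ) (hasMFDerivAt_fiber z A)
  have h2 : HasMFDerivAt 𝓘(ℝ, ℝ) 𝓘(ℝ, ℝ) (endEntry s r ∘
      fun c : ℝ => (⟨z.proj, z.snd + c • A⟩ : EndBundle M)) 0
     ((1 : ℝ →L[ℝ] ℝ).smulRight (inner ℝ (A (s z.proj)) (r z.proj) : ℝ)) := by
    refine HasFDerivAt.hasMFDerivAt ?_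
    have h3 : (endEntry s r ∘ fun c : ℝ => (⟨z.proj, z.snd + c • A⟩ : EndBundle M)) = fun c =>
        inner ℝ (z.snd (s z.proj)) (r z.proj) + c * inner ℝ (A (s z.proj)) (r z.proj) := by
      ext c
      simp [endEntry, inner_add_left, inner_smul_left]
    rw [h3]
    exact (((1 : ℝ →L[ℝ] ℝ).smulRight
      (inner ℝ (A (s z.proj)) (r z.proj) : ℝ)).hasFDerivAt (x := (0 : ℝ))).const_add _
  have h4 := congrArg (fun L : ℝ →L[ℝ] ℝ => L 1) (hasMFDerivAt_unique h h2)
  have h5 : mfderiv endModel 𝓘(ℝ, ℝ) (endEntry s r) z ((1 : ℝ) • ((0, A) : E₄ × (E₄ →L[ℝ] E₄))) =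
      (1 : ℝ) • (inner ℝ (A (s z.proj)) (r z.proj) : ℝ) := h4
  rwa [one_smul, one_smul] at h5

/-- The vectors `w` and dσ(ξ) have the same projection, so their difference is the vertical vector
`A`; on it the derivative of an entry is the entry of `A`, and along dσ(ξ) the chain rule applies.
-/
lemma mfderiv_endEntry_sub {s r : Π p : M, TangentSpace (𝓡 4) p} {p : M}
    (hs : MDiffFieldAt s p) (hr : MDiffFieldAt r p)
    {σ : Π p : M, TangentSpace (𝓡 4) p →L[ℝ] TangentSpace (𝓡 4) p}
    (hσ : MDifferentiableAt (𝓡 4) endModel (fun q => (⟨q, σ q⟩ : EndBundle M)) p)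
    (w : E₄ × (E₄ →L[ℝ] E₄)) (A : TangentSpace (𝓡 4) p →L[ℝ] TangentSpace (𝓡 4) p)
    (hA : A = w.2 - Prod.snd (mfderiv (𝓡 4) endModel (fun q => (⟨q, σ q⟩ : EndBundle M)) p w.1 :
        E₄ × (E₄ →L[ℝ] E₄))) :
    inner ℝ (A (s p)) (r p) =
      mvfderiv endModel (endEntry s r) ⟨p, σ p⟩ w
      - mvfderiv (𝓡 4) (fun q => inner ℝ (σ q (s q)) (r q)) p w.1 := by
  set S : E₄ × (E₄ →L[ℝ] E₄) := mfderiv (𝓡 4) endModel (fun q => (⟨q, σ q⟩ : EndBundle M)) p w.1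
    with hS
  have h1 : S.1 = w.1 := by
    have h := (hasMFDerivAt_endBundle_proj (⟨p, σ p⟩ : EndBundle M)).comp p hσ.hasMFDerivAt
    have h' := hasMFDerivAt_unique h (hasMFDerivAt_id p)
    exact congrArg (fun L : E₄ →L[ℝ] E₄ => L w.1) h'
  have h2 := mfderiv_endEntry_vertical (z := (⟨p, σ p⟩ : EndBundle M)) hs hr A
  have h3 : ((0, A) : E₄ × (E₄ →L[ℝ] E₄)) = w - S := by
    refine Prod.ext ?_ hA
    rw [Prod.fst_sub, h1, sub_self]
  have h4 : mvfderiv (𝓡 4) (fun q => inner ℝ (σ q (s q)) (r q)) p w.1 =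
      mvfderiv endModel (endEntry s r) ⟨p, σ p⟩ S := by
    have h := mfderiv_comp p (mdifferentiableAt_endEntry (z := (⟨p, σ p⟩ : EndBundle M)) hs hr) hσ
    exact congrArg (fun L : E₄ →L[ℝ] ℝ => L w.1) h
  rw [h4]
  refine h2.symm.trans ?_
  have h5 : ∀ (L : E₄ × (E₄ →L[ℝ] E₄) →L[ℝ] ℝ), L (0, A) = L w - L S := by
    intro L; rw [h3, map_sub]
  exact h5 (mvfderiv endModel (endEntry s r) ⟨p, σ p⟩)

/-- The derivative of a scalar factor occurs in both terms and cancels. Hence the extension chosen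
in `covEnd` may be replaced by any field with the same value, in particular by a frame field. -/
lemma tensorialAt_cov {p : M}
    {σ : Π p : M, TangentSpace (𝓡 4) p →L[ℝ] TangentSpace (𝓡 4) p}
    (hσ : MDifferentiableAt (𝓡 4) endModel (fun q => (⟨q, σ q⟩ : EndBundle M)) p)
    (ξ : TangentSpace (𝓡 4) p) :
    TensorialAt (𝓡 4) E₄ (fun y : Π p : M, TangentSpace (𝓡 4) p =>
      leviCivita (fun q => σ q (y q)) p ξ - σ p (leviCivita y p ξ)) p := by
  have hσs : ∀ {y : Π p : M, TangentSpace (𝓡 4) p}, MDiffFieldAt y p →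
      MDiffFieldAt (fun q => σ q (y q)) p := fun hy => hσ.clm_bundle_apply hy
  constructor
  · intro f y hf hy
    have h1 := leviCivita.isCovariantDerivativeOnUniv.leibniz (hσs hy) hf
    have h2 := leviCivita.isCovariantDerivativeOnUniv.leibniz hy hf
    have h3 : (fun q => σ q ((f • y) q)) = f • fun q => σ q (y q) := by
      ext1 q; exact map_smul (σ q) (f q) (y q)
    change leviCivita (fun q => σ q ((f • y) q)) p ξ - σ p (leviCivita (f • y) p ξ) = _
    rw [h3]
    refine (congrArg₂ (fun L L' => L ξ - σ p (L' ξ)) h1 h2).trans ?_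
    simp only [add_apply, smul_apply, ContinuousLinearMap.smulRight_apply, map_add, map_smul,
      smul_sub]
    exact add_sub_add_right_eq_sub _ _ _
  · intro y y' hy hy'
    have h1 := leviCivita.isCovariantDerivativeOnUniv.add (hσs hy) (hσs hy')
    have h2 := leviCivita.isCovariantDerivativeOnUniv.add hy hy'
    have h3 : (fun q => σ q ((y + y') q)) = (fun q => σ q (y q)) + fun q => σ q (y' q) := by
      ext1 q; exact map_add (σ q) (y q) (y' q)
    change leviCivita (fun q => σ q ((y + y') q)) p ξ - σ p (leviCivita (y + y') p ξ) = _
    rw [h3]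
    refine (congrArg₂ (fun L L' => L ξ - σ p (L' ξ)) h1 h2).trans ?_
    simp only [add_apply, map_add]
    exact add_sub_add_comm _ _ _ _

lemma inner_covEnd {s r : Π p : M, TangentSpace (𝓡 4) p} {p : M}
    (hs : MDiffFieldAt s p) (hr : MDiffFieldAt r p)
    {σ : Π p : M, TangentSpace (𝓡 4) p →L[ℝ] TangentSpace (𝓡 4) p}
    (hσ : MDifferentiableAt (𝓡 4) endModel (fun q => (⟨q, σ q⟩ : EndBundle M)) p)
    (ξ : TangentSpace (𝓡 4) p) :
    inner ℝ (covEnd σ p ξ (s p)) (r p) =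
      mvfderiv (𝓡 4) (fun q => inner ℝ (σ q (s q)) (r q)) p ξ
      - inner ℝ (σ p (leviCivita s p ξ)) (r p) - inner ℝ (σ p (s p)) (leviCivita r p ξ) := by
  have hσs : ∀ {y : Π p : M, TangentSpace (𝓡 4) p}, MDiffFieldAt y p →
      MDiffFieldAt (fun q => σ q (y q)) p := fun hy => hσ.clm_bundle_apply hy
  have hξ : MDiffFieldAt (extend E₄ ξ : Π p : M, TangentSpace (𝓡 4) p) p :=
      mdifferentiableAt_extend ..
  have h1 : covEnd σ p ξ (s p) = leviCivita (fun q => σ q (s q)) p ξ - σ p (leviCivita s p ξ) :=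
    (tensorialAt_cov hσ ξ).pointwise (mdifferentiableAt_extend ..) hs (extend_apply_self _ _)
  have h2 := leviCivita_metric hξ (hσs hs) hr
  rw [extend_apply_self] at h2
  rw [h1, inner_sub_left, h2]
  ring

/-- The connector is determined by the derivatives of matrix entries. -/
lemma inner_connector {s r : Π p : M, TangentSpace (𝓡 4) p} (z : EndBundle M)
    (hs : MDiffFieldAt s z.proj) (hr : MDiffFieldAt r z.proj) (w : TangentSpace endModel z) :
    inner ℝ (connector z w (s z.proj)) (r z.proj) =
      mvfderiv endModel (endEntry s r) z w
      - inner ℝ (z.snd (leviCivita s z.proj (mfderiv endModel (𝓡 4) TotalSpace.proj z w))) (r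
          z.proj)
      - inner ℝ (z.snd (s z.proj)) (leviCivita r z.proj (mfderiv endModel (𝓡 4) TotalSpace.proj z
          w)) := by
  have hξ : mfderiv endModel (𝓡 4) TotalSpace.proj z w = Prod.fst (w : E₄ × (E₄ →L[ℝ] E₄)) := by
    rw [(hasMFDerivAt_endBundle_proj z).mfderiv]; rfl
  let σ : Π q : M, TangentSpace (𝓡 4) q →L[ℝ] TangentSpace (𝓡 4) q := extend (E₄ →L[ℝ] E₄) z.snd
  have hσz : σ z.proj = z.snd := extend_apply_self _ _
  have hσ : MDifferentiableAt (𝓡 4) endModel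
      (fun q => (⟨q, σ q⟩ : EndBundle M)) z.proj :=
    mdifferentiableAt_extend ..
  -- The section σ passes through `z` only up to a propositional equality.
  have h0 : ∀ y : EndBundle M, y = z →
      mvfderiv endModel (endEntry s r) y (w : E₄ × (E₄ →L[ℝ] E₄)) =
      mvfderiv endModel (endEntry s r) z w := by rintro _ rfl; rfl
  have h1 := mfderiv_endEntry_sub hs hr hσ w _ rfl
  have h2 := inner_covEnd hs hr hσ (Prod.fst (w : E₄ × (E₄ →L[ℝ] E₄)))
  rw [h0 _ (by rw [hσz])] at h1
  rw [hσz] at h2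
  simp only [connector, hξ]
  rw [inner_add_left, h2]
  refine (congrArg (· + _) h1).trans ?_
  ring

/-- The connector as an endomorphism of the tangent space. -/
noncomputable def connectorHom (z : EndBundle M) (w : TangentSpace endModel z) :
    TangentSpace (𝓡 4) z.proj →L[ℝ] TangentSpace (𝓡 4) z.proj :=
  let σ : Π q : M, TangentSpace (𝓡 4) q →L[ℝ] TangentSpace (𝓡 4) q := extend (E₄ →L[ℝ] E₄) z.snd
  have hσ : MDifferentiableAt (𝓡 4) endModel (fun q => (⟨q, σ q⟩ : EndBundle M)) z.proj :=
    mdifferentiableAt_extend ..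
  let ξ : TangentSpace (𝓡 4) z.proj := mfderiv endModel (𝓡 4) TotalSpace.proj z w
  let dσ : TangentSpace endModel (⟨z.proj, σ z.proj⟩ : EndBundle M) :=
    mfderiv (𝓡 4) endModel (fun q => (⟨q, σ q⟩ : EndBundle M)) z.proj ξ
  let A : TangentSpace (𝓡 4) z.proj →L[ℝ] TangentSpace (𝓡 4) z.proj := w.2 - dσ.2
  A + (tensorialAt_cov hσ ξ).mkHom

end Connector

/-! ### Smooth orthonormal frames -/

section GramSchmidt

open InnerProductSpace

/-- The change of basis is triangular, with diagonal entries the norms of the orthogonalised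
vectors, which are positive. -/
lemma orientation_gramSchmidtOrthonormalBasis {V : Type*} [NormedAddCommGroup V]
    [InnerProductSpace ℝ V] [FiniteDimensional ℝ V] {n : ℕ} (h : finrank ℝ V = Fintype.card (Fin n))
    (b : Basis (Fin n) ℝ V) :
    (gramSchmidtOrthonormalBasis h b).toBasis.orientation = b.orientation := by
  rw [Basis.orientation_eq_iff_det_pos, gramSchmidtOrthonormalBasis_det]
  refine Finset.prod_pos fun i _ => ?_
  have h0 : gramSchmidt ℝ b i ≠ 0 := gramSchmidt_ne_zero i b.linearIndependent
  have h1 : gramSchmidtNormed ℝ b i ≠ 0 := by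
    rw [gramSchmidtNormed]
    simpa using h0
  have h2 : inner ℝ (gramSchmidt ℝ b i) (b i) =
      inner ℝ (gramSchmidt ℝ b i) (gramSchmidt ℝ b i) := by
    conv_lhs => rw [gramSchmidt_def'' ℝ b i]
    rw [inner_add_right, inner_sum, Finset.sum_eq_zero, add_zero]
    intro j hj
    rw [inner_smul_right, gramSchmidt_orthogonal ℝ b (Finset.mem_Iio.mp hj).ne', mul_zero]
  rw [gramSchmidtOrthonormalBasis_apply _ h1, gramSchmidtNormed, inner_smul_left, h2]
  have h3 := real_inner_self_pos.mpr h0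
  have h4 := norm_pos_iff.mpr h0
  simp only [RCLike.ofReal_real_eq_id, id_eq, conj_trivial]
  positivity

lemma orientation_reindex_swap {V : Type*} [AddCommGroup V] [Module ℝ V]
    (b : Basis (Fin 4) ℝ V) : (b.reindex (Equiv.swap 0 1)).orientation = -b.orientation := by
  rw [← Basis.orientation_ne_iff_eq_neg, ne_comm, Ne, Basis.orientation_eq_iff_det_pos]
  have h : (b.reindex (Equiv.swap 0 1) : Fin 4 → V) = b ∘ Equiv.swap 0 1 := by
    ext i; simp
  rw [h, AlternatingMap.map_swap _ _ (by decide), b.det_self]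
  norm_num

local notation "E₄" => EuclideanSpace ℝ (Fin 4)

variable {M : Type*} [TopologicalSpace M] [ChartedSpace E₄ M]
  [IsManifold (𝓡 4) ∞ M] [RiemannianBundle (fun p : M => TangentSpace (𝓡 4) p)]
  [IsContMDiffRiemannianBundle (𝓡 4) ∞ E₄ (fun p : M => TangentSpace (𝓡 4) p)]

lemma smoothFieldAt_gramSchmidt {X : Fin 4 → Π p : M, TangentSpace (𝓡 4) p} {p : M}
    (hX : ∀ i, SmoothFieldAt (X i) p) (hb : LinearIndependent ℝ fun i => X i p) (i : Fin 4) :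
    SmoothFieldAt (fun q => gramSchmidt ℝ (fun j => X j q) i) p := by
  induction i using WellFoundedLT.induction with
  | ind i ih =>
    have h1 : ∀ j ∈ Finset.Iio i, SmoothFieldAt (fun q =>
        (inner ℝ (gramSchmidt ℝ (fun k => X k q) j) (X i q) /
          inner ℝ (gramSchmidt ℝ (fun k => X k q) j) (gramSchmidt ℝ (fun k => X k q) j)) •
          gramSchmidt ℝ (fun k => X k q) j) p := by
      intro j hj
      have hj := ih j (Finset.mem_Iio.mp hj)
      have h2 : ContMDiffAt (𝓡 4) 𝓘(ℝ, ℝ) ∞ (fun q : M =>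
        inner ℝ (gramSchmidt ℝ (fun k => X k q) j) (X i q)) p := hj.inner_bundle (hX i)
      have h3 : ContMDiffAt (𝓡 4) 𝓘(ℝ, ℝ) ∞ (fun q : M =>
        inner ℝ (gramSchmidt ℝ (fun k => X k q) j) (gramSchmidt ℝ (fun k => X k q) j)) p :=
        hj.inner_bundle hj
      exact (h2.div₀ h3 (real_inner_self_pos.mpr (gramSchmidt_ne_zero j hb)).ne').smul_section hj
    have h4 : SmoothFieldAt _ p := ContMDiffAt.sum_section h1
    have h5 := (hX i).sub_section h4
    refine h5.congr_of_eventuallyEq (Filter.Eventually.of_forall fun q => ?_)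
    refine congrArg (fun v => (⟨q, v⟩ : TangentBundle (𝓡 4) M)) ?_
    have h6 := gramSchmidt_def'' ℝ (fun k => X k q) i
    rw [← sub_eq_iff_eq_add] at h6
    simp only [RCLike.ofReal_real_eq_id, id_eq, ← real_inner_self_eq_norm_sq] at h6
    exact h6.symm

lemma smoothFieldAt_gramSchmidtNormed {X : Fin 4 → Π p : M, TangentSpace (𝓡 4) p} {p : M}
    (hX : ∀ i, SmoothFieldAt (X i) p) (hb : LinearIndependent ℝ fun i => X i p) (i : Fin 4) :
    SmoothFieldAt (fun q => gramSchmidtNormed ℝ (fun j => X j q) i) p := by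
  have h := smoothFieldAt_gramSchmidt hX hb i
  have h0 := gramSchmidt_ne_zero i hb
  have hn : ContMDiffAt (𝓡 4) 𝓘(ℝ, ℝ) ∞ (fun q => ‖gramSchmidt ℝ (fun j => X j q) i‖⁻¹) p := by
    have h1 : ContMDiffAt (𝓡 4) 𝓘(ℝ, ℝ) ∞ (fun q : M => inner ℝ (gramSchmidt ℝ (fun j => X j q) i)
      (gramSchmidt ℝ (fun j => X j q) i)) p := h.inner_bundle h
    have h2 : ContDiffAt ℝ ∞ (fun r : ℝ => (√r)⁻¹) (inner ℝ (gramSchmidt ℝ (fun j => X j p) i)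
      (gramSchmidt ℝ (fun j => X j p) i)) := by
      have h3 := real_inner_self_pos.mpr h0
      exact (Real.contDiffAt_sqrt h3.ne').inv (Real.sqrt_pos.mpr h3).ne'
    have h4 := h2.contMDiffAt.comp p h1
    refine h4.congr_of_eventuallyEq (Filter.Eventually.of_forall fun q => ?_)
    simp only [Function.comp_apply]
    rw [norm_eq_sqrt_real_inner]
  exact hn.smul_section h

/-- Every point has a neighbourhood with a smooth orthonormal frame which is negatively oriented. -/
lemma exists_orthonormal_frame (o : ManifoldOrientation M) (p : M) :
    ∃ e : Fin 4 → Π p : M, TangentSpace (𝓡 4) p, ∀ᶠ q in 𝓝 p, (∀ i, SmoothFieldAt (e i) q) ∧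
      ∃ b : OrthonormalBasis (Fin 4) ℝ (TangentSpace (𝓡 4) q),
        (∀ i, b i = e i q) ∧ b.toBasis.orientation = -o.orientation q := by
  obtain ⟨U, hU, X, hX, hb⟩ := o.exists_frame p
  -- The given frame is positive; exchanging its first two fields makes it negative, and
  -- Gram–Schmidt preserves the orientation.
  refine ⟨fun i q => gramSchmidtNormed ℝ (fun j => X (Equiv.swap 0 1 j) q) i, ?_⟩
  filter_upwards [eventually_mem_nhds_iff.mpr hU] with q hq
  obtain ⟨c, hc, hco⟩ := hb q (mem_of_mem_nhds hq)
  set b := c.reindex (Equiv.swap 0 1) with hbdef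
  have hbX : (b : Fin 4 → TangentSpace (𝓡 4) q) = fun j => X (Equiv.swap 0 1 j) q := by
    ext1 j; simp [hbdef, hc]
  have hli : LinearIndependent ℝ fun j => X (Equiv.swap 0 1 j) q := hbX ▸ b.linearIndependent
  have hdim : finrank ℝ (TangentSpace (𝓡 4) q) = Fintype.card (Fin 4) := by
    rw [finrank_eq_card_basis b]
  refine ⟨fun i => smoothFieldAt_gramSchmidtNormed (fun j => (hX _).contMDiffAt hq) hli i,
    gramSchmidtOrthonormalBasis hdim b, fun i => ?_, ?_⟩
  · rw [gramSchmidtOrthonormalBasis_apply, hbX]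
    rw [gramSchmidtNormed]
    simpa using gramSchmidt_ne_zero i b.linearIndependent
  · rw [orientation_gramSchmidtOrthonormalBasis, hbdef, orientation_reindex_swap, hco]

end GramSchmidt

/-! ### Orthonormal frames in local coordinates -/

section FrameInCoordinates

local notation "E₄" => EuclideanSpace ℝ (Fin 4)

variable {M : Type*} [TopologicalSpace M] [ChartedSpace E₄ M]
  [IsManifold (𝓡 4) ∞ M] [RiemannianBundle (fun p : M => TangentSpace (𝓡 4) p)]
  [IsContMDiffRiemannianBundle (𝓡 4) ∞ E₄ (fun p : M => TangentSpace (𝓡 4) p)]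

/-- The vector fields `e i` are smooth at `q` and form an orthonormal basis there. -/
def IsOrthonormalFrameAt (e : Fin 4 → Π p : M, TangentSpace (𝓡 4) p) (q : M) : Prop :=
  (∀ i, SmoothFieldAt (e i) q) ∧
    ∃ b : OrthonormalBasis (Fin 4) ℝ (TangentSpace (𝓡 4) q), ∀ i, b i = e i q

variable {e : Fin 4 → Π p : M, TangentSpace (𝓡 4) p}

lemma IsOrthonormalFrameAt.inner_eq {q : M} (h : IsOrthonormalFrameAt e q) (i j : Fin 4) :
    inner ℝ (e i q) (e j q) = if i = j then (1 : ℝ) else 0 := by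
  obtain ⟨-, b, hb⟩ := h
  rw [← hb, ← hb]
  exact orthonormal_iff_ite.mp b.orthonormal i j

lemma IsOrthonormalFrameAt.sum_inner_smul {q : M} (h : IsOrthonormalFrameAt e q)
    (v : TangentSpace (𝓡 4) q) : ∑ i, (inner ℝ v (e i q) : ℝ) • e i q = v := by
  obtain ⟨-, b, hb⟩ := h
  simp only [← hb]
  simpa only [real_inner_comm] using b.sum_repr' v

lemma IsOrthonormalFrameAt.sum_inner_mul_inner {q : M} (h : IsOrthonormalFrameAt e q)
    (v w : TangentSpace (𝓡 4) q) :
    ∑ i, (inner ℝ v (e i q) : ℝ) * inner ℝ w (e i q) = inner ℝ v w := by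
  obtain ⟨-, b, hb⟩ := h
  simp only [← hb]
  rw [← b.sum_inner_mul_inner]
  simp only [real_inner_comm]

lemma mvfderiv_inner_eq_zero {q : M} (h : ∀ᶠ q' in 𝓝 q, IsOrthonormalFrameAt e q') (i j : Fin 4) :
    mvfderiv (𝓡 4) (fun q => inner ℝ (e i q) (e j q)) q = 0 := by
  have h1 : (fun q => inner ℝ (e i q) (e j q)) =ᶠ[𝓝 q] fun _ => if i = j then (1 : ℝ) else 0 :=
    h.mono fun q' hq' => hq'.inner_eq i j
  ext v
  have h2 := h1.mfderiv_eq (I := 𝓡 4) (I' := 𝓘(ℝ, ℝ))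
  have h3 := congrArg (fun L : E₄ →L[ℝ] ℝ => L v) h2
  refine h3.trans ?_
  rw [mfderiv_const]
  rfl

/-- The Koszul formula for an orthonormal frame. -/
lemma inner_leviCivita_frame {q : M} (h : ∀ᶠ q' in 𝓝 q, IsOrthonormalFrameAt e q')
    (a b c : Fin 4) :
    inner ℝ (leviCivita (e b) q (e a q)) (e c q) = 1 / 2 *
      (inner ℝ (mlieBracket (𝓡 4) (e a) (e b) q) (e c q)
      - inner ℝ (mlieBracket (𝓡 4) (e a) (e c) q) (e b q)
      - inner ℝ (mlieBracket (𝓡 4) (e b) (e c) q) (e a q) : ℝ) := by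
  have hs := fun i => (h.self_of_nhds.1 i).mdiffFieldAt
  refine (inner_leviCivitaFun (hs a) (hs b) (hs c)).trans ?_
  rw [koszul, mvfderiv_inner_eq_zero h, mvfderiv_inner_eq_zero h, mvfderiv_inner_eq_zero h]
  simp

variable {χ : E₄ → M} {ξ : E₄}

/-- The coordinate expression of a frame. -/
noncomputable def coordFrame (χ : E₄ → M) (e : Fin 4 → Π p : M, TangentSpace (𝓡 4) p) (a : Fin 4)
    (ξ : E₄) : E₄ :=
  mpullback 𝓘(ℝ, E₄) (𝓡 4) χ (e a) ξ

lemma mfderiv_coordFrame (hi : (mfderiv 𝓘(ℝ, E₄) (𝓡 4) χ ξ).IsInvertible) (a : Fin 4) :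
    mfderiv 𝓘(ℝ, E₄) (𝓡 4) χ ξ (coordFrame χ e a ξ) = e a (χ ξ) := by
  have := hi.self_comp_inverse
  exact congrArg (fun L : TangentSpace (𝓡 4) (χ ξ) →L[ℝ] TangentSpace (𝓡 4) (χ ξ) => L (e a (χ ξ)))
    this

lemma contDiffAt_coordFrame (he : IsOrthonormalFrameAt e (χ ξ))
    (hχ : ContMDiffAt 𝓘(ℝ, E₄) (𝓡 4) ∞ χ ξ) (hi : (mfderiv 𝓘(ℝ, E₄) (𝓡 4) χ ξ).IsInvertible)
    (a : Fin 4) : ContDiffAt ℝ ∞ (coordFrame χ e a) ξ :=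
  contMDiffAt_vectorSpace_iff_contDiffAt.mp
    (ContMDiffAt.mpullback_vectorField_preimage (he.1 a) hχ hi (by simp))

lemma mfderiv_frameMap (hi : (mfderiv 𝓘(ℝ, E₄) (𝓡 4) χ ξ).IsInvertible) (h : E₄) :
    mfderiv 𝓘(ℝ, E₄) (𝓡 4) χ ξ (frameMap (coordFrame χ e) ξ h) = ∑ a, h a • e a (χ ξ) := by
  rw [frameMap_apply]
  simp only [← mfderiv_coordFrame hi]
  refine (map_sum (mfderiv 𝓘(ℝ, E₄) (𝓡 4) χ ξ) _ _).trans ?_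
  exact Finset.sum_congr rfl fun a _ => map_smul _ _ _

lemma isInvertible_frameMap (he : IsOrthonormalFrameAt e (χ ξ))
    (hi : (mfderiv 𝓘(ℝ, E₄) (𝓡 4) χ ξ).IsInvertible) :
    (frameMap (coordFrame χ e) ξ).IsInvertible := by
  have hinj : Function.Injective (frameMap (coordFrame χ e) ξ : E₄ →ₗ[ℝ] E₄) := by
    rw [← LinearMap.ker_eq_bot, LinearMap.ker_eq_bot']
    intro h hh
    have h1 := mfderiv_frameMap (e := e) hi h
    rw [show frameMap (coordFrame χ e) ξ h = 0 from hh] at h1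
    have h2 : ∑ a, h a • e a (χ ξ) = 0 := h1.symm.trans (map_zero _)
    ext c
    have h3 := congrArg (fun v => inner ℝ v (e c (χ ξ))) h2
    simpa [sum_inner, inner_smul_left, he.inner_eq] using h3
  exact ⟨(LinearEquiv.ofInjectiveEndo _ hinj).toContinuousLinearEquiv, by ext; rfl⟩

lemma coframe_coordFrame (he : IsOrthonormalFrameAt e (χ ξ))
    (hi : (mfderiv 𝓘(ℝ, E₄) (𝓡 4) χ ξ).IsInvertible) (u : E₄) (c : Fin 4) :
    coframe (coordFrame χ e) ξ u c =
      inner ℝ (mfderiv 𝓘(ℝ, E₄) (𝓡 4) χ ξ u : TangentSpace (𝓡 4) (χ ξ)) (e c (χ ξ)) := by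
  have h := mfderiv_frameMap (e := e) hi (coframe (coordFrame χ e) ξ u)
  rw [frameMap_coframe (isInvertible_frameMap he hi)] at h
  rw [h, sum_inner]
  simp [inner_smul_left, he.inner_eq]

/-- Lie brackets are natural under pullback, so the coordinate connection coefficients agree with
the Koszul expression on the manifold. -/
lemma structureFun_coordFrame (he : IsOrthonormalFrameAt e (χ ξ))
    (hχ : ContMDiffAt 𝓘(ℝ, E₄) (𝓡 4) ∞ χ ξ) (hi : (mfderiv 𝓘(ℝ, E₄) (𝓡 4) χ ξ).IsInvertible)
    (a b c : Fin 4) :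
    structureFun (coordFrame χ e) ξ a b c =
      inner ℝ (mlieBracket (𝓡 4) (e a) (e b) (χ ξ)) (e c (χ ξ)) := by
  have h1 : mpullback 𝓘(ℝ, E₄) (𝓡 4) χ (mlieBracket (𝓡 4) (e a) (e b)) ξ =
      lieBracket ℝ (coordFrame χ e a) (coordFrame χ e b) ξ := by
    have : IsManifold (𝓡 4) (minSmoothness ℝ 2) M := by
      rw [minSmoothness_of_isRCLikeNormedField]; infer_instance
    rw [mpullback_mlieBracket (he.1 a).mdiffFieldAt (he.1 b).mdiffFieldAt hχ
      (by rw [minSmoothness_of_isRCLikeNormedField]; exact ENat.LEInfty.out),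
      ← mlieBracketWithin_univ, mlieBracketWithin_eq_lieBracketWithin]
    exact congrFun lieBracketWithin_univ ξ
  rw [structureFun, coframe_coordFrame he hi, ← h1]
  congr 1
  exact congrArg (fun L : TangentSpace (𝓡 4) (χ ξ) →L[ℝ] TangentSpace (𝓡 4) (χ ξ) =>
    L (mlieBracket (𝓡 4) (e a) (e b) (χ ξ))) hi.self_comp_inverse

/-- The connection form of a frame in coordinates is given by the Levi-Civita connection. -/
lemma entry_connForm_coordFrame (he : ∀ᶠ q in 𝓝 (χ ξ), IsOrthonormalFrameAt e q)
    (hχ : ContMDiffAt 𝓘(ℝ, E₄) (𝓡 4) ∞ χ ξ) (hi : (mfderiv 𝓘(ℝ, E₄) (𝓡 4) χ ξ).IsInvertible)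
    (u : E₄) (b c : Fin 4) :
    entry (connForm (coordFrame χ e) ξ u) b c =
      inner ℝ (leviCivita (e b) (χ ξ) (mfderiv 𝓘(ℝ, E₄) (𝓡 4) χ ξ u)) (e c (χ ξ)) := by
  have he' := he.self_of_nhds
  have h : mfderiv 𝓘(ℝ, E₄) (𝓡 4) χ ξ u = ∑ a, coframe (coordFrame χ e) ξ u a • e a (χ ξ) := by
    simp only [coframe_coordFrame he' hi]
    exact (he'.sum_inner_smul _).symm
  rw [entry_connForm, h, map_sum, sum_inner]
  refine Finset.sum_congr rfl fun a _ => ?_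
  rw [map_smul, inner_smul_left, inner_leviCivita_frame he, connCoeff,
    structureFun_coordFrame he' hχ hi, structureFun_coordFrame he' hχ hi,
    structureFun_coordFrame he' hχ hi]
  simp

end FrameInCoordinates

/-! ### Compatible complex structures of a Euclidean four-space -/

section TwistorAlgebra

variable {V : Type*} [NormedAddCommGroup V] [InnerProductSpace ℝ V]

lemma det_fin_four (Q : Fin 4 → Fin 4 → ℝ) : Matrix.det (Matrix.of Q) =
    (Q 0 0 * Q 1 1 - Q 0 1 * Q 1 0) * (Q 2 2 * Q 3 3 - Q 2 3 * Q 3 2)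
    - (Q 0 0 * Q 1 2 - Q 0 2 * Q 1 0) * (Q 2 1 * Q 3 3 - Q 2 3 * Q 3 1)
    + (Q 0 0 * Q 1 3 - Q 0 3 * Q 1 0) * (Q 2 1 * Q 3 2 - Q 2 2 * Q 3 1)
    + (Q 0 1 * Q 1 2 - Q 0 2 * Q 1 1) * (Q 2 0 * Q 3 3 - Q 2 3 * Q 3 0)
    - (Q 0 1 * Q 1 3 - Q 0 3 * Q 1 1) * (Q 2 0 * Q 3 2 - Q 2 2 * Q 3 0)
    + (Q 0 2 * Q 1 3 - Q 0 3 * Q 1 2) * (Q 2 0 * Q 3 1 - Q 2 1 * Q 3 0) := by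
  rw [Matrix.det_succ_row_zero]
  simp only [Fin.sum_univ_four, Matrix.det_fin_three]
  simp [show (1 : Fin 4).succAbove (2 : Fin 3) = 3 from rfl,
    show (2 : Fin 4).succAbove (2 : Fin 3) = 3 from rfl,
    show (3 : Fin 4).succAbove (2 : Fin 3) = 2 from rfl,
    show (1 : Fin 4).succAbove (1 : Fin 3) = 2 from rfl,
    show (2 : Fin 4).succAbove (1 : Fin 3) = 1 from rfl,
    show (3 : Fin 4).succAbove (1 : Fin 3) = 1 from rfl]
  ring

/-- The first row of the matrix of an endomorphism, without its diagonal entry. -/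
noncomputable def firstRow (e : Fin 4 → V) (J : V →ₗ[ℝ] V) : EuclideanSpace ℝ (Fin 3) :=
  WithLp.toLp 2 fun k => inner ℝ (J (e 0)) (e k.succ)

/-- The rows give total 2 for the squares of the six entries above the diagonal; subtracting twice
the Pfaffian leaves a vanishing sum of three squares. -/
lemma self_dual_of_pfaffian_eq_one {j : Fin 4 → Fin 4 → ℝ} (hjs : ∀ a b, j a b = -j b a)
    (hrow : ∀ a, ∑ b, j a b * j a b = 1)
    (hpf : j 0 1 * j 2 3 - j 0 2 * j 1 3 + j 0 3 * j 1 2 = 1) :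
    j 2 3 = j 0 1 ∧ j 1 3 = -j 0 2 ∧ j 1 2 = j 0 3 := by
  have hjd : ∀ a, j a a = 0 := fun a => by linarith [hjs a a]
  have hr := fun a => (Fin.sum_univ_four _).symm.trans (hrow a)
  have hr0 := hr 0
  have hr1 := hr 1
  have hr2 := hr 2
  have hr3 := hr 3
  rw [hjd] at hr0 hr1 hr2 hr3
  rw [hjs 1 0] at hr1
  rw [hjs 2 0, hjs 2 1] at hr2
  rw [hjs 3 0, hjs 3 1, hjs 3 2] at hr3
  have hz : (j 0 1 - j 2 3) ^ 2 + (j 0 2 + j 1 3) ^ 2 + (j 0 3 - j 1 2) ^ 2 = 0 := by linarith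
  have h1 := sq_nonneg (j 0 1 - j 2 3)
  have h2 := sq_nonneg (j 0 2 + j 1 3)
  have h3 := sq_nonneg (j 0 3 - j 1 2)
  have e1 : j 0 1 - j 2 3 = 0 := pow_eq_zero_iff two_ne_zero |>.mp (by linarith)
  have e2 : j 0 2 + j 1 3 = 0 := pow_eq_zero_iff two_ne_zero |>.mp (by linarith)
  have e3 : j 0 3 - j 1 2 = 0 := pow_eq_zero_iff two_ne_zero |>.mp (by linarith)
  exact ⟨by linarith, by linarith, by linarith⟩

lemma asdMatrix_of_pfaffian_eq_one {j : Fin 4 → Fin 4 → ℝ} (hjs : ∀ a b, j a b = -j b a)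
    (hrow : ∀ a, ∑ b, j a b * j a b = 1)
    (hpf : j 0 1 * j 2 3 - j 0 2 * j 1 3 + j 0 3 * j 1 2 = 1) (a b : Fin 4) :
    j a b = asdMatrix !₂[j 0 1, j 0 2, j 0 3] a b := by
  obtain ⟨h1, h2, h3⟩ := self_dual_of_pfaffian_eq_one hjs hrow hpf
  have hjd : ∀ a, j a a = 0 := fun a => by linarith [hjs a a]
  have h10 := hjs 1 0
  have h20 := hjs 2 0
  have h30 := hjs 3 0
  have h21 := hjs 2 1
  have h31 := hjs 3 1
  have h32 := hjs 3 2
  fin_cases a <;> fin_cases b <;> simp [asdMatrix, hjd] <;> linarith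

/-- The matrix of a compatible complex structure that preserves the orientation. -/
lemma inner_eq_asdMatrix (e f : OrthonormalBasis (Fin 4) ℝ V)
    (hef : e.toBasis.orientation = f.toBasis.orientation) (J : V →ₗ[ℝ] V)
    (hJ : ∀ v, J (J v) = -v) (hJi : ∀ v w, inner ℝ (J v) (J w) = (inner ℝ v w : ℝ))
    (h01 : J (f 0) = f 1) (h23 : J (f 2) = f 3) :
    (∀ a b, inner ℝ (J (e a)) (e b) = asdMatrix (firstRow e J) a b) ∧
      inner ℝ (firstRow e J) (firstRow e J) = (1 : ℝ) := by
  have hskew : ∀ v w, inner ℝ (J v) w = -(inner ℝ (J w) v : ℝ) := by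
    intro v w
    rw [← hJi (J v) w, hJ, inner_neg_left, real_inner_comm]
  set j : Fin 4 → Fin 4 → ℝ := fun a b => inner ℝ (J (e a)) (e b) with hj
  have hjs : ∀ a b, j a b = - j b a := fun a b => hskew _ _
  have hrow : ∀ a, ∑ b, j a b * j a b = 1 := by
    intro a
    have h : ∑ b, j a b * j a b = inner ℝ (J (e a)) (J (e a)) := by
      rw [← e.sum_inner_mul_inner]
      exact Finset.sum_congr rfl fun b _ => by rw [real_inner_comm (J (e a)) (e b)]
    rw [h, hJi, real_inner_self_eq_norm_sq, e.orthonormal.1 a, one_pow]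
  set Q : Fin 4 → Fin 4 → ℝ := fun i a => inner ℝ (f i) (e a) with hQ
  have hdet : Matrix.det (Matrix.of Q) = 1 := by
    have h := f.det_to_matrix_orthonormalBasis_of_same_orientation e hef.symm
    rw [Basis.det_apply] at h
    rw [← h]
    congr 1
    ext i a
    simp [Q, Basis.toMatrix_apply, f.repr_apply_apply]
  have h10 : J (f 1) = - f 0 := by rw [← h01, hJ]
  have h32 : J (f 3) = - f 2 := by rw [← h23, hJ]
  have hjQ : ∀ a b, j a b = Q 0 a * Q 1 b - Q 1 a * Q 0 b + Q 2 a * Q 3 b - Q 3 a * Q 2 b := by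
    intro a b
    have h1 : e a = ∑ i, Q i a • f i := (f.sum_repr' (e a)).symm
    simp only [j]
    conv_lhs => rw [h1]
    rw [Fin.sum_univ_four]
    simp only [map_add, map_smul, h01, h10, h23, h32, inner_add_left, inner_smul_left,
      inner_neg_left, conj_trivial]
    simp only [hQ]
    ring
  -- In the adapted basis the Pfaffian is 1, and a change of basis multiplies it by the determinant.
  -- Here this is the Laplace expansion by the first two rows.
  have hpf : j 0 1 * j 2 3 - j 0 2 * j 1 3 + j 0 3 * j 1 2 = 1 := by
    rw [← hdet, det_fin_four]
    simp only [hjQ]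
    ring
  constructor
  · intro a b
    have hy : firstRow e J = !₂[j 0 1, j 0 2, j 0 3] := by ext k; fin_cases k <;> rfl
    rw [hy]
    exact asdMatrix_of_pfaffian_eq_one hjs hrow hpf a b
  · have h := (Fin.sum_univ_four _).symm.trans (hrow 0)
    rw [show j 0 0 = 0 by linarith [hjs 0 0]] at h
    rw [PiLp.inner_apply, Fin.sum_univ_three]
    change j 0 1 * j 0 1 + j 0 2 * j 0 2 + j 0 3 * j 0 3 = 1
    linarith

lemma sum_asdMatrix_mul_asdMatrix (y : EuclideanSpace ℝ (Fin 3)) (a a' : Fin 4) :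
    ∑ b, asdMatrix y a b * asdMatrix y a' b = if a = a' then inner ℝ y y else 0 := by
  rw [PiLp.inner_apply, Fin.sum_univ_four, Fin.sum_univ_three]
  fin_cases a <;> fin_cases a' <;> simp [asdMatrix] <;> ring

/-- The endomorphism with matrix `asdMatrix y` in an orthonormal basis. -/
noncomputable def asdEnd (e : OrthonormalBasis (Fin 4) ℝ V) (y : EuclideanSpace ℝ (Fin 3)) :
    V →ₗ[ℝ] V :=
  e.toBasis.constr ℝ fun a => ∑ b, asdMatrix y a b • e b

lemma asdEnd_apply (e : OrthonormalBasis (Fin 4) ℝ V) (y : EuclideanSpace ℝ (Fin 3)) (a : Fin 4) :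
    asdEnd e y (e a) = ∑ b, asdMatrix y a b • e b := by
  have := e.toBasis.constr_basis ℝ (fun a => ∑ b, asdMatrix y a b • e b) a
  rwa [e.coe_toBasis] at this

lemma inner_asdEnd_asdEnd (e : OrthonormalBasis (Fin 4) ℝ V) {y : EuclideanSpace ℝ (Fin 3)}
    (hy : inner ℝ y y = (1 : ℝ)) (v w : V) :
    inner ℝ (asdEnd e y v) (asdEnd e y w) = (inner ℝ v w : ℝ) := by
  have h : Orthonormal ℝ (asdEnd e y ∘ e.toBasis) := by
    rw [orthonormal_iff_ite]
    intro a a'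
    simp only [Function.comp_apply, e.coe_toBasis, asdEnd_apply]
    rw [← hy, ← sum_asdMatrix_mul_asdMatrix, sum_inner]
    refine Finset.sum_congr rfl fun b _ => ?_
    rw [inner_smul_left, inner_sum]
    simp [inner_smul_right, orthonormal_iff_ite.mp e.orthonormal]
  exact ((asdEnd e y).isometryOfOrthonormal (v := e.toBasis) (by simp [e.orthonormal])
    h).inner_map_map v w

lemma asdEnd_asdEnd (e : OrthonormalBasis (Fin 4) ℝ V) {y : EuclideanSpace ℝ (Fin 3)}
    (hy : inner ℝ y y = (1 : ℝ)) (v : V) : asdEnd e y (asdEnd e y v) = -v := by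
  rw [PiLp.inner_apply, Fin.sum_univ_three] at hy
  simp only [RCLike.inner_apply, conj_trivial] at hy
  have h : asdEnd e y ∘ₗ asdEnd e y = -LinearMap.id := by
    refine e.toBasis.ext fun a => ?_
    simp only [e.coe_toBasis, LinearMap.comp_apply, asdEnd_apply, map_sum, map_smul,
      LinearMap.neg_apply, LinearMap.id_apply]
    have h1 : ∀ c, ∑ b, asdMatrix y a b * asdMatrix y b c = if a = c then -1 else 0 := by
      intro c
      rw [Fin.sum_univ_four]
      fin_cases a <;> fin_cases c <;> simp [asdMatrix] <;> linarith
    simp only [Finset.smul_sum, smul_smul]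
    rw [Finset.sum_comm]
    simp only [← Finset.sum_smul, h1]
    simp
  exact congrArg (fun L : V →ₗ[ℝ] V => L v) h

/-- Every point of the sphere is given by a compatible complex structure. -/
lemma exists_adapted_basis (e : OrthonormalBasis (Fin 4) ℝ V)
    (f : OrthonormalBasis (Fin 3) ℝ (EuclideanSpace ℝ (Fin 3))) :
    ∃ e' : OrthonormalBasis (Fin 4) ℝ V, e'.toBasis.orientation = e.toBasis.orientation ∧
      asdEnd e (f 2) (e' 0) = e' 1 ∧ asdEnd e (f 2) (e' 2) = e' 3 := by
  have hf := orthonormal_iff_ite.mp f.orthonormal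
  set y := f 2
  set u := f 0
  have hyy : inner ℝ y y = (1 : ℝ) := (hf 2 2).trans (if_pos rfl)
  have huu : inner ℝ u u = (1 : ℝ) := (hf 0 0).trans (if_pos rfl)
  have hyu : inner ℝ y u = (0 : ℝ) := (hf 2 0).trans (if_neg (by decide))
  -- The basis is e₀, Je₀, u, Ju, with `u` read in the span of the last three vectors of `e`. There
  -- Je₀ has coordinates y and Ju has coordinates y × u.
  set m : Fin 4 → V := ![e 0, asdEnd e y (e 0), ∑ k, u k • e k.succ,
    asdEnd e y (∑ k, u k • e k.succ)] with hm
  rw [PiLp.inner_apply, Fin.sum_univ_three] at hyy huu hyu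
  simp only [RCLike.inner_apply, conj_trivial] at hyy huu hyu
  set c : Fin 4 → Fin 4 → ℝ := ![![1, 0, 0, 0], ![0, y 0, y 1, y 2], ![0, u 0, u 1, u 2],
    ![0, y 1 * u 2 - y 2 * u 1, y 2 * u 0 - y 0 * u 2, y 0 * u 1 - y 1 * u 0]] with hc
  have hmc : ∀ i, m i = ∑ a, c i a • e a := by
    intro i
    fin_cases i
    · simp [hm, hc, Fin.sum_univ_four]
    · simp [hm, hc, Fin.sum_univ_four, asdEnd_apply, asdMatrix]
    · simp [hm, hc, Fin.sum_univ_four, Fin.sum_univ_three]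
    · simp only [hm, hc, Fin.sum_univ_four, Fin.sum_univ_three, map_add, map_smul, asdEnd_apply]
      simp [asdMatrix]
      have h0 : u 0 * y 0 + u 1 * y 1 + u 2 * y 2 = 0 := by linarith
      match_scalars <;> linarith
  have hcc : ∀ i j, inner ℝ (m i) (m j) = ∑ a, c i a * c j a := by
    intro i j
    rw [hmc, hmc, sum_inner]
    refine Finset.sum_congr rfl fun b _ => ?_
    rw [inner_smul_left, inner_sum]
    simp [inner_smul_right, orthonormal_iff_ite.mp e.orthonormal]
  have hmo : Orthonormal ℝ m := by
    rw [orthonormal_iff_ite]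
    intro i j
    rw [hcc, Fin.sum_univ_four]
    fin_cases i <;> fin_cases j <;> simp [hc] <;> first
      | linarith
      | ring1
      | linear_combination (u 0 * u 0 + u 1 * u 1 + u 2 * u 2) * hyy + huu -
          (y 0 * u 0 + y 1 * u 1 + y 2 * u 2) * hyu
  have := Module.Finite.of_basis e.toBasis
  have hcard : Fintype.card (Fin 4) = finrank ℝ V := (finrank_eq_card_basis e.toBasis).symm
  have hspan : ⊤ ≤ Submodule.span ℝ (Set.range m) :=
    (hmo.linearIndependent.span_eq_top_of_card_eq_finrank' hcard).ge
  refine ⟨OrthonormalBasis.mk hmo hspan, ?_, ?_, ?_⟩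
  · rw [eq_comm, Basis.orientation_eq_iff_det_pos, Basis.det_apply]
    have h : e.toBasis.toMatrix (OrthonormalBasis.mk hmo hspan).toBasis =
        (Matrix.of c).transpose := by
      ext a i
      rw [Basis.toMatrix_apply, Matrix.transpose_apply, Matrix.of_apply]
      simp only [OrthonormalBasis.coe_toBasis, OrthonormalBasis.coe_mk,
        OrthonormalBasis.coe_toBasis_repr_apply]
      rw [e.repr_apply_apply, hmc, inner_sum]
      simp [inner_smul_right, orthonormal_iff_ite.mp e.orthonormal]
    -- The determinant is det(y, u, y × u) = |y × u|², which is positive.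
    rw [h, Matrix.det_transpose, det_fin_four]
    simp [hc]
    nlinarith
  · simp [hm]
  · simp [hm]

end TwistorAlgebra

/-! ### The metric of the twistor space in a frame -/

section TwistorMetric

local notation "E₄" => EuclideanSpace ℝ (Fin 4)

/-- The trace does not depend on the basis, which permits replacing the standard basis in the
definition of the twistor metric by the frame. -/
lemma sum_inner_map_eq_trace {V : Type*} [NormedAddCommGroup V] [InnerProductSpace ℝ V]
    [FiniteDimensional ℝ V] {ι : Type*} [Fintype ι] (b : OrthonormalBasis ι ℝ V)
    (K L : V →ₗ[ℝ] V) :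
    ∑ i, inner ℝ (K (b i)) (L (b i)) = LinearMap.trace ℝ V (LinearMap.adjoint K ∘ₗ L) := by
  classical
  rw [LinearMap.trace_eq_sum_inner _ b]
  refine Finset.sum_congr rfl fun i _ => ?_
  rw [LinearMap.comp_apply, LinearMap.adjoint_inner_right]

lemma asdMatrix_add (y η : EuclideanSpace ℝ (Fin 3)) (a b : Fin 4) :
    asdMatrix (y + η) a b = asdMatrix y a b + asdMatrix η a b := by
  fin_cases a <;> fin_cases b <;> simp [asdMatrix, add_comm]

lemma asdMatrix_smul (r : ℝ) (y : EuclideanSpace ℝ (Fin 3)) (a b : Fin 4) :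
    asdMatrix (r • y) a b = r * asdMatrix y a b := by
  fin_cases a <;> fin_cases b <;> simp [asdMatrix]

lemma hasFDerivAt_asdMatrix {W : Type*} [NormedAddCommGroup W] [NormedSpace ℝ W]
    {Y : W → EuclideanSpace ℝ (Fin 3)} {x : W} (hY : DifferentiableAt ℝ Y x) (a b : Fin 4) (v : W) :
    ∃ L : W →L[ℝ] ℝ, HasFDerivAt (fun x => asdMatrix (Y x) a b) L x ∧
      L v = asdMatrix (fderiv ℝ Y x v) a b := by
  let A : EuclideanSpace ℝ (Fin 3) →L[ℝ] ℝ := LinearMap.toContinuousLinearMap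
    { toFun := fun y => asdMatrix y a b
      map_add' := fun y η => asdMatrix_add y η a b
      map_smul' := fun r y => asdMatrix_smul r y a b }
  exact ⟨A ∘L fderiv ℝ Y x, A.hasFDerivAt.comp x hY.hasFDerivAt, rfl⟩

variable {M : Type*} [TopologicalSpace M] [ChartedSpace E₄ M]
  [IsManifold (𝓡 4) ∞ M] [RiemannianBundle (fun p : M => TangentSpace (𝓡 4) p)]
  [IsContMDiffRiemannianBundle (𝓡 4) ∞ E₄ (fun p : M => TangentSpace (𝓡 4) p)]
  {e : Fin 4 → Π p : M, TangentSpace (𝓡 4) p}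

lemma twistorMetric_eq (t : ℝ) {z : EndBundle M} (he : IsOrthonormalFrameAt e z.proj)
    (v w : TangentSpace endModel z) :
    twistorMetric t z v w =
      inner ℝ (mfderiv endModel (𝓡 4) TotalSpace.proj z v : TangentSpace (𝓡 4) z.proj)
        (mfderiv endModel (𝓡 4) TotalSpace.proj z w : TangentSpace (𝓡 4) z.proj) +
      t ^ 2 / 4 * ∑ a, ∑ b, inner ℝ (connector z v (e a z.proj)) (e b z.proj) *
        inner ℝ (connector z w (e a z.proj)) (e b z.proj) := by
  obtain ⟨b, hb⟩ := he.2
  rw [twistorMetric]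
  congr 2
  have h := fun {n : ℕ} (b : OrthonormalBasis (Fin n) ℝ (TangentSpace (𝓡 4) z.proj)) =>
    sum_inner_map_eq_trace b
      (connectorHom z v : TangentSpace (𝓡 4) z.proj →ₗ[ℝ] TangentSpace (𝓡 4) z.proj)
      (connectorHom z w : TangentSpace (𝓡 4) z.proj →ₗ[ℝ] TangentSpace (𝓡 4) z.proj)
  refine ((h (stdOrthonormalBasis ℝ (TangentSpace (𝓡 4) z.proj))).trans (h b).symm).trans
      (Finset.sum_congr rfl fun a _ => ?_)
  rw [he.sum_inner_mul_inner, hb]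
  rfl

variable {χ : E₄ → M} {ξ : E₄} {q : M}

/-- The base point of Φ(x) and its image under the chart are equal but not definitionally so; this
form moves tangent vectors across the equality. -/
lemma coframe_coordFrame_of_eq (hq : χ ξ = q) (he : IsOrthonormalFrameAt e q)
    (hi : (mfderiv 𝓘(ℝ, E₄) (𝓡 4) χ ξ).IsInvertible) {u : E₄} {w : TangentSpace (𝓡 4) q}
    (hw : (mfderiv 𝓘(ℝ, E₄) (𝓡 4) χ ξ u : E₄) = w) (c : Fin 4) :
    coframe (coordFrame χ e) ξ u c = inner ℝ w (e c q) := by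
  subst hq
  have hw' : (mfderiv 𝓘(ℝ, E₄) (𝓡 4) χ ξ u : TangentSpace (𝓡 4) (χ ξ)) = w := hw
  rw [coframe_coordFrame he hi, hw']

lemma entry_connForm_coordFrame_of_eq (hq : χ ξ = q)
    (he : ∀ᶠ q in 𝓝 q, IsOrthonormalFrameAt e q) (hχ : ContMDiffAt 𝓘(ℝ, E₄) (𝓡 4) ∞ χ ξ)
    (hi : (mfderiv 𝓘(ℝ, E₄) (𝓡 4) χ ξ).IsInvertible) {u : E₄} {w : TangentSpace (𝓡 4) q}
    (hw : (mfderiv 𝓘(ℝ, E₄) (𝓡 4) χ ξ u : E₄) = w) (b c : Fin 4) :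
    entry (connForm (coordFrame χ e) ξ u) b c = inner ℝ (leviCivita (e b) q w) (e c q) := by
  subst hq
  have hw' : (mfderiv 𝓘(ℝ, E₄) (𝓡 4) χ ξ u : TangentSpace (𝓡 4) (χ ξ)) = w := hw
  rw [entry_connForm_coordFrame he hχ hi, hw']

variable {W : Type*} [NormedAddCommGroup W] [InnerProductSpace ℝ W] {Φ : W → EndBundle M}
  {X : W → E₄} {Y : W → EuclideanSpace ℝ (Fin 3)} {x : W}

lemma mfderiv_proj_comp (hΦ : MDifferentiableAt 𝓘(ℝ, W) endModel Φ x)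
    (hX : DifferentiableAt ℝ X x) (hXΦ : ∀ᶠ x' in 𝓝 x, χ (X x') = (Φ x').proj)
    (hχ : MDifferentiableAt 𝓘(ℝ, E₄) (𝓡 4) χ (X x)) (v : W) :
    (mfderiv 𝓘(ℝ, E₄) (𝓡 4) χ (X x) (fderiv ℝ X x v) : E₄) =
      mfderiv endModel (𝓡 4) TotalSpace.proj (Φ x) (mfderiv 𝓘(ℝ, W) endModel Φ x v) := by
  have h : (χ ∘ X) =ᶠ[𝓝 x] TotalSpace.proj ∘ Φ := hXΦ
  have h1 := h.mfderiv_eq (I := 𝓘(ℝ, W)) (I' := 𝓡 4)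
  have h2 := mfderiv_comp x hχ hX.mdifferentiableAt
  have h3 := mfderiv_comp x (hasMFDerivAt_endBundle_proj (Φ x)).mdifferentiableAt hΦ
  rw [mfderiv_eq_fderiv] at h2
  exact congrArg (fun L : W →L[ℝ] E₄ => L v) (h2.symm.trans (h1.trans h3))

lemma mvfderiv_endEntry_comp (hΦ : MDifferentiableAt 𝓘(ℝ, W) endModel Φ x)
    (hY : DifferentiableAt ℝ Y x)
    (hYΦ : ∀ᶠ x' in 𝓝 x, ∀ a b, endEntry (e a) (e b) (Φ x') = asdMatrix (Y x') a b)
    (he : IsOrthonormalFrameAt e (Φ x).proj) (v : W) (a b : Fin 4) :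
    mvfderiv endModel (endEntry (e a) (e b)) (Φ x) (mfderiv 𝓘(ℝ, W) endModel Φ x v) =
      asdMatrix (fderiv ℝ Y x v) a b := by
  obtain ⟨L, hL, hLv⟩ := hasFDerivAt_asdMatrix hY a b v
  have h : (endEntry (e a) (e b) ∘ Φ) =ᶠ[𝓝 x] fun x' => asdMatrix (Y x') a b :=
    hYΦ.mono fun x' h => h a b
  have h1 := h.mfderiv_eq (I := 𝓘(ℝ, W)) (I' := 𝓘(ℝ, ℝ))
  have h2 := mfderiv_comp x
    (mdifferentiableAt_endEntry (he.1 a).mdiffFieldAt (he.1 b).mdiffFieldAt) hΦ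
  rw [← hLv]
  exact congrArg (fun L : W →L[ℝ] ℝ => L v)
    (h2.symm.trans (h1.trans hL.hasMFDerivAt.mfderiv))

/-- The connector in a frame, along a family of endomorphisms with matrices `asdMatrix (Y x)`. -/
lemma inner_connector_frame (hΦ : MDifferentiableAt 𝓘(ℝ, W) endModel Φ x)
    (hX : DifferentiableAt ℝ X x) (hXΦ : ∀ᶠ x' in 𝓝 x, χ (X x') = (Φ x').proj)
    (hY : DifferentiableAt ℝ Y x)
    (hYΦ : ∀ᶠ x' in 𝓝 x, ∀ a b, endEntry (e a) (e b) (Φ x') = asdMatrix (Y x') a b)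
    (he : ∀ᶠ q in 𝓝 (Φ x).proj, IsOrthonormalFrameAt e q)
    (hχ : ContMDiffAt 𝓘(ℝ, E₄) (𝓡 4) ∞ χ (X x))
    (hi : (mfderiv 𝓘(ℝ, E₄) (𝓡 4) χ (X x)).IsInvertible) (v : W) (a b : Fin 4) :
    inner ℝ (connector (Φ x) (mfderiv 𝓘(ℝ, W) endModel Φ x v) (e a (Φ x).proj))
        (e b (Φ x).proj) =
      asdMatrix (covDir (asdForm (pullForm X (connForm (coordFrame χ e)))) v Y x) a b := by
  have he' := he.self_of_nhds
  have hq : χ (X x) = (Φ x).proj := hXΦ.self_of_nhds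
  have hd : ∀ a, leviCivita (e a) (Φ x).proj (mfderiv endModel (𝓡 4) TotalSpace.proj (Φ x)
      (mfderiv 𝓘(ℝ, W) endModel Φ x v)) =
      ∑ c, entry (connForm (coordFrame χ e) (X x) (fderiv ℝ X x v)) a c • e c (Φ x).proj := by
    intro a
    simp only [fun c => entry_connForm_coordFrame_of_eq hq he hχ hi
      (mfderiv_proj_comp hΦ hX hXΦ (hχ.mdifferentiableAt (by simp)) v) a c]
    exact (he'.sum_inner_smul _).symm
  have hY0 : ∀ a b, inner ℝ ((Φ x).snd (e a (Φ x).proj)) (e b (Φ x).proj) =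
      asdMatrix (Y x) a b := hYΦ.self_of_nhds
  rw [inner_connector (Φ x) (he'.1 a).mdiffFieldAt (he'.1 b).mdiffFieldAt,
    mvfderiv_endEntry_comp hΦ hY hYΦ he', hd, hd, map_sum, sum_inner, inner_sum]
  simp only [map_smul, inner_smul_left, inner_smul_right, conj_trivial, hY0]
  exact asdMatrix_add_asdAct (isSkew_connForm _ _ _) _ _ _ _

/-- The pullback of the metric of the twistor space. -/
lemma twistorMetric_mfderiv (t : ℝ) (hΦ : MDifferentiableAt 𝓘(ℝ, W) endModel Φ x)
    (hX : DifferentiableAt ℝ X x) (hXΦ : ∀ᶠ x' in 𝓝 x, χ (X x') = (Φ x').proj)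
    (hY : DifferentiableAt ℝ Y x)
    (hYΦ : ∀ᶠ x' in 𝓝 x, ∀ a b, endEntry (e a) (e b) (Φ x') = asdMatrix (Y x') a b)
    (he : ∀ᶠ q in 𝓝 (Φ x).proj, IsOrthonormalFrameAt e q)
    (hχ : ContMDiffAt 𝓘(ℝ, E₄) (𝓡 4) ∞ χ (X x))
    (hi : (mfderiv 𝓘(ℝ, E₄) (𝓡 4) χ (X x)).IsInvertible) (v w : W) :
    twistorMetric t (Φ x) (mfderiv 𝓘(ℝ, W) endModel Φ x v) (mfderiv 𝓘(ℝ, W) endModel Φ x w) =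
      inner ℝ (coframe (coordFrame χ e) (X x) (fderiv ℝ X x v))
        (coframe (coordFrame χ e) (X x) (fderiv ℝ X x w)) +
      t ^ 2 * inner ℝ (covDir (asdForm (pullForm X (connForm (coordFrame χ e)))) v Y x)
        (covDir (asdForm (pullForm X (connForm (coordFrame χ e)))) w Y x) := by
  have he' := he.self_of_nhds
  have hq : χ (X x) = (Φ x).proj := hXΦ.self_of_nhds
  rw [twistorMetric_eq t he']
  simp only [inner_connector_frame hΦ hX hXΦ hY hYΦ he hχ hi]
  rw [sum_asdMatrix_mul, ← he'.sum_inner_mul_inner, PiLp.inner_apply]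
  have hc := fun v => coframe_coordFrame_of_eq hq he' hi
    (mfderiv_proj_comp hΦ hX hXΦ (hχ.mdifferentiableAt (by simp)) v)
  congr 1
  · refine Finset.sum_congr rfl fun c _ => ?_
    rw [hc, hc]
    exact mul_comm _ _
  · ring

end TwistorMetric

/-! ### Conformal charts of the twistor space -/

section TwistorChart

local notation "E₄" => EuclideanSpace ℝ (Fin 4)

variable {M : Type*} [TopologicalSpace M] [ChartedSpace E₄ M]
  [IsManifold (𝓡 4) ∞ M] [RiemannianBundle (fun p : M => TangentSpace (𝓡 4) p)]
  [IsContMDiffRiemannianBundle (𝓡 4) ∞ E₄ (fun p : M => TangentSpace (𝓡 4) p)]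

/-- A smooth orthonormal frame at `q`, which is negatively oriented. -/
def IsNegativeFrameAt (o : ManifoldOrientation M) (e : Fin 4 → Π p : M, TangentSpace (𝓡 4) p)
    (q : M) : Prop :=
  (∀ i, SmoothFieldAt (e i) q) ∧ ∃ b : OrthonormalBasis (Fin 4) ℝ (TangentSpace (𝓡 4) q),
    (∀ i, b i = e i q) ∧ b.toBasis.orientation = -o.orientation q

variable {o : ManifoldOrientation M} {e : Fin 4 → Π p : M, TangentSpace (𝓡 4) p}

lemma IsNegativeFrameAt.isOrthonormalFrameAt {q : M} (h : IsNegativeFrameAt o e q) :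
    IsOrthonormalFrameAt e q :=
  ⟨h.1, h.2.imp fun _ hb => hb.1⟩

/-- The coordinates of a point of the twistor space in its fibre. -/
noncomputable def fiberCoord (e : Fin 4 → Π p : M, TangentSpace (𝓡 4) p) (z : EndBundle M) :
    EuclideanSpace ℝ (Fin 3) :=
  WithLp.toLp 2 fun k => endEntry (e 0) (e k.succ) z

/-- The frame and the basis adapted to J are both negatively oriented, so the comparison of bases of
equal orientation applies: relative to a negative frame, Λ₋ has the self-dual shape of `asdMatrix`.
-/
lemma endEntry_eq_asdMatrix {z : EndBundle M} (hz : z ∈ twistorSpace o)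
    (he : IsNegativeFrameAt o e z.proj) :
    (∀ a b, endEntry (e a) (e b) z = asdMatrix (fiberCoord e z) a b) ∧
      inner ℝ (fiberCoord e z) (fiberCoord e z) = (1 : ℝ) := by
  obtain ⟨h1, h2, f, hfo, h01, h23⟩ := hz
  obtain ⟨-, b, hb, hbo⟩ := he
  have h := inner_eq_asdMatrix b f (hbo.trans hfo.symm)
    (z.snd : TangentSpace (𝓡 4) z.proj →ₗ[ℝ] TangentSpace (𝓡 4) z.proj) h1 h2 h01 h23
  have hy : firstRow b (z.snd : TangentSpace (𝓡 4) z.proj →ₗ[ℝ] TangentSpace (𝓡 4) z.proj) =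
      fiberCoord e z := by
    ext k
    simp only [firstRow, fiberCoord, endEntry, hb]
    rfl
  rw [hy] at h
  simp only [hb] at h
  exact h

/-- The whole sphere is attained, so the curvature identity becomes available for every orthonormal
basis of three-space. -/
lemma exists_mem_twistorSpace {p : M} (he : IsNegativeFrameAt o e p)
    (f : OrthonormalBasis (Fin 3) ℝ (EuclideanSpace ℝ (Fin 3))) :
    ∃ z ∈ twistorSpace o, z.proj = p ∧ fiberCoord e z = f 2 := by
  obtain ⟨-, b, hb, hbo⟩ := he
  obtain ⟨e', heo, h01, h23⟩ := exists_adapted_basis b f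
  have hf : inner ℝ (f 2) (f 2) = (1 : ℝ) :=
    (orthonormal_iff_ite.mp f.orthonormal 2 2).trans (if_pos rfl)
  refine ⟨⟨p, LinearMap.toContinuousLinearMap (asdEnd b (f 2))⟩,
    ⟨asdEnd_asdEnd b hf, inner_asdEnd_asdEnd b hf, e', heo.trans hbo, h01, h23⟩, rfl, ?_⟩
  ext k
  simp only [fiberCoord, endEntry, ← hb]
  change inner ℝ (asdEnd b (f 2) (b 0)) (b k.succ) = _
  rw [asdEnd_apply, sum_inner]
  simp only [inner_smul_left, orthonormal_iff_ite.mp b.orthonormal]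
  fin_cases k <;> simp [asdMatrix]

variable {p : M}

lemma eventually_chart (he : ∀ᶠ q in 𝓝 p, IsNegativeFrameAt o e q) :
    ∀ᶠ ξ in 𝓝 (extChartAt (𝓡 4) p p),
      ContMDiffAt 𝓘(ℝ, E₄) (𝓡 4) ∞ (extChartAt (𝓡 4) p).symm ξ ∧
      (mfderiv 𝓘(ℝ, E₄) (𝓡 4) (extChartAt (𝓡 4) p).symm ξ).IsInvertible ∧
      ∀ᶠ q in 𝓝 ((extChartAt (𝓡 4) p).symm ξ), IsNegativeFrameAt o e q := by
  have h1 : ContinuousAt (extChartAt (𝓡 4) p).symm (extChartAt (𝓡 4) p p) :=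
    continuousAt_extChartAt_symm p
  have h2 : Filter.Tendsto (extChartAt (𝓡 4) p).symm (𝓝 (extChartAt (𝓡 4) p p)) (𝓝 p) := by
    simpa only [ContinuousAt, extChartAt_to_inv] using h1
  filter_upwards [extChartAt_target_mem_nhds (I := 𝓡 4) p, h2.eventually he.eventually_nhds,
    (isOpen_extChartAt_target (I := 𝓡 4) p).mem_nhds (mem_extChartAt_target p)] with ξ h3 h4 _
  refine ⟨(contMDiffOn_extChartAt_symm p).contMDiffAt
    ((isOpen_extChartAt_target (I := 𝓡 4) p).mem_nhds h3), ?_, h4⟩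
  have h := isInvertible_mfderivWithin_extChartAt_symm h3
  rwa [ModelWithCorners.range_eq_univ, mfderivWithin_univ] at h

/-- The base point of a family of endomorphisms, in the chart of `M` at `p`. -/
noncomputable def baseCoord {W : Type*} (p : M) (Φ : W → EndBundle M) (x : W) : E₄ :=
  extChartAt (𝓡 4) p (Φ x).proj

/-- Smoothness of Φ in End(TM) makes base coordinates and matrix entries smooth; membership in the
twistor space gives the shape of the matrix and the unit length, and `twistorMetric_mfderiv`
rewrites the conformality. -/
lemma conformalTwistorChart_of_conformal {W : Type*} [NormedAddCommGroup W]
    [InnerProductSpace ℝ W] {t : ℝ} {Φ : W → EndBundle M} {ρ : W → ℝ} {x₀ : W}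
    (he : ∀ᶠ q in 𝓝 (Φ x₀).proj, IsNegativeFrameAt o e q)
    (hΦ : ∀ᶠ x in 𝓝 x₀, ContMDiffAt 𝓘(ℝ, W) endModel ∞ Φ x)
    (hmem : ∀ᶠ x in 𝓝 x₀, Φ x ∈ twistorSpace o) (hρ : ContDiffAt ℝ ∞ ρ x₀) (hpos : 0 < ρ x₀)
    (hc : ∀ᶠ x in 𝓝 x₀, ∀ v w : W, twistorMetric t (Φ x) (mfderiv 𝓘(ℝ, W) endModel Φ x v)
      (mfderiv 𝓘(ℝ, W) endModel Φ x w) = ρ x * inner ℝ v w) :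
    ConformalTwistorChart t (coordFrame (extChartAt (𝓡 4) (Φ x₀).proj).symm e)
      (extChartAt (𝓡 4) (Φ x₀).proj (Φ x₀).proj) x₀ (baseCoord (Φ x₀).proj Φ)
      (fun x => fiberCoord e (Φ x)) ρ := by
  have hP : ∀ᶠ x in 𝓝 x₀, ContMDiffAt 𝓘(ℝ, W) (𝓡 4) ∞ (fun x => (Φ x).proj) x :=
    hΦ.mono fun x hx => (contMDiffAt_proj _).comp x hx
  have hPt : Filter.Tendsto (fun x => (Φ x).proj) (𝓝 x₀) (𝓝 (Φ x₀).proj) :=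
    hP.self_of_nhds.continuousAt
  have hsrc : ∀ᶠ x in 𝓝 x₀, (Φ x).proj ∈ (chartAt E₄ (Φ x₀).proj).source :=
    hPt.eventually (chart_source_mem_nhds E₄ _)
  have hXs : ∀ᶠ x in 𝓝 x₀, ContDiffAt ℝ ∞ (baseCoord (Φ x₀).proj Φ) x := by
    filter_upwards [hP, hsrc] with x h1 h2
    exact ((contMDiffAt_extChartAt' h2).comp x h1).contDiffAt
  have hYs : ∀ᶠ x in 𝓝 x₀, ContDiffAt ℝ ∞ (fun x => fiberCoord e (Φ x)) x := by
    filter_upwards [hΦ, hPt.eventually he] with x h1 h2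
    refine contDiffAt_piLp' 2 fun k => ?_
    exact ((contMDiffAt_endEntry (h2.1 0) (h2.1 k.succ)).comp x h1).contDiffAt
  have hYe : ∀ᶠ x in 𝓝 x₀,
      (∀ a b, endEntry (e a) (e b) (Φ x) = asdMatrix (fiberCoord e (Φ x)) a b) ∧
      inner ℝ (fiberCoord e (Φ x)) (fiberCoord e (Φ x)) = (1 : ℝ) := by
    filter_upwards [hmem, hPt.eventually he] with x h1 h2 using endEntry_eq_asdMatrix h1 h2
  have hXΦ : ∀ᶠ x in 𝓝 x₀,
      (extChartAt (𝓡 4) (Φ x₀).proj).symm (baseCoord (Φ x₀).proj Φ x) = (Φ x).proj :=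
    hsrc.mono fun x h => (extChartAt (𝓡 4) (Φ x₀).proj).left_inv (by rwa [extChartAt_source])
  have hXt : Filter.Tendsto (baseCoord (Φ x₀).proj Φ) (𝓝 x₀)
      (𝓝 (extChartAt (𝓡 4) (Φ x₀).proj (Φ x₀).proj)) :=
    hXs.self_of_nhds.continuousAt
  refine ⟨rfl, hXs.self_of_nhds.of_le ENat.LEInfty.out, hYs.self_of_nhds.of_le ENat.LEInfty.out,
    hρ.of_le ENat.LEInfty.out, hpos, hYe.mono fun _ h => h.2, ?_⟩
  filter_upwards [hΦ, hXs, hYs, hYe.eventually_nhds, hXΦ.eventually_nhds,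
    hXt.eventually (eventually_chart he), hPt.eventually he.eventually_nhds, hc]
    with x h1 h2 h3 h4 h5 h6 h7 h8 v w
  refine Eq.trans ?_ (h8 v w)
  exact (twistorMetric_mfderiv t (h1.mdifferentiableAt (by simp))
    (h2.differentiableAt (by simp)) h5 (h3.differentiableAt (by simp)) (h4.mono fun _ h => h.1)
    (h7.mono fun _ h => h.isOrthonormalFrameAt) h6.1 h6.2.1 v w).symm

lemma exists_conformalTwistorChart {t : ℝ}
    (hL : IsLocallyConformallyFlat 6 (twistorSpace o) (twistorMetric t))
    (he : ∀ᶠ q in 𝓝 p, IsNegativeFrameAt o e q) {z : EndBundle M} (hz : z ∈ twistorSpace o)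
    (hzp : z.proj = p) :
    ∃ x₀ X Y ρ, ConformalTwistorChart (W := EuclideanSpace ℝ (Fin 6)) t
      (coordFrame (extChartAt (𝓡 4) p).symm e) (extChartAt (𝓡 4) p p) x₀ X Y ρ ∧
      Y x₀ = fiberCoord e z := by
  obtain ⟨φ, ρ, hzφ, hΦ, hρ, hc⟩ := hL ⟨z, hz⟩
  have htar := φ.open_target.mem_nhds (φ.map_source hzφ)
  have hz₀ : (φ.symm (φ ⟨z, hz⟩) : EndBundle M) = z := congrArg Subtype.val (φ.left_inv hzφ)
  have hp₀ : (φ.symm (φ ⟨z, hz⟩) : EndBundle M).proj = p := by rw [hz₀, hzp]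
  have h := conformalTwistorChart_of_conformal (t := t) (Φ := fun x => (φ.symm x : EndBundle M))
    (x₀ := φ ⟨z, hz⟩) (ρ := ρ) (hp₀.symm ▸ he)
    (Filter.mem_of_superset htar fun x hx => hΦ.contMDiffAt (φ.open_target.mem_nhds hx))
    (Filter.Eventually.of_forall fun x => (φ.symm x).2) (hρ.contDiffAt htar)
    (hc _ (φ.map_source hzφ)).1 (Filter.mem_of_superset htar fun x hx => (hc x hx).2)
  rw [hp₀] at h
  exact ⟨_, _, _, _, h, congrArg (fiberCoord e) hz₀⟩

end TwistorChart

theorem theorem2p1 {M : Type*} [TopologicalSpace M] [T2Space M] [Nonempty M]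
    [ChartedSpace (EuclideanSpace ℝ (Fin 4)) M] [IsManifold (𝓡 4) ∞ M]
    [RiemannianBundle (fun p : M => TangentSpace (𝓡 4) p)]
    [IsContMDiffRiemannianBundle (𝓡 4) ∞ (EuclideanSpace ℝ (Fin 4))
      (fun p : M => TangentSpace (𝓡 4) p)]
    (o : ManifoldOrientation M) (t : ℝ) (ht : 0 < t) :
    ¬ IsLocallyConformallyFlat 6 (twistorSpace o) (twistorMetric t) := by
  intro hL
  obtain ⟨p⟩ := ‹Nonempty M›
  obtain ⟨e, he⟩ := exists_orthonormal_frame o p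
  have he : ∀ᶠ q in 𝓝 p, IsNegativeFrameAt o e q := he
  have hch := eventually_chart he
  refine not_forall_conformalTwistorChart (W := EuclideanSpace ℝ (Fin 6)) (t := t)
    (ε := coordFrame (extChartAt (𝓡 4) p).symm e) (ξ₀ := extChartAt (𝓡 4) p p) ht.ne' (by simp)
    (fun a => ?_) ?_ fun f => ?_
  · obtain ⟨h1, h2, h3⟩ := hch.self_of_nhds
    exact (contDiffAt_coordFrame h3.self_of_nhds.isOrthonormalFrameAt h1 h2 a).of_le
      ENat.LEInfty.out
  · filter_upwards [hch] with ξ h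
    exact isInvertible_frameMap h.2.2.self_of_nhds.isOrthonormalFrameAt h.2.1
  -- The basis `f` selects the point of the fibre over `p`, and flatness is applied at that point.
  · obtain ⟨z, hz, hzp, hzf⟩ := exists_mem_twistorSpace he.self_of_nhds f
    obtain ⟨x₀, X, Y, ρ, hc, hY⟩ := exists_conformalTwistorChart hL he hz hzp
    exact ⟨x₀, X, Y, ρ, hc, hY.trans hzf⟩
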